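/- All graphs are finite, undirected and simple. For a graph $G$ with vertex set $V$, a $G$-partial matrix is a real symmetric matrix $X$ indexed by $V$ whose entries are specified exactly on the diagonal and at the edges of $G$. It is *PSD-completable* if the unspecified entries can be chosen so that the resulting real symmetric matrix is positive semidefinite, and *$G$-locally PSD* if for every clique $S$ of $G$ the submatrix $X|_S$ is positive semidefinite. Let $I_G$ be the $G$-partial matrix with ones on the diagonal and zeros at the edges, and put \[ \epsilon_G(X)=\min\{\epsilon\in\mathbb R : X+\epsilon I_G \text{ is PSD-completable}\},\qquad \epsilon(G)=\max\{\epsilon_G(X) : X \text{ is } G\text{-locally PSD},\ \operatorname{tr}X=1\}. \] A graph is *chordal* if it has no induced cycle with at least $4$ vertices; the *chordal girth* of a graph is the number of vertices of its smallest induced cycle with at least $4$ vertices, and $\infty$ if the graph is chordal. A graph is *series parallel* if it has no $K_4$ minor. The $g$-vertex cycle is denoted $\mathcal O_g$. Let $D$ be a finite multidigraph with vertex set $V(D)$, edge set $E(D)$ and tail and head maps $t,h:E(D)\to V(D)$ with $t(e)\ne h(e)$ for all $e$. For each $e\in E(D)$ let $C_e$ be a connected chordal graph with two distinct distinguished vertices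 $T(e),H(e)$, and let $D/\{C_e\}$ be the graph obtained from the disjoint union of all $C_e$ and $V(D)$ by identifying $T(e)$ with $t(e)$ and $H(e)$ with $h(e)$ for every $e$ (parallel edges that arise are merged). It is called a *thickening* of $D$ if every triangle of $D/\{C_e\}$ is a triangle (with its three edges) of some $C_e$. **Corollary.** Suppose that the undirected simple graph underlying $D$ is triangle-free and series parallel, and that $G=D/\{C_e\}$ is a thickening of $D$. Let $g$ be the chordal girth of $G$. * If $g<\infty$, then \[ \epsilon(G)=\epsilon(\mathcal O_g)=\frac1g\left(\frac1{\cos(\pi/g)}-1\right). \] * If $g=\infty$ and $G$ has at least two vertices, then $\epsilon(G)=0$ (the limit of the formula as $g\to\infty$). -/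

import Mathlib

/-! ### Graphs

A graph is a `SimpleGraph`; the loops `{i, i}` that partial matrices use are added in
`IsSpecified` below. -/

/-- `G` has an induced cycle with exactly `n ≥ 4` vertices (a hole of length `n`). -/
def HasHole {V : Type*} (G : SimpleGraph V) (n : ℕ) : Prop :=
  4 ≤ n ∧ ∃ S : Set V, Nonempty (G.induce S ≃g SimpleGraph.cycleGraph n)

/-- `G` is chordal: it has no induced cycle with at least four vertices. -/
def IsChordal {V : Type*} (G : SimpleGraph V) : Prop :=
  ∀ n : ℕ, ¬ HasHole G n

/-- The chordal girth: the number of vertices of a smallest induced cycle with at least four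
vertices, and `⊤` if there is none. -/
noncomputable def chordalGirth {V : Type*} (G : SimpleGraph V) : ℕ∞ :=
  sInf {m : ℕ∞ | ∃ n : ℕ, HasHole G n ∧ m = (n : ℕ∞)}

/-- `G` is series parallel: it has no `K₄` minor, i.e. there are no four pairwise disjoint,
(nonempty) connected, pairwise adjacent sets of vertices. For connected `G` this says that no
sequence of edge contractions of `G` results in `K₄`. -/
def IsSeriesParallel {V : Type*} (G : SimpleGraph V) : Prop :=
  ¬ ∃ B : Fin 4 → Set V,
    (∀ i, (G.induce (B i)).Connected) ∧
    (∀ i j, i ≠ j → Disjoint (B i) (B j)) ∧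
    (∀ i j, i ≠ j → ∃ u ∈ B i, ∃ v ∈ B j, G.Adj u v)

/-! ### Partial matrices and the additive distance -/

/-- The positions at which a `G`-partial matrix is specified: the diagonal and the edges. -/
def IsSpecified {V : Type*} (G : SimpleGraph V) (z : Sym2 V) : Prop :=
  z.IsDiag ∨ z ∈ G.edgeSet

/-- The vector space `Sym(G)` of (symmetric) `G`-partial matrices. -/
abbrev PartialMatrix {V : Type*} (G : SimpleGraph V) : Type _ :=
  {z : Sym2 V // IsSpecified G z} → ℝ

theorem isSpecified_diag {V : Type*} (G : SimpleGraph V) (i : V) : IsSpecified G s(i, i) :=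
  Or.inl (Sym2.mk_isDiag_iff.mpr rfl)

theorem isSpecified_of_isClique {V : Type*} {G : SimpleGraph V} {C : Set V} (hC : G.IsClique C)
    (i j : C) : IsSpecified G s((i : V), (j : V)) := by
  by_cases h : (i : V) = j
  · exact Or.inl (Sym2.mk_isDiag_iff.mpr h)
  · exact Or.inr (hC i.2 j.2 h)

namespace PartialMatrix

/-- The fully specified submatrix `X|_C` on a clique `C`. -/
def cliqueSubmatrix {V : Type*} {G : SimpleGraph V} (X : PartialMatrix G) {C : Set V}
    (hC : G.IsClique C) : Matrix C C ℝ :=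
  Matrix.of fun i j => X ⟨s((i : V), (j : V)), isSpecified_of_isClique hC i j⟩

/-- `X` is PSD-completable, i.e. `X ∈ SOS(G)`. -/
def IsCompletable {V : Type*} {G : SimpleGraph V} (X : PartialMatrix G) : Prop :=
  ∃ M : Matrix V V ℝ, M.PosSemidef ∧
    ∀ (i j : V) (h : IsSpecified G s(i, j)), M i j = X ⟨s(i, j), h⟩

/-- `X` is `G`-locally PSD, i.e. `X ∈ POS(G)`. -/
def IsLocallyPSD {V : Type*} {G : SimpleGraph V} (X : PartialMatrix G) : Prop :=
  ∀ (C : Set V) (hC : G.IsClique C), (X.cliqueSubmatrix hC).PosSemidef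

/-- The trace of a partial matrix. -/
def trace {V : Type*} [Fintype V] {G : SimpleGraph V} (X : PartialMatrix G) : ℝ :=
  ∑ i : V, X ⟨s(i, i), isSpecified_diag G i⟩

open Classical in
/-- `I_G`, the projection of the identity matrix to `Sym(G)`. -/
noncomputable def identity {V : Type*} (G : SimpleGraph V) : PartialMatrix G :=
  fun z => if z.1.IsDiag then 1 else 0

/-- `ε_G(X)`, the least real `ε` (of either sign) such that `X + ε I_G` is PSD-completable.
For a nonempty finite vertex set, the set is nonempty, closed and bounded below, so that the
infimum is a minimum. -/
noncomputable def defect {V : Type*} {G : SimpleGraph V} (X : PartialMatrix G) : ℝ :=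
  sInf {ε : ℝ | IsCompletable (X + ε • identity G)}

end PartialMatrix

/-- The additive distance `ε(G)`, the maximum of `ε_G(X)` over the `G`-locally PSD partial
matrices `X` of trace one. For a nonempty finite vertex set these form a nonempty compact set,
so that the supremum is a maximum. -/
noncomputable def additiveDistance {V : Type*} [Fintype V] (G : SimpleGraph V) : ℝ :=
  sSup {ε : ℝ | ∃ X : PartialMatrix G, X.IsLocallyPSD ∧ X.trace = 1 ∧ ε = X.defect}

/-! ### Multidigraphs and thickenings -/

/-- A multidigraph without loops, with vertices `V` and edges `E`. -/
structure Multidigraph (V : Type*) (E : Type*) where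
  tail : E → V
  head : E → V
  tail_ne_head : ∀ e, tail e ≠ head e

namespace Multidigraph

/-- The undirected (simple) graph associated with a multidigraph. -/
def undirected {V E : Type*} (D : Multidigraph V E) : SimpleGraph V where
  Adj i j := ∃ e, (D.tail e = i ∧ D.head e = j) ∨ (D.tail e = j ∧ D.head e = i)
  symm := ⟨fun _ _ ⟨e, h⟩ => ⟨e, h.symm⟩⟩
  loopless := ⟨by
    rintro i ⟨e, ⟨h, h'⟩ | ⟨h, h'⟩⟩ <;> exact D.tail_ne_head e (h.trans h'.symm)⟩

/-- The identifications `T(e) ∼ t(e)` and `H(e) ∼ h(e)` on the disjoint union of the `V(C_e)`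
and of `V(D)`. -/
inductive GlueRel {V E : Type*} (D : Multidigraph V E) {W : E → Type*} (T H : ∀ e, W e) :
    (Σ e, W e) ⊕ V → (Σ e, W e) ⊕ V → Prop
  | tail (e : E) : GlueRel D T H (Sum.inl ⟨e, T e⟩) (Sum.inr (D.tail e))
  | head (e : E) : GlueRel D T H (Sum.inl ⟨e, H e⟩) (Sum.inr (D.head e))

/-- The vertex set of `D / {C_e}`: the quotient by the equivalence relation that the
identifications generate. -/
def GlueVertex {V E : Type*} (D : Multidigraph V E) {W : E → Type*} (T H : ∀ e, W e) : Type _ :=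
  Quot (GlueRel D T H)

noncomputable instance {V E : Type*} [Finite V] [Finite E] (D : Multidigraph V E)
    {W : E → Type*} [∀ e, Finite (W e)] (T H : ∀ e, W e) : Fintype (GlueVertex D T H) :=
  haveI : Finite (GlueVertex D T H) := inferInstanceAs (Finite (Quot (GlueRel D T H)))
  Fintype.ofFinite _

/-- The map `V(C_e) → V(D / {C_e})`. -/
def glueMap {V E : Type*} (D : Multidigraph V E) {W : E → Type*} (T H : ∀ e, W e) (e : E)
    (a : W e) : GlueVertex D T H :=
  Quot.mk _ (Sum.inl ⟨e, a⟩)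

/-- The graph `D / {C_e}`; its edges are the images of the edges of the `C_e`. -/
def glue {V E : Type*} (D : Multidigraph V E) {W : E → Type*} (C : ∀ e, SimpleGraph (W e))
    (T H : ∀ e, W e) : SimpleGraph (GlueVertex D T H) where
  Adj x y := x ≠ y ∧
    ∃ e a b, (C e).Adj a b ∧ glueMap D T H e a = x ∧ glueMap D T H e b = y
  symm := ⟨fun _ _ ⟨hne, e, a, b, hab, ha, hb⟩ => ⟨hne.symm, e, b, a, hab.symm, hb, ha⟩⟩
  loopless := ⟨fun _ h => h.1 rfl⟩

/-- `D / {C_e}` is a thickening of `D`: every triangle of `D / {C_e}` is (the image of) a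
triangle of one of the graphs `C_e`. -/
def IsThickening {V E : Type*} (D : Multidigraph V E) {W : E → Type*}
    (C : ∀ e, SimpleGraph (W e)) (T H : ∀ e, W e) : Prop :=
  ∀ x y z, (glue D C T H).Adj x y → (glue D C T H).Adj y z → (glue D C T H).Adj x z →
    ∃ e a b c, (C e).Adj a b ∧ (C e).Adj b c ∧ (C e).Adj a c ∧
      glueMap D T H e a = x ∧ glueMap D T H e b = y ∧ glueMap D T H e c = z

end Multidigraph

/-! Lower bound. A shortest hole is an induced `g`-cycle, and extension by zero along it preserves
local positivity and trace. On the cycle, take all specified entries `1/g`, except `-1/g` at one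
edge. A completion after a shift by `ε` is a Gram matrix of vectors of equal length: `g - 1`
consecutive angles equal some `θ` and the closing angle is `π - θ`. The triangle inequality for
angles gives `π ≤ g θ`, which is the bound (`le_of_isCompletable_oddCycleMatrix`).

Upper bound. On each chordal `C_e` the partial matrix has a completion `M e`
(`IsChordal.isCompletable`), and the pieces meet only at vertices of `D`. By
`Matrix.PosSemidef.exists_split`, `M e` is a convex combination of two rank one matrices, whose
entries at `T e` and `H e` have the extreme moduli, plus a matrix that vanishes there. The shift is
a multiple of the trace, so completability is additive, and all `M e` may be assumed to have rank
one (`IsLocalFamily.isCompletableFamily`).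

The signs of the rank one entries define a double cover of the glued graph. In a thickening each
triangle lies in one `C_e`, so triangles are even, and a shortest odd closed walk is a hole: odd
closed walks have at least `g` steps (`IsTriangleEvenCover.exists_hasHole`). After the shift,
adjacent vertices of weights `A` and `B` must enclose the angle `edgeAngle ε A B`. Collapsing the
distance layers of `C_e` to a chain of weighted nodes yields completions in which `T e` and `H e`
enclose any angle, at most `π`, between their own `edgeAngle` and the sum along the chain
(`exists_completion_of_angle`).

It remains to choose angles on `D` consistently. Angular path lengths in the double cover of the
subdivided `D`, cut off by complements of base angles, define a pseudometric. Convexity of `A ↦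
edgeAngle ε A A` and the value of `ε` make every odd closed path at least `π` long
(`pi_le_sum_edgeAngle`), so opposite points are at distance `π`. On a series parallel graph such a
metric is realized by unit vectors: remove a vertex with at most two neighbours and solve one
spherical triangle (`IsSeriesParallel.exists_posSemidef`). Finally `exists_glued` assembles the
pieces. -/

open SimpleGraph

open scoped InnerProductSpace

/-! ### Gram representations, amalgamation and splitting of positive semidefinite matrices -/

namespace Matrix.PosSemidef

/-- A real positive semidefinite matrix is the Gram matrix of a finite family of vectors. -/
theorem exists_gram {ι : Type*} [Fintype ι] {M : Matrix ι ι ℝ} (hM : M.PosSemidef) :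
    ∃ x : ι → EuclideanSpace ℝ ι, ∀ i j, M i j = ⟪x i, x j⟫_ℝ := by
  classical
  obtain ⟨B, hB⟩ : ∃ B : Matrix ι ι ℝ, M = B.conjTranspose * B := by
    open scoped MatrixOrder in
    obtain ⟨B, hB⟩ := CStarAlgebra.nonneg_iff_eq_star_mul_self.mp hM.nonneg
    exact ⟨B, by rw [hB, Matrix.star_eq_conjTranspose]⟩
  refine ⟨fun i => WithLp.toLp 2 fun k => B k i, fun i j => ?_⟩
  rw [hB, Matrix.mul_apply]
  simp [PiLp.inner_apply, mul_comm]

/-- The Gram matrix of a family of vectors, given by its entries, is positive semidefinite. -/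
theorem of_inner {ι F : Type*} [Finite ι] [NormedAddCommGroup F] [InnerProductSpace ℝ F]
    {M : Matrix ι ι ℝ} (x : ι → F) (h : ∀ i j, M i j = ⟪x i, x j⟫_ℝ) : M.PosSemidef := by
  have : M = Matrix.gram ℝ x := by ext i j; exact h i j
  rw [this]; exact Matrix.posSemidef_gram ℝ x

/-- Extension of a positive semidefinite matrix along an injective map. -/
theorem exists_extend {ι κ : Type*} [Finite ι] [Finite κ] {M : Matrix ι ι ℝ} (hM : M.PosSemidef)
    {f : ι → κ} (hf : Function.Injective f) :
    ∃ N : Matrix κ κ ℝ, N.PosSemidef ∧ ∀ i j, N (f i) (f j) = M i j := by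
  classical
  cases nonempty_fintype ι
  obtain ⟨x, hx⟩ := hM.exists_gram
  refine ⟨Matrix.gram ℝ (Function.extend f x 0), Matrix.posSemidef_gram ℝ _, fun i j => ?_⟩
  rw [Matrix.gram_apply, hf.extend_apply, hf.extend_apply, hx]

/-- Extension by zero of a positive semidefinite matrix along an injective map. -/
theorem exists_extend_zero {ι κ : Type*} [Finite ι] [Finite κ] {M : Matrix ι ι ℝ}
    (hM : M.PosSemidef) {f : ι → κ} (hf : Function.Injective f) :
    ∃ N : Matrix κ κ ℝ, N.PosSemidef ∧ (∀ i j, N (f i) (f j) = M i j) ∧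
      ∀ k l, (k ∉ Set.range f ∨ l ∉ Set.range f) → N k l = 0 := by
  classical
  cases nonempty_fintype ι
  obtain ⟨x, hx⟩ := hM.exists_gram
  refine ⟨Matrix.gram ℝ (Function.extend f x 0), Matrix.posSemidef_gram ℝ _, fun i j => ?_,
    fun k l h => ?_⟩
  · rw [Matrix.gram_apply, hf.extend_apply, hf.extend_apply, hx]
  · rw [Matrix.gram_apply]
    rcases h with h | h
    · rw [Function.extend_apply' _ _ _ (by simpa using h)]; simp
    · rw [Function.extend_apply' _ _ l (by simpa using h)]; simp

/-- Two families of vectors with the same Gram matrix are related by a linear isometry. -/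
theorem _root_.exists_linearIsometry_of_inner_eq {ι F : Type*} [NormedAddCommGroup F]
    [InnerProductSpace ℝ F] [FiniteDimensional ℝ F] (x y : ι → F)
    (h : ∀ i j, ⟪x i, x j⟫_ℝ = ⟪y i, y j⟫_ℝ) : ∃ U : F →ₗᵢ[ℝ] F, ∀ i, U (y i) = x i := by
  classical
  let Ly : (ι →₀ ℝ) →ₗ[ℝ] F := Finsupp.linearCombination ℝ y
  let Lx : (ι →₀ ℝ) →ₗ[ℝ] F := Finsupp.linearCombination ℝ x
  -- Norms of linear combinations depend only on the Gram matrix, so `y i ↦ x i` is well defined and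
  -- isometric on the span of `y`; in finite dimension it extends.
  have hin : ∀ c : ι →₀ ℝ, ‖Lx c‖ = ‖Ly c‖ := by
    intro c
    have : ⟪Lx c, Lx c⟫_ℝ = ⟪Ly c, Ly c⟫_ℝ := by
      simp only [Lx, Ly, Finsupp.linearCombination_apply, Finsupp.sum, sum_inner, inner_sum,
        real_inner_smul_left, real_inner_smul_right, h]
    rw [real_inner_self_eq_norm_sq, real_inner_self_eq_norm_sq] at this
    exact (sq_eq_sq₀ (norm_nonneg _) (norm_nonneg _)).mp this
  have hker : LinearMap.ker Ly ≤ LinearMap.ker Lx := by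
    intro c hc
    rw [LinearMap.mem_ker] at hc ⊢
    rw [← norm_eq_zero, hin, hc, norm_zero]
  let g : LinearMap.range Ly →ₗ[ℝ] F :=
    ((LinearMap.ker Ly).liftQ Lx hker).comp Ly.quotKerEquivRange.symm.toLinearMap
  have hg : ∀ c, g ⟨Ly c, LinearMap.mem_range_self Ly c⟩ = Lx c := by
    intro c
    have : Ly.quotKerEquivRange.symm ⟨Ly c, LinearMap.mem_range_self Ly c⟩ =
        (LinearMap.ker Ly).mkQ c := by
      rw [LinearEquiv.symm_apply_eq]; rfl
    simp only [g, LinearMap.comp_apply, LinearEquiv.coe_coe, this]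
    simp
  let gi : LinearMap.range Ly →ₗᵢ[ℝ] F := ⟨g, by
    rintro ⟨_, c, rfl⟩
    rw [hg, hin]; rfl⟩
  refine ⟨gi.extend, fun i => ?_⟩
  have h1 : Ly (Finsupp.single i 1) = y i := by simp [Ly]
  have h2 : Lx (Finsupp.single i 1) = x i := by simp [Lx]
  have := gi.extend_apply ⟨Ly (Finsupp.single i 1), LinearMap.mem_range_self Ly _⟩
  rw [← h2, ← hg, ← h1]
  exact this

/-- Amalgamation of two positive semidefinite matrices that agree on `A ∩ B`. -/
theorem exists_amalgam {ι : Type*} [Finite ι] {M N : Matrix ι ι ℝ} (hM : M.PosSemidef)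
    (hN : N.PosSemidef) (A B : Set ι)
    (h : ∀ i ∈ A ∩ B, ∀ j ∈ A ∩ B, M i j = N i j) :
    ∃ P : Matrix ι ι ℝ, P.PosSemidef ∧ (∀ i ∈ A, ∀ j ∈ A, P i j = M i j) ∧
      ∀ i ∈ B, ∀ j ∈ B, P i j = N i j := by
  classical
  cases nonempty_fintype ι
  obtain ⟨x, hx⟩ := hM.exists_gram
  obtain ⟨y, hy⟩ := hN.exists_gram
  -- The Gram vectors of `N` are moved by an isometry that matches them with those of `M` on the
  -- overlap.
  obtain ⟨U, hU⟩ := exists_linearIsometry_of_inner_eq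
    (fun i : (A ∩ B : Set ι) => x i) (fun i : (A ∩ B : Set ι) => y i)
    (fun i j => by rw [← hx, ← hy, h i i.2 j j.2])
  let z : ι → EuclideanSpace ℝ ι := fun i => if i ∈ A then x i else U (y i)
  have hzA : ∀ i ∈ A, z i = x i := fun i hi => if_pos hi
  have hzB : ∀ i ∈ B, z i = U (y i) := by
    intro i hi
    by_cases hA : i ∈ A
    · rw [hzA i hA, hU ⟨i, hA, hi⟩]
    · exact if_neg hA
  refine ⟨Matrix.gram ℝ z, Matrix.posSemidef_gram ℝ z, fun i hi j hj => ?_, fun i hi j hj => ?_⟩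
  · rw [Matrix.gram_apply, hzA i hi, hzA j hj, hx]
  · rw [Matrix.gram_apply, hzB i hi, hzB j hj, hy, U.inner_map_map]

theorem of_mul_self {ι : Type*} [Finite ι] (x : ι → ℝ) :
    (Matrix.of fun i j => x i * x j : Matrix ι ι ℝ).PosSemidef :=
  of_inner x fun i j => by simp [mul_comm]

/-- The Gram vectors are scaled one by one; this serves both for changes of sign and for changes of
length. -/
theorem mul_sign {ι : Type*} {M : Matrix ι ι ℝ} [Finite ι] (hM : M.PosSemidef) (s : ι → ℝ) :
    (Matrix.of fun i j => s i * s j * M i j : Matrix ι ι ℝ).PosSemidef := by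
  cases nonempty_fintype ι
  obtain ⟨x, hx⟩ := hM.exists_gram
  refine of_inner (fun i => s i • x i) fun i j => ?_
  rw [Matrix.of_apply, real_inner_smul_left, real_inner_smul_right, hx, mul_assoc]

theorem symm_apply {ι : Type*} {M : Matrix ι ι ℝ} (hM : M.PosSemidef) (i j : ι) :
    M i j = M j i := by
  simpa using hM.1.apply j i

theorem sq_le {ι : Type*} [Finite ι] {M : Matrix ι ι ℝ} (hM : M.PosSemidef) (i j : ι) :
    M i j ^ 2 ≤ M i i * M j j := by
  cases nonempty_fintype ι
  obtain ⟨x, hx⟩ := hM.exists_gram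
  rw [hx, hx, hx, real_inner_self_eq_norm_sq, real_inner_self_eq_norm_sq, ← mul_pow]
  exact sq_le_sq.mpr ((abs_real_inner_le_norm _ _).trans (le_abs_self _))

theorem abs_le_sqrt {ι : Type*} [Finite ι] {M : Matrix ι ι ℝ} (hM : M.PosSemidef) (i j : ι) :
    |M i j| ≤ √(M i i) * √(M j j) := by
  rw [← Real.sqrt_mul hM.diag_nonneg]
  exact Real.abs_le_sqrt (hM.sq_le i j)

/-- Splitting off a matrix of rank one that carries a given diagonal entry. -/
theorem exists_split_one {ι : Type*} [Finite ι] {M : Matrix ι ι ℝ} (hM : M.PosSemidef) (s : ι) :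
    ∃ p : ι → ℝ, (Matrix.of fun i j => M i j - p i * p j).PosSemidef ∧ p s = √(M s s) ∧
      ∀ t, M t t = 0 → p t = 0 := by
  cases nonempty_fintype ι
  obtain ⟨x, hx⟩ := hM.exists_gram
  -- `p` is the component along the unit vector of `x s`, and the remainder is the Gram matrix of
  -- the orthogonal projections. If `M s s = 0`, the inverses are `0` and nothing is split off.
  refine ⟨fun i => M i s * (√(M s s))⁻¹, of_inner
    (fun i => x i - (M i s * (M s s)⁻¹) • x s) fun i j => ?_, ?_, fun t ht => ?_⟩
  · have h1 : M s j = M j s := hM.symm_apply _ _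
    have h2 : (√(M s s))⁻¹ * (√(M s s))⁻¹ = (M s s)⁻¹ := by
      rw [← mul_inv, Real.mul_self_sqrt hM.diag_nonneg]
    have h3 : (M s s)⁻¹ * (M s s)⁻¹ * M s s = (M s s)⁻¹ := by
      rcases eq_or_ne (M s s) 0 with h | h
      · simp [h]
      · field_simp
    simp only [Matrix.of_apply, inner_sub_left, inner_sub_right, real_inner_smul_left,
      real_inner_smul_right, ← hx]
    rw [h1]
    linear_combination (-M i s * M j s) * h2 - M i s * M j s * h3
  · rcases eq_or_ne (M s s) 0 with h | h
    · simp [h]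
    · have : √(M s s) ≠ 0 := by
        rw [Real.sqrt_ne_zero hM.diag_nonneg]; exact h
      field_simp
      rw [Real.sq_sqrt hM.diag_nonneg]
  · have := hM.sq_le t s
    rw [ht, zero_mul] at this
    have : M t s = 0 := by nlinarith
    simp [this]

/-- A positive semidefinite matrix splits along two indices into two matrices of rank one, whose
entries at these indices have the extreme moduli, and a matrix that vanishes there. -/
theorem exists_split {ι : Type*} [Finite ι] {M : Matrix ι ι ℝ} (hM : M.PosSemidef) {s t : ι}
    (hst : s ≠ t) {a : ℝ} (ha : a = (1 + M s t / (√(M s s) * √(M t t))) / 2) :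
    ∃ p n : ι → ℝ,
      p s = √(M s s) ∧ p t = √(M t t) ∧ n s = √(M s s) ∧ n t = -√(M t t) ∧
      (Matrix.of fun i j => M i j - a * (p i * p j) - (1 - a) * (n i * n j)).PosSemidef := by
  classical
  cases nonempty_fintype ι
  -- If a diagonal entry vanishes, both rank one matrices can be taken equal, so that the value of
  -- `a` is irrelevant.
  by_cases hs : M s s = 0
  · obtain ⟨p, hp, hpt, h0⟩ := hM.exists_split_one t
    refine ⟨p, fun i => -p i, ?_, hpt, ?_, by simp only [hpt], ?_⟩
    · rw [hs, h0 s hs, Real.sqrt_zero]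
    · simp only [hs, h0 s hs, Real.sqrt_zero, neg_zero]
    · convert hp using 1; ext i j; simp only [Matrix.of_apply]; ring
  by_cases ht : M t t = 0
  · obtain ⟨p, hp, hps, h0⟩ := hM.exists_split_one s
    refine ⟨p, p, hps, ?_, hps, ?_, ?_⟩
    · rw [ht, h0 t ht, Real.sqrt_zero]
    · rw [ht, h0 t ht, Real.sqrt_zero, neg_zero]
    · convert hp using 1; ext i j; simp only [Matrix.of_apply]; ring
  obtain ⟨x, hx⟩ := hM.exists_gram
  have hs' : √(M s s) ≠ 0 := by rw [Real.sqrt_ne_zero hM.diag_nonneg]; exact hs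
  have ht' : √(M t t) ≠ 0 := by rw [Real.sqrt_ne_zero hM.diag_nonneg]; exact ht
  have hs2 : √(M s s) ^ 2 = M s s := Real.sq_sqrt hM.diag_nonneg
  have ht2 : √(M t t) ^ 2 = M t t := Real.sq_sqrt hM.diag_nonneg
  generalize √(M s s) = S at *
  generalize √(M t t) = T at *
  have hc : M s t = (2 * a - 1) * (S * T) := by rw [ha]; field_simp; ring
  have hc' : M t s = (2 * a - 1) * (S * T) := by rw [← hc, hM.symm_apply]
  have hks : ∀ b : ℝ, (4 * b)⁻¹ * (4 * b)⁻¹ * (4 * b) = (4 * b)⁻¹ := by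
    intro b
    rcases eq_or_ne b 0 with h | h
    · simp [h]
    · field_simp
  -- `q` and `r` are the inner products with the sum and the difference of the unit vectors at `s`
  -- and `t`. These are orthogonal, with squared lengths `4 * a` and `4 * (1 - a)`.
  let q : ι → ℝ := fun i => M i s / S + M i t / T
  let r : ι → ℝ := fun i => M i s / S - M i t / T
  have hqs : q s = 2 * a * S := by simp only [q]; rw [hc, ← hs2]; field_simp; ring
  have hqt : q t = 2 * a * T := by simp only [q]; rw [hc', ← ht2]; field_simp; ring
  have hrs : r s = 2 * (1 - a) * S := by simp only [r]; rw [hc, ← hs2]; field_simp; ring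
  have hrt : r t = -(2 * (1 - a) * T) := by simp only [r]; rw [hc', ← ht2]; field_simp; ring
  -- If `a = 0`, this matrix enters with coefficient zero, so any vector with the prescribed entries
  -- at `s` and `t` will do; likewise for `n`.
  let p : ι → ℝ := fun i => if a = 0 then (if i = t then T else S) else q i / (2 * a)
  let n : ι → ℝ := fun i => if 1 - a = 0 then (if i = t then -T else S) else r i / (2 * (1 - a))
  have hp : ∀ i j, a * (p i * p j) = (4 * a)⁻¹ * (q i * q j) := by
    intro i j
    by_cases h : a = 0
    · simp [h]
    · simp only [p, if_neg h]; field_simp; ring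
  have hn : ∀ i j, (1 - a) * (n i * n j) = (4 * (1 - a))⁻¹ * (r i * r j) := by
    intro i j
    by_cases h : 1 - a = 0
    · simp [h]
    · simp only [n, if_neg h]; field_simp; ring
  refine ⟨p, n, ?_, ?_, ?_, ?_, of_inner (fun i => x i
    - ((4 * a)⁻¹ * q i) • (S⁻¹ • x s + T⁻¹ • x t)
    - ((4 * (1 - a))⁻¹ * r i) • (S⁻¹ • x s - T⁻¹ • x t)) fun i j => ?_⟩
  · by_cases h : a = 0
    · simp [p, h, hst]
    · simp only [p, if_neg h, hqs]; field_simp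
  · by_cases h : a = 0
    · simp [p, h]
    · simp only [p, if_neg h, hqt]; field_simp
  · by_cases h : 1 - a = 0
    · simp [n, h, hst]
    · simp only [n, if_neg h, hrs]; field_simp
  · by_cases h : 1 - a = 0
    · simp [n, h]
    · simp only [n, if_neg h, hrt]; field_simp
  · rw [Matrix.of_apply, hp, hn]
    set u := S⁻¹ • x s + T⁻¹ • x t with hu
    set w := S⁻¹ • x s - T⁻¹ • x t with hw
    have hxu : ∀ i, ⟪x i, u⟫_ℝ = q i := fun i => by
      rw [hu, inner_add_right, real_inner_smul_right, real_inner_smul_right, ← hx, ← hx]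
      simp only [q]; ring
    have hxw : ∀ i, ⟪x i, w⟫_ℝ = r i := fun i => by
      rw [hw, inner_sub_right, real_inner_smul_right, real_inner_smul_right, ← hx, ← hx]
      simp only [r]; ring
    have hux : ∀ i, ⟪u, x i⟫_ℝ = q i := fun i => by rw [real_inner_comm, hxu]
    have hwx : ∀ i, ⟪w, x i⟫_ℝ = r i := fun i => by rw [real_inner_comm, hxw]
    have huu : ⟪u, u⟫_ℝ = 4 * a := by
      conv_lhs => rw [hu]
      rw [inner_add_left, real_inner_smul_left, real_inner_smul_left, hxu, hxu, hqs, hqt]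
      field_simp; ring
    have huw : ⟪u, w⟫_ℝ = 0 := by
      conv_lhs => rw [hu]
      rw [inner_add_left, real_inner_smul_left, real_inner_smul_left, hxw, hxw, hrs, hrt]
      field_simp; ring
    have hwu : ⟪w, u⟫_ℝ = 0 := by rw [real_inner_comm, huw]
    have hww : ⟪w, w⟫_ℝ = 4 * (1 - a) := by
      conv_lhs => rw [hw]
      rw [inner_sub_left, real_inner_smul_left, real_inner_smul_left, hxw, hxw, hrs, hrt]
      field_simp; ring
    simp only [inner_sub_left, inner_sub_right, real_inner_smul_left, real_inner_smul_right,
      hxu, hxw, hux, hwx, huu, huw, hwu, hww, ← hx]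
    linear_combination (-(q i * q j)) * hks a - r i * r j * hks (1 - a)

end Matrix.PosSemidef

/-! ### Holes -/

theorem cycleGraph_adj_iff_of_lt {n : ℕ} {i j : Fin n} (h : i < j) :
    (cycleGraph n).Adj i j ↔ (j : ℕ) = i + 1 ∨ ((i : ℕ) = 0 ∧ (j : ℕ) = n - 1 ∧ 1 < n) := by
  rw [cycleGraph_adj', Fin.sub_val_of_le h.le, Fin.coe_sub_iff_lt.mpr h]
  have := Fin.lt_def.mp h
  omega

theorem hasHole_of_embedding {V : Type*} {G : SimpleGraph V} {n : ℕ} (hn : 4 ≤ n)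
    (f : cycleGraph n ↪g G) : HasHole G n := by
  refine ⟨hn, Set.range f, ⟨⟨(Equiv.ofInjective f f.injective).symm, ?_⟩⟩⟩
  rintro ⟨_, i, rfl⟩ ⟨_, j, rfl⟩
  simp

theorem HasHole.exists_embedding {V : Type*} {G : SimpleGraph V} {n : ℕ} (h : HasHole G n) :
    4 ≤ n ∧ Nonempty (cycleGraph n ↪g G) := by
  obtain ⟨h4, S, ⟨e⟩⟩ := h
  exact ⟨h4, ⟨e.symm.toEmbedding.trans (Embedding.induce S)⟩⟩

/-! ### Odd closed walks in double covers -/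

/-- The involution of the double cover of a vertex set. -/
def bar {V : Type*} (x : V × ℤˣ) : V × ℤˣ := (x.1, -x.2)

@[simp] theorem bar_fst {V : Type*} (x : V × ℤˣ) : (bar x).1 = x.1 := rfl

@[simp] theorem bar_snd {V : Type*} (x : V × ℤˣ) : (bar x).2 = -x.2 := rfl

@[simp] theorem bar_bar {V : Type*} (x : V × ℤˣ) : bar (bar x) = x := by simp [bar]

theorem ne_bar {V : Type*} (x : V × ℤˣ) : x ≠ bar x := by
  intro h
  have := congrArg Prod.snd h
  rcases Int.units_eq_one_or x.2 with h' | h' <;> simp [h'] at this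

theorem eq_or_eq_bar {V : Type*} {x y : V × ℤˣ} (h : x.1 = y.1) : x = y ∨ x = bar y := by
  rcases Int.units_eq_one_or x.2 with hx | hx <;> rcases Int.units_eq_one_or y.2 with hy | hy
  · exact Or.inl (Prod.ext h (by rw [hx, hy]))
  · exact Or.inr (Prod.ext h (by simp [hx, hy]))
  · exact Or.inr (Prod.ext h (by simp [hx, hy]))
  · exact Or.inl (Prod.ext h (by rw [hx, hy]))

theorem exists_walk_of_seq {V : Type*} {K : SimpleGraph V} {n : ℕ} {c : ℕ → V}
    (hc : ∀ k < n, K.Adj (c k) (c (k + 1))) (i d : ℕ) (h : i + d ≤ n) :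
    ∃ p : K.Walk (c i) (c (i + d)), p.length = d := by
  induction d with
  | zero => exact ⟨.nil, rfl⟩
  | succ d ih =>
    obtain ⟨p, hp⟩ := ih (by omega)
    exact ⟨p.concat (hc (i + d) (by omega)), by simp [hp]⟩

/-- A double cover `K` of a graph `G`, given by a sign for each edge of `G`, such that each
triangle is even. -/
structure IsTriangleEvenCover {V : Type*} (G : SimpleGraph V) (K : SimpleGraph (V × ℤˣ)) :
    Prop where
  proj : ∀ x y, K.Adj x y → G.Adj x.1 y.1
  bar_bar : ∀ x y, K.Adj x y → K.Adj (bar x) (bar y)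
  lift : ∀ x y, G.Adj x.1 y.1 → K.Adj x y ∨ K.Adj x (bar y)
  unique : ∀ x y, K.Adj x y → ¬K.Adj x (bar y)
  triangle : ∀ x y z, K.Adj x y → K.Adj y z → ¬K.Adj z (bar x)

/-- A shortest odd closed walk is an induced cycle. -/
theorem IsTriangleEvenCover.exists_hasHole {V : Type*} {G : SimpleGraph V}
    {K : SimpleGraph (V × ℤˣ)} (hK : IsTriangleEvenCover G K) {x : V × ℤˣ}
    (p : K.Walk x (bar x)) : ∃ m ≤ p.length, HasHole G m := by
  classical
  have hex : ∃ m, ∃ (y : V × ℤˣ) (q : K.Walk y (bar y)), q.length = m := ⟨_, x, p, rfl⟩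
  set m := Nat.find hex with hm
  obtain ⟨y, q, hq⟩ := Nat.find_spec hex
  rw [← hm] at hq
  have hmin : ∀ (z : V × ℤˣ) (r : K.Walk z (bar z)), m ≤ r.length := fun z r =>
    Nat.find_min' hex ⟨z, r, rfl⟩
  refine ⟨m, hmin x p, ?_⟩
  let c : ℕ → V × ℤˣ := q.getVert
  have hc : ∀ k < m, K.Adj (c k) (c (k + 1)) := fun k hk =>
    q.adj_getVert_succ (by omega)
  have h0 : c 0 = y := q.getVert_zero
  have hcm : c m = bar y := by rw [← hq]; exact q.getVert_length
  have hseg : ∀ i j, i ≤ j → j ≤ m → ∃ r : K.Walk (c i) (c j), r.length = j - i := by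
    intro i j hij hj
    obtain ⟨d, rfl⟩ := Nat.exists_eq_add_of_le hij
    obtain ⟨r, hr⟩ := exists_walk_of_seq hc i d hj
    exact ⟨r, by omega⟩
  have hmin' : ∀ z z' (r : K.Walk z z'), z' = bar z → m ≤ r.length := by
    rintro z _ r rfl; exact hmin z r
  -- Minimality is used in two ways: `short` replaces the segment from `i` to `j`, and `close` turns
  -- that segment into an odd closed walk of its own.
  have short : ∀ i j, i ≤ j → j ≤ m → ∀ r : K.Walk (c i) (c j), m ≤ i + r.length + (m - j) := by
    intro i j hij hj r
    obtain ⟨r1, h1⟩ := hseg 0 i (by omega) (by omega)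
    obtain ⟨r2, h2⟩ := hseg j m hj le_rfl
    have := hmin' _ _ ((r1.append r).append r2) (by rw [h0, hcm])
    rw [Walk.length_append, Walk.length_append, h1, h2] at this
    omega
  have close : ∀ i j, i ≤ j → j ≤ m → ∀ r : K.Walk (c j) (bar (c i)), m ≤ (j - i) + r.length := by
    intro i j hij hj r
    obtain ⟨r1, h1⟩ := hseg i j hij hj
    have := hmin _ (r1.append r)
    rwa [Walk.length_append, h1] at this
  -- Lengths 0, 1, 2, 3 would mean a point equal to its opposite, a loop, both lifts of one edge,
  -- and an odd triangle.
  have hm4 : 4 ≤ m := by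
    by_contra hlt
    have : m = 0 ∨ m = 1 ∨ m = 2 ∨ m = 3 := by omega
    rcases this with h | h | h | h <;> rw [h] at hcm hc
    · exact ne_bar y (h0.symm.trans hcm)
    · have := hK.proj _ _ (hc 0 (by omega))
      rw [h0, hcm] at this
      exact G.irrefl this
    · have h1 := hc 0 (by omega)
      have h2 := hc 1 (by omega)
      rw [h0] at h1
      rw [hcm] at h2
      exact hK.unique _ _ h1.symm h2
    · have h1 := hc 0 (by omega)
      have h2 := hc 2 (by omega)
      rw [h0] at h1
      rw [hcm] at h2
      exact hK.triangle _ _ _ h1 (hc 1 (by omega)) h2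
  -- A chord lifts to an edge to `c j` or to its opposite. The first gives a shortcut unless `j = i
  -- + 1`, the second a shorter odd walk unless the chord is the closing edge.
  have hadj : ∀ i j, i < j → j < m → (G.Adj (c i).1 (c j).1 ↔ j = i + 1 ∨ (i = 0 ∧ j = m - 1)) := by
    intro i j hij hj
    constructor
    · intro h
      rcases hK.lift _ _ h with h | h
      · have := short i j hij.le hj.le (.cons h .nil)
        simp only [Walk.length_cons, Walk.length_nil] at this
        omega
      · have h' := (hK.bar_bar _ _ h).symm
        rw [_root_.bar_bar] at h'
        have := close i j hij.le hj.le (.cons h' .nil)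
        simp only [Walk.length_cons, Walk.length_nil] at this
        omega
    · rintro (rfl | ⟨rfl, rfl⟩)
      · exact hK.proj _ _ (hc i (by omega))
      · have := hK.proj _ _ (hc (m - 1) (by omega)).symm
        rwa [show m - 1 + 1 = m by omega, hcm, ← h0] at this
  have hinj : ∀ i j, i < j → j < m → (c i).1 ≠ (c j).1 := by
    intro i j hij hj h
    rcases eq_or_eq_bar h with h | h
    · have := short i j hij.le hj.le (Walk.nil.copy rfl h)
      rw [Walk.length_copy, Walk.length_nil] at this
      omega
    · have := close i j hij.le hj.le (Walk.nil.copy rfl (by rw [h, _root_.bar_bar]))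
      rw [Walk.length_copy, Walk.length_nil] at this
      omega
  have hinj' : Function.Injective fun i : Fin m => (c i).1 := by
    intro i j h
    rcases lt_trichotomy i j with hij | hij | hij
    · exact absurd h (hinj i j hij j.2)
    · exact hij
    · exact absurd h.symm (hinj j i hij i.2)
  refine hasHole_of_embedding hm4 ⟨⟨_, hinj'⟩, ?_⟩
  have key : ∀ i j : Fin m, i < j → (G.Adj (c i).1 (c j).1 ↔ (cycleGraph m).Adj i j) := by
    intro i j hij
    rw [hadj i j hij j.2, cycleGraph_adj_iff_of_lt hij]
    have := j.2
    omega
  intro i j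
  change G.Adj (c i).1 (c j).1 ↔ _
  rcases lt_trichotomy i j with hij | rfl | hij
  · exact key i j hij
  · simp
  · rw [SimpleGraph.adj_comm, key j i hij, SimpleGraph.adj_comm]

theorem Int.units_ne_neg (a : ℤˣ) : a ≠ -a := by revert a; decide

/-- The double cover of a graph with signed edges. -/
def signCover {V : Type*} (G : SimpleGraph V) (s : V → V → ℤˣ) (hs : ∀ i j, s i j = s j i) :
    SimpleGraph (V × ℤˣ) where
  Adj x y := G.Adj x.1 y.1 ∧ y.2 = x.2 * s x.1 y.1
  symm := ⟨fun x y ⟨h, h'⟩ => ⟨h.symm, by rw [h', hs y.1, mul_assoc, Int.units_mul_self, mul_one]⟩⟩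
  loopless := ⟨fun _ h => G.irrefl h.1⟩

/-- The sign of a walk decides the sheet on which its lift ends, so it suffices that the signs
around each triangle multiply to one. -/
theorem isTriangleEvenCover_signCover {V : Type*} (G : SimpleGraph V) (s : V → V → ℤˣ)
    (hs : ∀ i j, s i j = s j i)
    (htri : ∀ i j k, G.Adj i j → G.Adj j k → G.Adj i k → s i j * s j k * s k i = 1) :
    IsTriangleEvenCover G (signCover G s hs) where
  proj _ _ h := h.1
  bar_bar x y h := ⟨h.1, by simp [h.2]⟩
  lift x y h := by
    rcases eq_or_eq_bar (x := (y.1, x.2 * s x.1 y.1)) (y := y) rfl with h' | h'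
    · left; exact ⟨h, by rw [← h']⟩
    · right; exact ⟨h, by rw [← h']⟩
  unique x y h h' := by
    have := h'.2
    rw [bar_fst, ← h.2, bar_snd] at this
    exact Int.units_ne_neg _ this.symm
  triangle x y z h h' h'' := by
    have h1 := h''.2
    rw [h'.2, h.2, bar_snd, bar_fst, mul_assoc, mul_assoc, ← mul_assoc (s x.1 y.1),
      htri _ _ _ h.1 h'.1 h''.1.symm, mul_one] at h1
    exact Int.units_ne_neg _ h1.symm

/-! ### Chordal graphs -/

/-- In a chordal graph, two vertices that have a common neighbour outside and neighbours inside a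
connected set, whose vertices are not adjacent to the common neighbour, are adjacent. -/
theorem IsChordal.adj_of_common {V : Type*} {G : SimpleGraph V} (hG : IsChordal G) {P : Set V}
    {u w x y a b : V} (hP : ∀ v ∈ P, v ≠ u ∧ ¬G.Adj u v) (hw : w ∈ P) (hxy : x ≠ y)
    (hux : G.Adj u x) (huy : G.Adj u y) (hxa : G.Adj x a) (hyb : G.Adj y b)
    (ha : Relation.ReflTransGen (fun i j => G.Adj i j ∧ j ∈ P) w a)
    (hb : Relation.ReflTransGen (fun i j => G.Adj i j ∧ j ∈ P) w b) : G.Adj x y := by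
  classical
  by_contra hn
  let H : Set V := {v | v = u ∨ v = x ∨ v = y ∨ v ∈ P}
  let G' := G.induce H
  -- Only the edges from `x` into `P` are negative. The closed walk `u, x, a, …, b, y, u` uses
  -- exactly one of them and is therefore odd.
  let s : H → H → ℤˣ := fun i j =>
    if ((i : V) = x ∧ (j : V) ∈ P) ∨ ((j : V) = x ∧ (i : V) ∈ P) then -1 else 1
  have hs : ∀ i j, s i j = s j i := fun i j => by simp only [s, or_comm]
  have hxP : x ∉ P := fun h => (hP x h).2 hux
  have hyP : y ∉ P := fun h => (hP y h).2 huy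
  have huP : u ∉ P := fun h => (hP u h).1 rfl
  have hcov : IsTriangleEvenCover G' (signCover G' s hs) := by
    apply isTriangleEvenCover_signCover
    rintro ⟨i, hi⟩ ⟨j, hj⟩ ⟨k, hk⟩ hij hjk hik
    replace hij : G.Adj i j := hij
    replace hjk : G.Adj j k := hjk
    replace hik : G.Adj i k := hik
    -- As `x` and `y` are assumed not adjacent, a triangle at `x` has both other vertices in `P`, so
    -- it has two negative edges.
    have nb : ∀ j ∈ H, ∀ k ∈ H, G.Adj x j → G.Adj x k → G.Adj j k → j ∈ P := by
      intro j hj k hk hxj hxk hjk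
      rcases hj with rfl | rfl | rfl | hj
      · rcases hk with rfl | rfl | rfl | hk
        · exact absurd hjk G.irrefl
        · exact absurd hxk G.irrefl
        · exact absurd hxk hn
        · exact absurd hjk (hP k hk).2
      · exact absurd hxj G.irrefl
      · exact absurd hxj hn
      · exact hj
    by_cases hix : i = x
    · subst hix
      have h1 := nb j hj k hk hij hik hjk
      have h2 := nb k hk j hj hik hij hjk.symm
      simp [s, h1, h2, hij.ne', hik.ne']
    by_cases hjx : j = x
    · subst hjx
      have h1 := nb i hi k hk hij.symm hjk hik
      have h2 := nb k hk i hi hjk hij.symm hik.symm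
      simp [s, h1, h2, hij.ne, hjk.ne']
    by_cases hkx : k = x
    · subst hkx
      have h1 := nb i hi j hj hik.symm hjk.symm hij
      have h2 := nb j hj i hi hjk.symm hik.symm hij.symm
      simp [s, h1, h2, hik.ne, hjk.ne]
    simp [s, hix, hjx, hkx]
  have hreach : ∀ (t : ℤˣ) (hwH : w ∈ H) (c : V)
      (_ : Relation.ReflTransGen (fun i j => G.Adj i j ∧ j ∈ P) w c),
      c ∈ P ∧ ∀ hc : c ∈ H, (signCover G' s hs).Reachable (⟨w, hwH⟩, t) (⟨c, hc⟩, t) := by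
    intro t hwH c hc
    induction hc with
    | refl => exact ⟨hw, fun _ => .refl _⟩
    | @tail c d _ hcd ih =>
      refine ⟨hcd.2, fun hd => ?_⟩
      have hcH : c ∈ H := Or.inr (Or.inr (Or.inr ih.1))
      refine (ih.2 hcH).trans (Adj.reachable ⟨hcd.1, ?_⟩)
      have h1 : c ≠ x := fun h => hxP (h ▸ ih.1)
      have h2 : d ≠ x := fun h => hxP (h ▸ hcd.2)
      simp [s, h1, h2]
  have hwH : w ∈ H := Or.inr (Or.inr (Or.inr hw))
  obtain ⟨haP, ha'⟩ := hreach (-1) hwH a ha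
  obtain ⟨hbP, hb'⟩ := hreach (-1) hwH b hb
  have haH : a ∈ H := Or.inr (Or.inr (Or.inr haP))
  have hbH : b ∈ H := Or.inr (Or.inr (Or.inr hbP))
  have huH : u ∈ H := Or.inl rfl
  have hxH : x ∈ H := Or.inr (Or.inl rfl)
  have hyH : y ∈ H := Or.inr (Or.inr (Or.inl rfl))
  have e1 : (signCover G' s hs).Adj (⟨u, huH⟩, 1) (⟨x, hxH⟩, 1) :=
    ⟨hux, by simp [s, huP, hxP]⟩
  have e2 : (signCover G' s hs).Adj (⟨x, hxH⟩, 1) (⟨a, haH⟩, -1) := ⟨hxa, by simp [s, haP]⟩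
  have e3 : (signCover G' s hs).Adj (⟨b, hbH⟩, -1) (⟨y, hyH⟩, -1) := by
    refine ⟨hyb.symm, ?_⟩
    have : b ≠ x := fun h => hxP (h ▸ hbP)
    simp [s, this, hxy.symm]
  have e4 : (signCover G' s hs).Adj (⟨y, hyH⟩, -1) (⟨u, huH⟩, -1) :=
    ⟨huy.symm, by simp [s, huP, hyP]⟩
  obtain ⟨p⟩ : (signCover G' s hs).Reachable (⟨u, huH⟩, 1) (bar (⟨u, huH⟩, 1)) :=
    (((e1.reachable.trans e2.reachable).trans ((ha' haH).symm.trans (hb' hbH))).trans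
      e3.reachable).trans e4.reachable
  obtain ⟨m, -, hm⟩ := hcov.exists_hasHole p
  obtain ⟨h4, ⟨f⟩⟩ := hm.exists_embedding
  exact hG m (hasHole_of_embedding h4 (f.trans (Embedding.induce H)))

/-- Every locally positive semidefinite partial matrix with a chordal pattern is completable. -/
theorem IsChordal.isCompletable {V : Type*} [Finite V] {G : SimpleGraph V} (hG : IsChordal G)
    {X : PartialMatrix G} (hX : X.IsLocallyPSD) : X.IsCompletable := by
  classical
  cases nonempty_fintype V
  suffices h : ∀ U : Finset V, ∃ M : Matrix V V ℝ, M.PosSemidef ∧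
      ∀ i ∈ U, ∀ j ∈ U, ∀ h : IsSpecified G s(i, j), M i j = X ⟨s(i, j), h⟩ by
    obtain ⟨M, hM, h⟩ := h Finset.univ
    exact ⟨M, hM, fun i j => h i (Finset.mem_univ i) j (Finset.mem_univ j)⟩
  intro U
  induction U using Finset.strongInduction with
  | H U ih =>
  by_cases hcl : G.IsClique (U : Set V)
  · obtain ⟨M, hM, h⟩ := (hX U hcl).exists_extend Subtype.val_injective
    exact ⟨M, hM, fun i hi j hj _ => h ⟨i, hi⟩ ⟨j, hj⟩⟩
  obtain ⟨u, hu, w, hw, huw, hnadj⟩ : ∃ u ∈ U, ∃ w ∈ U, u ≠ w ∧ ¬G.Adj u w := by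
    by_contra hcon
    push Not at hcon
    exact hcl fun u hu w hw huw => hcon u hu w hw huw
  -- `A` is the component of `w` among the non-neighbours of `u`, and `S` is its boundary. All of
  -- `S` is adjacent to `u`, so chordality makes `S` a clique that separates `u` from `w`. The
  -- completions on the two sides agree on `S`, where everything is specified, and can be
  -- amalgamated.
  let P : Set V := {v | v ∈ U ∧ v ≠ u ∧ ¬G.Adj u v}
  have hwP : w ∈ P := ⟨hw, huw.symm, hnadj⟩
  let A : Set V := {a | Relation.ReflTransGen (fun i j => G.Adj i j ∧ j ∈ P) w a}
  have hAP : A ⊆ P := by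
    intro a ha
    rcases Relation.ReflTransGen.cases_tail ha with h | ⟨c, -, h⟩
    · rw [← h] at hwP; exact hwP
    · exact h.2
  let S : Set V := {v | v ∈ U ∧ v ∉ A ∧ ∃ a ∈ A, G.Adj v a}
  have hSu : ∀ v ∈ S, G.Adj u v := by
    rintro v ⟨hvU, hvA, a, ha, hva⟩
    by_contra hn
    have hvu : v ≠ u := by
      rintro rfl
      exact (hAP ha).2.2 hva
    exact hvA (Relation.ReflTransGen.tail ha ⟨hva.symm, hvU, hvu, hn⟩)
  have hS : G.IsClique S := by
    intro x hx y hy hxy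
    obtain ⟨-, -, a, ha, hxa⟩ := id hx
    obtain ⟨-, -, b, hb, hyb⟩ := id hy
    exact hG.adj_of_common (P := P) (fun v hv => hv.2) hwP hxy (hSu x hx) (hSu y hy) hxa hyb ha hb
  have hAU : ∀ a ∈ A, a ∈ U := fun a ha => (hAP ha).1
  have huA : u ∉ A := fun h => (hAP h).2.1 rfl
  have huS : u ∉ S := fun h => G.irrefl (hSu u h)
  obtain ⟨M, hM, hMX⟩ := ih (U.filter fun v => v ∈ A ∨ v ∈ S)
    ⟨Finset.filter_subset _ _, fun h => by
      have := (Finset.mem_filter.mp (h hu)).2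
      tauto⟩
  obtain ⟨N, hN, hNX⟩ := ih (U.filter fun v => v ∉ A)
    ⟨Finset.filter_subset _ _, fun h =>
      (Finset.mem_filter.mp (h hw)).2 (Relation.ReflTransGen.refl)⟩
  obtain ⟨Q, hQ, h1, h2⟩ := hM.exists_amalgam hN {v | v ∈ A ∨ v ∈ S} {v | v ∈ U ∧ v ∉ A} (by
    rintro i ⟨hi, hi'⟩ j ⟨hj, hj'⟩
    have hiS : i ∈ S := hi.resolve_left hi'.2
    have hjS : j ∈ S := hj.resolve_left hj'.2
    have hsp : IsSpecified G s(i, j) := isSpecified_of_isClique hS ⟨i, hiS⟩ ⟨j, hjS⟩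
    rw [hMX i (Finset.mem_filter.mpr ⟨hi'.1, hi⟩) j (Finset.mem_filter.mpr ⟨hj'.1, hj⟩) hsp,
      hNX i (Finset.mem_filter.mpr hi') j (Finset.mem_filter.mpr hj') hsp])
  -- No specified position joins `A` to the part beyond `S`, so the amalgam is unconstrained there.
  have hcover : ∀ i ∈ U, ∀ j ∈ U, i ∈ A → j ∉ A → IsSpecified G s(i, j) → j ∈ S := by
    intro i hi j hj hiA hjA hsp
    refine ⟨hj, hjA, i, hiA, ?_⟩
    rcases hsp with h | h
    · rw [Sym2.mk_isDiag_iff] at h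
      exact absurd (h ▸ hiA) hjA
    · exact (G.mem_edgeSet.mp h).symm
  refine ⟨Q, hQ, fun i hi j hj hsp => ?_⟩
  have left : (i ∈ A ∨ i ∈ S) → (j ∈ A ∨ j ∈ S) → Q i j = X ⟨s(i, j), hsp⟩ := fun hi' hj' => by
    rw [h1 i hi' j hj',
      hMX i (Finset.mem_filter.mpr ⟨hi, hi'⟩) j (Finset.mem_filter.mpr ⟨hj, hj'⟩) hsp]
  by_cases hiA : i ∈ A <;> by_cases hjA : j ∈ A
  · exact left (Or.inl hiA) (Or.inl hjA)
  · exact left (Or.inl hiA) (Or.inr (hcover i hi j hj hiA hjA hsp))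
  · exact left (Or.inr (hcover j hj i hi hjA hiA (by rwa [Sym2.eq_swap]))) (Or.inl hjA)
  · rw [h2 i ⟨hi, hiA⟩ j ⟨hj, hjA⟩, hNX i (Finset.mem_filter.mpr ⟨hi, hiA⟩) j
      (Finset.mem_filter.mpr ⟨hj, hjA⟩) hsp]

/-! ### Series parallel graphs -/

/-- A minor of a minor is a minor: the unions of the sets `φ p` over the branch sets of a `K₄` in
`G'` are branch sets in `G`. -/
theorem IsSeriesParallel.of_branch {V V' : Type*} {G : SimpleGraph V} {G' : SimpleGraph V'}
    (hG : IsSeriesParallel G) (φ : V' → Set V) (hconn : ∀ p, (G.induce (φ p)).Connected)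
    (hdisj : ∀ p q, p ≠ q → Disjoint (φ p) (φ q))
    (hadj : ∀ p q, G'.Adj p q → ∃ u ∈ φ p, ∃ v ∈ φ q, G.Adj u v) : IsSeriesParallel G' := by
  rintro ⟨B, hB, hBd, hBa⟩
  refine hG ⟨fun i => ⋃ p ∈ B i, φ p, fun i => ?_, fun i j hij => ?_, fun i j hij => ?_⟩
  · have hsub : ∀ p ∈ B i, φ p ⊆ ⋃ p ∈ B i, φ p := fun p hp =>
      Set.subset_biUnion_of_mem (u := φ) hp
    have hin : ∀ p (hp : p ∈ B i) (u v : V) (hu : u ∈ φ p) (hv : v ∈ φ p),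
        (G.induce (⋃ p ∈ B i, φ p)).Reachable ⟨u, hsub p hp hu⟩ ⟨v, hsub p hp hv⟩ := by
      intro p hp u v hu hv
      exact ((hconn p).preconnected ⟨u, hu⟩ ⟨v, hv⟩).map (G.induceHomOfLE (hsub p hp)).toHom
    have hwalk : ∀ (p q : B i), (G'.induce (B i)).Walk p q → ∀ u v (hu : u ∈ φ p) (hv : v ∈ φ q),
        (G.induce (⋃ p ∈ B i, φ p)).Reachable ⟨u, hsub p p.2 hu⟩ ⟨v, hsub q q.2 hv⟩ := by
      intro p q w
      induction w with
      | nil => exact fun u v hu hv => hin _ (Subtype.prop _) u v hu hv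
      | @cons p r q h w ih =>
        intro u v hu hv
        obtain ⟨u', hu', v', hv', h'⟩ := hadj _ _ (show G'.Adj p r from h)
        refine (hin p p.2 u u' hu hu').trans ((Adj.reachable ?_).trans (ih v' v hv' hv))
        exact h'
    obtain ⟨p₀⟩ := (hB i).nonempty
    obtain ⟨⟨u₀, hu₀⟩⟩ := (hconn p₀).nonempty
    have : Nonempty (⋃ p ∈ B i, φ p : Set V) := ⟨⟨u₀, hsub _ p₀.2 hu₀⟩⟩
    refine Connected.mk ?_
    rintro ⟨u, hu⟩ ⟨v, hv⟩
    obtain ⟨p, hp, hu'⟩ := Set.mem_iUnion₂.mp hu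
    obtain ⟨q, hq, hv'⟩ := Set.mem_iUnion₂.mp hv
    obtain ⟨w⟩ := (hB i).preconnected ⟨p, hp⟩ ⟨q, hq⟩
    exact hwalk _ _ w u v hu' hv'
  · rw [Set.disjoint_iUnion₂_left]
    intro p hp
    rw [Set.disjoint_iUnion₂_right]
    intro q hq
    exact hdisj p q fun h => Set.disjoint_left.mp (hBd i j hij) hp (h ▸ hq)
  · obtain ⟨p, hp, q, hq, h⟩ := hBa i j hij
    obtain ⟨u, hu, v, hv, h'⟩ := hadj p q h
    exact ⟨u, Set.mem_biUnion hp hu, v, Set.mem_biUnion hq hv, h'⟩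

theorem connected_induce_singleton {V : Type*} (G : SimpleGraph V) (v : V) :
    (G.induce {v}).Connected := by
  have : Nonempty ({v} : Set V) := ⟨⟨v, rfl⟩⟩
  refine Connected.mk ?_
  rintro ⟨a, rfl⟩ ⟨b, rfl⟩
  exact .refl _

theorem IsSeriesParallel.induce {V : Type*} {G : SimpleGraph V} (hG : IsSeriesParallel G)
    (S : Set V) : IsSeriesParallel (G.induce S) :=
  hG.of_branch (fun p => {(p : V)}) (fun p => connected_induce_singleton G p)
    (fun _ _ hpq => Set.disjoint_singleton.mpr fun h => hpq (Subtype.ext h))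
    fun p q h => ⟨p, rfl, q, rfl, h⟩

theorem IsSeriesParallel.not_clique {V : Type*} {G : SimpleGraph V} (hG : IsSeriesParallel G)
    {a b c d : V} (hab : G.Adj a b) (hac : G.Adj a c) (had : G.Adj a d) (hbc : G.Adj b c)
    (hbd : G.Adj b d) : ¬G.Adj c d := by
  intro hcd
  refine hG ⟨fun i => {(![a, b, c, d] : Fin 4 → V) i}, fun i => connected_induce_singleton G _,
    ?_, ?_⟩
  · intro i j hij
    rw [Set.disjoint_singleton]
    fin_cases i <;> fin_cases j <;>
      simp [hab.ne, hab.ne', hac.ne, hac.ne', had.ne, had.ne', hbc.ne, hbc.ne', hbd.ne, hbd.ne',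
        hcd.ne, hcd.ne'] at hij ⊢
  · intro i j hij
    refine ⟨_, rfl, _, rfl, ?_⟩
    fin_cases i <;> fin_cases j <;>
      simp [hab, hab.symm, hac, hac.symm, had, had.symm, hbc, hbc.symm, hbd, hbd.symm,
        hcd, hcd.symm] at hij ⊢

/-- The graph obtained by deleting the vertices in `S` after contracting `x` into `y`. -/
def contractInto {V : Type*} (G : SimpleGraph V) (S : Set V) (x y : V) :
    SimpleGraph {v // v ∉ S} where
  Adj p q := p ≠ q ∧ (G.Adj p q ∨ ((p : V) = y ∧ G.Adj x q) ∨ ((q : V) = y ∧ G.Adj x p))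
  symm := ⟨fun _ _ ⟨h, h'⟩ => ⟨h.symm, h'.imp (fun h => h.symm) Or.symm⟩⟩
  loopless := ⟨fun _ h => h.1 rfl⟩

theorem IsSeriesParallel.contractInto {V : Type*} {G : SimpleGraph V} (hG : IsSeriesParallel G)
    {S : Set V} {x y : V} (hx : x ∈ S) (hxy : G.Adj x y) :
    IsSeriesParallel (contractInto G S x y) := by
  refine hG.of_branch (fun p => {v | v = p ∨ ((p : V) = y ∧ v = x)}) (fun p => ?_)
    (fun p q hpq => ?_) fun p q h => ?_
  · by_cases hp : (p : V) = y
    · have : {v | v = (p : V) ∨ ((p : V) = y ∧ v = x)} = {y, x} := by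
        ext v; simp [hp]
      rw [this]
      exact induce_pair_connected_of_adj hxy.symm
    · have : {v | v = (p : V) ∨ ((p : V) = y ∧ v = x)} = {(p : V)} := by
        ext v; simp [hp]
      rw [this]
      exact connected_induce_singleton G _
  · rw [Set.disjoint_left]
    rintro v (rfl | ⟨hp, rfl⟩) (h | ⟨hq, h⟩)
    · exact hpq (Subtype.ext h)
    · exact p.2 (h ▸ hx)
    · exact q.2 (h ▸ hx)
    · exact hpq (Subtype.ext (hp.trans hq.symm))
  · rcases h.2 with h' | ⟨hp, h'⟩ | ⟨hq, h'⟩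
    · exact ⟨p, Or.inl rfl, q, Or.inl rfl, h'⟩
    · exact ⟨x, Or.inr ⟨hp, rfl⟩, q, Or.inl rfl, h'⟩
    · exact ⟨p, Or.inl rfl, x, Or.inr ⟨hq, rfl⟩, h'.symm⟩

/-- A graph without `K₄` minor has a vertex with at most two neighbours. -/
theorem IsSeriesParallel.exists_degree_le_two {V : Type*} [Finite V] [hne : Nonempty V]
    {G : SimpleGraph V} (hG : IsSeriesParallel G) :
    ∃ v a b, ∀ c, G.Adj v c → c = a ∨ c = b := by
  induction hn : Nat.card V using Nat.strong_induction_on generalizing V with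
  | _ n ih =>
  by_contra hcon
  push Not at hcon
  have hcard : ∀ (S : Set V) (x : V), x ∈ S → Nat.card {v // v ∉ S} < n := by
    intro S x hx
    rw [← hn]
    exact Finite.card_subtype_lt (x := x) (by simpa using hx)
  -- In a smallest counterexample, contracting `xy` creates a vertex of degree at most two. If it is
  -- the contracted vertex, then `x` and `y` have their other neighbours among the same two
  -- vertices. Otherwise its degree dropped, which requires it to be adjacent to both `x` and `y`.
  have hedge : ∀ x y, G.Adj x y → (∃ z w, G.Adj z x ∧ G.Adj z y ∧
      ∀ c, G.Adj z c → c = x ∨ c = y ∨ c = w) ∨ ∃ a b, (∀ c, G.Adj x c → c = y ∨ c = a ∨ c = b) ∧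
      ∀ c, G.Adj y c → c = x ∨ c = a ∨ c = b := by
    intro x y hxy
    have : Nonempty {v // v ∉ ({x} : Set V)} := ⟨⟨y, hxy.ne'⟩⟩
    obtain ⟨⟨v, hv⟩, ⟨a, ha⟩, ⟨b, hb⟩, h⟩ := ih _ (hcard {x} x rfl)
      (hG.contractInto (S := {x}) rfl hxy) rfl
    have hv' : v ≠ x := hv
    have h' : ∀ c, c ≠ x → c ≠ v → (G.Adj v c ∨ (v = y ∧ G.Adj x c) ∨ (c = y ∧ G.Adj x v)) →
        c = a ∨ c = b := by
      intro c hc hcv hadj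
      have := h ⟨c, hc⟩ ⟨fun h => hcv (congrArg Subtype.val h).symm, hadj⟩
      simpa [Subtype.ext_iff] using this
    by_cases hvy : v = y
    · subst hvy
      right
      refine ⟨a, b, fun c hc => ?_, fun c hc => ?_⟩
      · by_cases hcv : c = v
        · exact Or.inl hcv
        · exact Or.inr (h' c hc.ne' hcv (Or.inr (Or.inl ⟨rfl, hc⟩)))
      · by_cases hcx : c = x
        · exact Or.inl hcx
        · exact Or.inr (h' c hcx hc.ne' (Or.inl hc))
    · left
      have hvx : G.Adj v x := by
        by_contra hvx
        obtain ⟨c, hc, hca, hcb⟩ := hcon v a b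
        have hcx : c ≠ x := by rintro rfl; exact hvx hc
        rcases h' c hcx hc.ne' (Or.inl hc) with h | h
        · exact hca h
        · exact hcb h
      have hy : y = a ∨ y = b := h' y hxy.ne' (Ne.symm hvy) (Or.inr (Or.inr ⟨rfl, hvx.symm⟩))
      obtain ⟨w, hw⟩ : ∃ w, ∀ c, G.Adj v c → c = x ∨ c = y ∨ c = w := by
        rcases hy with rfl | rfl
        · refine ⟨b, fun c hc => ?_⟩
          by_cases hcx : c = x
          · exact Or.inl hcx
          · exact Or.inr (h' c hcx hc.ne' (Or.inl hc))
        · refine ⟨a, fun c hc => ?_⟩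
          by_cases hcx : c = x
          · exact Or.inl hcx
          · exact Or.inr (h' c hcx hc.ne' (Or.inl hc)).symm
      refine ⟨v, w, hvx, ?_, hw⟩
      obtain ⟨c, hc, hcx, hcw⟩ := hcon v x w
      rcases hw c hc with h | rfl | h
      · exact absurd h hcx
      · exact hc
      · exact absurd h hcw
  -- No vertex has its neighbours confined to two vertices, so each member of a list of three that
  -- contains all neighbours is itself a neighbour.
  have hthree : ∀ x a b c, (∀ d, G.Adj x d → d = a ∨ d = b ∨ d = c) →
      G.Adj x a ∧ G.Adj x b ∧ G.Adj x c := by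
    intro x a b c h
    refine ⟨?_, ?_, ?_⟩
    · obtain ⟨d, hd, h1, h2⟩ := hcon x b c
      rcases h d hd with rfl | h | h
      exacts [hd, absurd h h1, absurd h h2]
    · obtain ⟨d, hd, h1, h2⟩ := hcon x a c
      rcases h d hd with h | rfl | h
      exacts [absurd h h1, hd, absurd h h2]
    · obtain ⟨d, hd, h1, h2⟩ := hcon x a b
      rcases h d hd with h | h | rfl
      exacts [absurd h h1, absurd h h2, hd]
  -- If twins `x`, `z` have the nonadjacent common neighbours `y`, `w`, then `y` has two further
  -- neighbours. With only one, `u`, the alternative `hedge` for `yu` would make `x` or `z` adjacent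
  -- to `u`.
  have hpoor : ∀ x z y w, (∀ c, G.Adj x c → c = z ∨ c = y ∨ c = w) →
      (∀ c, G.Adj z c → c = x ∨ c = y ∨ c = w) → ¬G.Adj y w → ∀ u,
      ¬∀ c, G.Adj y c → c = x ∨ c = z ∨ c = u := by
    intro x z y w hx hz hyw u hu
    obtain ⟨hyx, hyz, hyu⟩ := hthree y x z u hu
    have huw : u ≠ w := by rintro rfl; exact hyw hyu
    have huz : u ≠ z := by
      rintro rfl
      obtain ⟨d, hd, h1, h2⟩ := hcon y x u
      rcases hu d hd with h | h | h
      exacts [h1 h, h2 h, h2 h]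
    have hux : u ≠ x := by
      rintro rfl
      obtain ⟨d, hd, h1, h2⟩ := hcon y u z
      rcases hu d hd with h | h | h
      exacts [h1 h, h2 h, h1 h]
    have hxu : ¬G.Adj x u := by
      intro h
      rcases hx u h with h | h | h
      exacts [huz h, hyu.ne' h, huw h]
    have hzu : ¬G.Adj z u := by
      intro h
      rcases hz u h with h | h | h
      exacts [hux h, hyu.ne' h, huw h]
    rcases hedge y u hyu with ⟨v, -, hvy, hvu, -⟩ | ⟨a, b, hy, hu'⟩
    · rcases hu v hvy.symm with rfl | rfl | rfl
      exacts [hxu hvu, hzu hvu, G.irrefl hvu]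
    · obtain ⟨-, hua, hub⟩ := hthree u y a b hu'
      rcases hy x hyx with h | h | h
      · exact hux h.symm
      · exact hxu (h ▸ hua.symm)
      · exact hxu (h ▸ hub.symm)
  -- Adjacent twins are impossible: delete `z` and contract `x` into `y`. This joins `y` to `w` and
  -- leaves all other degrees unchanged, so a vertex of degree at most two must be `y` or `w`,
  -- contrary to `hpoor`.
  have htwin : ∀ x z y w, (∀ c, G.Adj x c → c = z ∨ c = y ∨ c = w) →
      (∀ c, G.Adj z c → c = x ∨ c = y ∨ c = w) → False := by
    intro x z y w hx hz
    obtain ⟨hxz, hxy, hxw⟩ := hthree x z y w hx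
    obtain ⟨-, hzy, hzw⟩ := hthree z x y w hz
    have hyw : ¬G.Adj y w := hG.not_clique hxz hxy hxw hzy hzw
    have hne : y ≠ w := by
      rintro rfl
      obtain ⟨d, hd, h1, h2⟩ := hcon x z y
      rcases hx d hd with h | h | h
      exacts [h1 h, h2 h, h2 h]
    have hyS : y ∉ ({x, z} : Set V) := by simp [hxy.ne', hzy.ne']
    have hwS : w ∉ ({x, z} : Set V) := by simp [hxw.ne', hzw.ne']
    have : Nonempty {v // v ∉ ({x, z} : Set V)} := ⟨⟨y, hyS⟩⟩
    obtain ⟨⟨v, hv⟩, ⟨a, ha⟩, ⟨b, hb⟩, h⟩ := ih _ (hcard {x, z} x (by simp))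
      (hG.contractInto (S := {x, z}) (by simp) hxy) rfl
    have hvx : v ≠ x := fun h => hv (by simp [h])
    have hvz : v ≠ z := fun h => hv (by simp [h])
    have h' : ∀ c, c ≠ x → c ≠ z → c ≠ v →
        (G.Adj v c ∨ (v = y ∧ G.Adj x c) ∨ (c = y ∧ G.Adj x v)) → c = a ∨ c = b := by
      intro c hc hc' hcv hadj
      have := h ⟨c, by simp [hc, hc']⟩ ⟨fun h => hcv (congrArg Subtype.val h).symm, hadj⟩
      simpa [Subtype.ext_iff] using this
    by_cases hvy : v = y
    · subst hvy
      have hw := h' w hxw.ne' hzw.ne' (Ne.symm hne) (Or.inr (Or.inl ⟨rfl, hxw⟩))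
      rcases hw with rfl | rfl
      · refine hpoor x z v w hx hz hyw b fun c hc => ?_
        by_cases hcx : c = x
        · exact Or.inl hcx
        by_cases hcz : c = z
        · exact Or.inr (Or.inl hcz)
        rcases h' c hcx hcz hc.ne' (Or.inl hc) with rfl | h
        · exact absurd hc hyw
        · exact Or.inr (Or.inr h)
      · refine hpoor x z v w hx hz hyw a fun c hc => ?_
        by_cases hcx : c = x
        · exact Or.inl hcx
        by_cases hcz : c = z
        · exact Or.inr (Or.inl hcz)
        rcases h' c hcx hcz hc.ne' (Or.inl hc) with h | rfl
        · exact Or.inr (Or.inr h)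
        · exact absurd hc hyw
    by_cases hvw : v = w
    · subst hvw
      have hpoor' := hpoor x z v y (fun c hc => (hx c hc).imp_right Or.symm)
        (fun c hc => (hz c hc).imp_right Or.symm) (fun h => hyw h.symm)
      have hw := h' y hxy.ne' hzy.ne' hne (Or.inr (Or.inr ⟨rfl, hxw⟩))
      rcases hw with rfl | rfl
      · refine hpoor' b fun c hc => ?_
        by_cases hcx : c = x
        · exact Or.inl hcx
        by_cases hcz : c = z
        · exact Or.inr (Or.inl hcz)
        rcases h' c hcx hcz hc.ne' (Or.inl hc) with rfl | h
        · exact absurd hc.symm hyw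
        · exact Or.inr (Or.inr h)
      · refine hpoor' a fun c hc => ?_
        by_cases hcx : c = x
        · exact Or.inl hcx
        by_cases hcz : c = z
        · exact Or.inr (Or.inl hcz)
        rcases h' c hcx hcz hc.ne' (Or.inl hc) with h | rfl
        · exact Or.inr (Or.inr h)
        · exact absurd hc.symm hyw
    obtain ⟨c, hc, h1, h2⟩ := hcon v a b
    have hcx : c ≠ x := by
      rintro rfl
      rcases hx v hc.symm with h | h | h
      exacts [hvz h, hvy h, hvw h]
    have hcz : c ≠ z := by
      rintro rfl
      rcases hz v hc.symm with h | h | h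
      exacts [hvx h, hvy h, hvw h]
    rcases h' c hcx hcz hc.ne' (Or.inl hc) with h | h
    exacts [h1 h, h2 h]
  obtain ⟨x⟩ := hne
  obtain ⟨y, hxy, -, -⟩ := hcon x x x
  rcases hedge x y hxy with ⟨z, w, hzx, hzy, hz⟩ | ⟨a, b, hx, hy⟩
  · obtain ⟨-, -, hzw⟩ := hthree z x y w hz
    -- Now `z` has exactly the neighbours `x`, `y`, `w`. A second use of the alternative, on `zw`,
    -- gives a vertex of degree three among `x` and `y`, which is a twin of `z`, or makes `z` and
    -- `w` twins.
    rcases hedge z w hzw with ⟨v, w', hvz, hvw, hv⟩ | ⟨a, b, h1, h2⟩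
    · have hyw : y ≠ w := by
        rintro rfl
        obtain ⟨d, hd, h1, h2⟩ := hcon z x y
        rcases hz d hd with h | h | h
        exacts [h1 h, h2 h, h2 h]
      have hxw : x ≠ w := by
        rintro rfl
        obtain ⟨d, hd, h1, h2⟩ := hcon z x y
        rcases hz d hd with h | h | h
        exacts [h1 h, h2 h, h1 h]
      rcases hz v hvz.symm with rfl | rfl | rfl
      · have : y = w' := by
          rcases hv y hxy with h | h | h
          exacts [absurd h hzy.ne', absurd h hyw, h]
        subst this
        exact htwin v z y w (fun c hc => (hv c hc).imp_right Or.symm) hz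
      · have : x = w' := by
          rcases hv x hxy.symm with h | h | h
          exacts [absurd h hzx.ne', absurd h hxw, h]
        subst this
        refine htwin v z x w (fun c hc => (hv c hc).imp_right Or.symm) fun c hc => ?_
        rcases hz c hc with h | h | h
        exacts [Or.inr (Or.inl h), Or.inl h, Or.inr (Or.inr h)]
      · exact G.irrefl hvw
    · exact htwin z w a b h1 h2
  · exact htwin x y a b hx hy

/-! ### Angles -/

theorem Real.cos_le_cos_of_abs_sub_le {α β γ : ℝ} (hγ : γ ≤ Real.pi) (h : |α - β| ≤ γ) :
    Real.cos γ ≤ Real.cos (α - β) := by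
  rw [← Real.cos_abs (α - β)]
  exact Real.cos_le_cos_of_nonneg_of_le_pi (abs_nonneg _) hγ h

theorem Real.cos_add_le_cos {α β γ : ℝ} (hγ : 0 ≤ γ) (h1 : γ ≤ α + β)
    (h2 : γ ≤ 2 * Real.pi - α - β) : Real.cos (α + β) ≤ Real.cos γ := by
  rcases le_total (α + β) Real.pi with h | h
  · exact Real.cos_le_cos_of_nonneg_of_le_pi hγ h h1
  · rw [← Real.cos_two_pi_sub (α + β)]
    exact Real.cos_le_cos_of_nonneg_of_le_pi hγ (by linarith) (by linarith)

/-- Three angles that satisfy the spherical triangle inequalities are the angles between three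
unit vectors. -/
theorem exists_unit_vectors_of_angles {α β γ : ℝ} (hα : 0 ≤ α) (hα' : α ≤ Real.pi) (hβ : 0 ≤ β)
    (hβ' : β ≤ Real.pi) (hγ : 0 ≤ γ) (hγ' : γ ≤ Real.pi) (h1 : |α - β| ≤ γ) (h2 : γ ≤ α + β)
    (h3 : γ ≤ 2 * Real.pi - α - β) :
    ∃ x y z : EuclideanSpace ℝ (Fin 3), ⟪x, x⟫_ℝ = 1 ∧ ⟪y, y⟫_ℝ = 1 ∧ ⟪z, z⟫_ℝ = 1 ∧
      ⟪x, y⟫_ℝ = Real.cos α ∧ ⟪x, z⟫_ℝ = Real.cos β ∧ ⟪y, z⟫_ℝ = Real.cos γ := by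
  have hsa := Real.sin_nonneg_of_nonneg_of_le_pi hα hα'
  have hsb := Real.sin_nonneg_of_nonneg_of_le_pi hβ hβ'
  have hlo := Real.cos_add_le_cos hγ h2 h3
  have hhi := Real.cos_le_cos_of_abs_sub_le hγ' h1
  rw [Real.cos_add] at hlo
  rw [Real.cos_sub] at hhi
  -- `x` is the first basis vector, `y` lies in the plane of the first two, and `t` is the second
  -- coordinate of `z`. The angle inequalities say `|cos γ - cos α cos β| ≤ sin α sin β`, so `t`
  -- fits; it is free if `sin α = 0`.
  obtain ⟨t, ht, htb⟩ : ∃ t, Real.cos α * Real.cos β + t * Real.sin α = Real.cos γ ∧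
      t ^ 2 ≤ Real.sin β ^ 2 := by
    rcases hsa.eq_or_lt with h | h
    · refine ⟨0, ?_, by simpa using sq_nonneg _⟩
      rw [← h] at hlo hhi ⊢
      linarith
    · refine ⟨(Real.cos γ - Real.cos α * Real.cos β) / Real.sin α, by field_simp; ring, ?_⟩
      rw [sq_le_sq, abs_of_nonneg hsb, abs_le, le_div_iff₀ h, div_le_iff₀ h]
      constructor <;> linarith
  have hs : √(Real.sin β ^ 2 - t ^ 2) ^ 2 = Real.sin β ^ 2 - t ^ 2 :=
    Real.sq_sqrt (by linarith)
  have ha := Real.sin_sq_add_cos_sq α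
  have hb := Real.sin_sq_add_cos_sq β
  refine ⟨!₂[1, 0, 0], !₂[Real.cos α, Real.sin α, 0],
    !₂[Real.cos β, t, √(Real.sin β ^ 2 - t ^ 2)], ?_, ?_, ?_, ?_, ?_, ?_⟩ <;>
    rw [PiLp.inner_apply, Fin.sum_univ_three] <;> simp <;> linarith

/-- Fourier–Motzkin elimination for the spherical triangle inequalities. -/
theorem exists_angles_of_bounds {θ l₁ u₁ l₂ u₂ : ℝ} (hθ : 0 ≤ θ) (hθ' : θ ≤ Real.pi)
    (hl₁ : 0 ≤ l₁) (hlu₁ : l₁ ≤ u₁) (hu₁ : u₁ ≤ Real.pi) (hl₂ : 0 ≤ l₂) (hlu₂ : l₂ ≤ u₂)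
    (hu₂ : u₂ ≤ Real.pi) (h1 : θ ≤ u₁ + u₂) (h2 : θ ≤ 2 * Real.pi - l₁ - l₂) (h3 : l₂ ≤ u₁ + θ)
    (h4 : l₁ ≤ u₂ + θ) :
    ∃ θ₁ θ₂, l₁ ≤ θ₁ ∧ θ₁ ≤ u₁ ∧ l₂ ≤ θ₂ ∧ θ₂ ≤ u₂ ∧ |θ₁ - θ₂| ≤ θ ∧ θ ≤ θ₁ + θ₂ ∧
      θ ≤ 2 * Real.pi - θ₁ - θ₂ := by
  -- `θ₁ = x` is the largest of the lower bounds forced on it, and then `θ₂` is the least value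
  -- left.
  obtain ⟨x, hx⟩ : ∃ x, x = max l₁ (max (l₂ - θ) (θ - u₂)) := ⟨_, rfl⟩
  have hx1 : l₁ ≤ x := hx ▸ le_max_left _ _
  have hx2 : l₂ - θ ≤ x := hx ▸ (le_max_left _ _).trans (le_max_right _ _)
  have hx3 : θ - u₂ ≤ x := hx ▸ (le_max_right _ _).trans (le_max_right _ _)
  have hxu : ∀ r, l₁ ≤ r → l₂ - θ ≤ r → θ - u₂ ≤ r → x ≤ r := fun r a b c =>
    hx ▸ max_le a (max_le b c)
  have e1 := hxu u₁ hlu₁ (by linarith) (by linarith)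
  have e2 := hxu (2 * Real.pi - θ - l₂) (by linarith) (by linarith) (by linarith)
  have e3 := hxu (θ + u₂) (by linarith) (by linarith) (by linarith)
  refine ⟨x, max l₂ |x - θ|, hx1, e1, le_max_left _ _,
    max_le hlu₂ (abs_le.mpr ⟨by linarith, by linarith⟩), ?_, ?_, ?_⟩
  · rw [abs_le]
    have h5 : max l₂ |x - θ| ≤ x + θ :=
      max_le (by linarith) (abs_le.mpr ⟨by linarith, by linarith⟩)
    have h6 := (le_abs_self (x - θ)).trans (le_max_right l₂ _)
    constructor <;> linarith
  · have h6 := (neg_le_abs (x - θ)).trans (le_max_right l₂ _)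
    linarith
  · have h5 : max l₂ |x - θ| ≤ 2 * Real.pi - x - θ :=
      max_le (by linarith) (abs_le.mpr ⟨by linarith, by linarith⟩)
    linarith

/-! ### Antipodal metrics on series parallel graphs -/

/-- Adding one row and column to a positive semidefinite matrix. -/
theorem exists_posSemidef_attach {V F : Type*} [Finite V] [NormedAddCommGroup F]
    [InnerProductSpace ℝ F] (v : V) {M : Matrix {w // w ∉ ({v} : Set V)} {w // w ∉ ({v} : Set V)} ℝ}
    (hM : M.PosSemidef) (f : V → F) (B : Set V)
    (h : ∀ i j : {w // w ∉ ({v} : Set V)}, (i : V) ∈ B → (j : V) ∈ B → ⟪f i, f j⟫_ℝ = M i j) :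
    ∃ N : Matrix V V ℝ, N.PosSemidef ∧ (∀ i j : {w // w ∉ ({v} : Set V)}, N i j = M i j) ∧
      ∀ i ∈ B, ∀ j ∈ B, N i j = ⟪f i, f j⟫_ℝ := by
  obtain ⟨M', hM', hMM'⟩ := hM.exists_extend (f := Subtype.val) Subtype.val_injective
  obtain ⟨N, hN, h1, h2⟩ := hM'.exists_amalgam (Matrix.posSemidef_gram ℝ f) {w | w ≠ v} B (by
    rintro i ⟨hi, hi'⟩ j ⟨hj, hj'⟩
    rw [Matrix.gram_apply]
    exact (hMM' ⟨i, hi⟩ ⟨j, hj⟩).trans (h ⟨i, hi⟩ ⟨j, hj⟩ hi' hj').symm)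
  exact ⟨N, hN, fun i j => (h1 i i.2 j j.2).trans (hMM' i j), fun i hi j hj => h2 i hi j hj⟩

/-- A pseudometric on the double cover of `V` that is bounded by `π` and for which opposite points
have distance `π`. -/
structure IsAntipodalMetric {V : Type*} (D : V × ℤˣ → V × ℤˣ → ℝ) : Prop where
  symm : ∀ x y, D x y = D y x
  triangle : ∀ x y z, D x z ≤ D x y + D y z
  bar_bar : ∀ x y, D (bar x) (bar y) = D x y
  le_pi : ∀ x y, D x y ≤ Real.pi
  pi_le : ∀ x, Real.pi ≤ D x (bar x)

/-- A pseudometric on the double cover of a graph without `K₄` minor bounds the angles between the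
vectors of some family of unit vectors, for the edges of the graph. -/
theorem IsSeriesParallel.exists_posSemidef {V : Type*} [Finite V] {G : SimpleGraph V}
    (hG : IsSeriesParallel G) {D : V × ℤˣ → V × ℤˣ → ℝ} (hD : IsAntipodalMetric D) :
    ∃ M : Matrix V V ℝ, M.PosSemidef ∧ (∀ i, M i i = 1) ∧ ∀ i j, G.Adj i j → ∃ θ : ℝ,
      M i j = Real.cos θ ∧ Real.pi - D (i, 1) (j, -1) ≤ θ ∧ θ ≤ D (i, 1) (j, 1) := by
  classical
  induction hn : Nat.card V using Nat.strong_induction_on generalizing V with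
  | _ n ih =>
  rcases isEmpty_or_nonempty V with hV | hV
  · exact ⟨1, Matrix.PosSemidef.one, fun i => isEmptyElim i, fun i => isEmptyElim i⟩
  obtain ⟨v, a, b, hv⟩ := hG.exists_degree_le_two
  have hcard : Nat.card {w // w ∉ ({v} : Set V)} < n := by
    rw [← hn]
    exact Finite.card_subtype_lt (x := v) (by simp)
  let D' : {w // w ∉ ({v} : Set V)} × ℤˣ → {w // w ∉ ({v} : Set V)} × ℤˣ → ℝ :=
    fun x y => D (x.1, x.2) (y.1, y.2)
  have hD' : IsAntipodalMetric D' :=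
    ⟨fun _ _ => hD.symm _ _, fun _ _ _ => hD.triangle _ _ _, fun _ _ => hD.bar_bar (_, _) (_, _),
      fun _ _ => hD.le_pi _ _, fun _ => hD.pi_le (_, _)⟩
  have hbar : ∀ i j : V, D (i, -1) (j, -1) = D (i, 1) (j, 1) := fun i j => hD.bar_bar (i, 1) (j, 1)
  have hbar' : ∀ i j : V, D (i, -1) (j, 1) = D (i, 1) (j, -1) := fun i j => by
    simpa [bar] using hD.bar_bar (i, 1) (j, -1)
  have hpi : ∀ i j : V, Real.pi ≤ D (i, 1) (j, 1) + D (i, 1) (j, -1) := fun i j => by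
    have h1 := hD.pi_le (j, 1)
    have h2 := hD.triangle (j, 1) (i, 1) (j, -1)
    rw [hD.symm (j, 1) (i, 1)] at h2
    exact h1.trans h2
  -- the inductive step, from a family of vectors on `v` and its neighbours
  have step : ∀ (G' : SimpleGraph {w // w ∉ ({v} : Set V)}) (_ : IsSeriesParallel G')
      (_ : ∀ i j : {w // w ∉ ({v} : Set V)}, G.Adj i j → G'.Adj i j)
      (M : Matrix {w // w ∉ ({v} : Set V)} {w // w ∉ ({v} : Set V)} ℝ) (_ : M.PosSemidef)
      (_ : ∀ i, M i i = 1) (_ : ∀ i j, G'.Adj i j → ∃ θ : ℝ,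
      M i j = Real.cos θ ∧ Real.pi - D' (i, 1) (j, -1) ≤ θ ∧ θ ≤ D' (i, 1) (j, 1))
      (f : V → EuclideanSpace ℝ (Fin 3)) (B : Set V) (_ : v ∈ B) (_ : ⟪f v, f v⟫_ℝ = 1)
      (_ : ∀ w, G.Adj v w → w ∈ B ∧ ∃ θ : ℝ, ⟪f v, f w⟫_ℝ = Real.cos θ ∧
        Real.pi - D (v, 1) (w, -1) ≤ θ ∧ θ ≤ D (v, 1) (w, 1))
      (_ : ∀ i j : {w // w ∉ ({v} : Set V)}, (i : V) ∈ B → (j : V) ∈ B → ⟪f i, f j⟫_ℝ = M i j),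
      ∃ M : Matrix V V ℝ, M.PosSemidef ∧ (∀ i, M i i = 1) ∧ ∀ i j, G.Adj i j → ∃ θ : ℝ,
      M i j = Real.cos θ ∧ Real.pi - D (i, 1) (j, -1) ≤ θ ∧ θ ≤ D (i, 1) (j, 1) := by
    intro G' hG' hGG' M hM hM1 hMθ f B hvB hfv hfθ hfM
    obtain ⟨N, hN, hN1, hN2⟩ := exists_posSemidef_attach v hM f B hfM
    refine ⟨N, hN, fun i => ?_, fun i j hij => ?_⟩
    · by_cases hi : i = v
      · rw [hi, hN2 v hvB v hvB, hfv]
      · exact (hN1 ⟨i, hi⟩ ⟨i, hi⟩).trans (hM1 _)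
    · by_cases hi : i = v
      · subst hi
        obtain ⟨hj, θ, h⟩ := hfθ j hij
        exact ⟨θ, by rw [hN2 i hvB j hj, h.1], h.2⟩
      · by_cases hj : j = v
        · subst hj
          obtain ⟨hi', θ, h⟩ := hfθ i hij.symm
          refine ⟨θ, by rw [hN2 i hi' j hvB, real_inner_comm, h.1], ?_, ?_⟩
          · rw [hD.symm, hbar']; exact h.2.1
          · rw [hD.symm]; exact h.2.2
        · obtain ⟨θ, h⟩ := hMθ ⟨i, hi⟩ ⟨j, hj⟩ (hGG' ⟨i, hi⟩ ⟨j, hj⟩ hij)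
          exact ⟨θ, (hN1 ⟨i, hi⟩ ⟨j, hj⟩).trans h.1, h.2⟩
  have rel : ∀ {i : V}, i ≠ v → ∃ i' : {w // w ∉ ({v} : Set V)}, (i' : V) = i :=
    fun {i} hi => ⟨⟨i, hi⟩, rfl⟩
  -- a vertex with one neighbour
  have one : ∀ a, G.Adj v a → (∀ c, G.Adj v c → c = a) →
      ∃ M : Matrix V V ℝ, M.PosSemidef ∧ (∀ i, M i i = 1) ∧ ∀ i j, G.Adj i j → ∃ θ : ℝ,
      M i j = Real.cos θ ∧ Real.pi - D (i, 1) (j, -1) ≤ θ ∧ θ ≤ D (i, 1) (j, 1) := by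
    intro a hva ha
    obtain ⟨M, hM, hM1, hMθ⟩ := ih _ hcard (hG.induce _) hD' rfl
    have h0 : 0 ≤ D (v, 1) (a, 1) := by linarith [hpi v a, hD.le_pi (v, 1) (a, -1)]
    -- Only two unit vectors at a given angle are needed; the third one is a copy of `y`, at angle
    -- `0` from it.
    obtain ⟨x, y, -, hx, hy, -, hxy, -, -⟩ := exists_unit_vectors_of_angles
      h0 (hD.le_pi _ _) h0 (hD.le_pi _ _) le_rfl Real.pi_pos.le (by simp) (by linarith)
      (by linarith [hD.le_pi (v, 1) (a, 1)])
    have hav : a ≠ v := hva.ne'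
    refine step _ (hG.induce _) (fun i j h => h) M hM hM1 hMθ
      (fun i => if i = v then x else y) {v, a} (by simp) (by simpa using hx) ?_ ?_
    · intro w hw
      obtain rfl := ha w hw
      refine ⟨by simp, _, by simpa [hav] using hxy, by linarith [hpi v w], le_rfl⟩
    · rintro ⟨i, hi⟩ ⟨j, hj⟩ hi' hj'
      obtain rfl : i = a := by simpa [show i ≠ v from hi] using hi'
      obtain rfl : j = i := by simpa [show j ≠ v from hj] using hj'
      rw [hM1]
      simpa [hav] using hy
  by_cases hva : G.Adj v a
  · by_cases hvb : G.Adj v b ∧ a ≠ b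
    · obtain ⟨hvb, hab⟩ := hvb
      have hav : a ≠ v := hva.ne'
      have hbv : b ≠ v := hvb.ne'
      -- Contracting `v` into `a` makes `a` and `b` adjacent, so that the induction also bounds the
      -- angle between their vectors.
      have hG' := hG.contractInto (S := {v}) rfl hva
      obtain ⟨M, hM, hM1, hMθ⟩ := ih _ hcard hG' hD' rfl
      obtain ⟨θ, hθ, hθl, hθu⟩ := hMθ ⟨a, hav⟩ ⟨b, hbv⟩
        ⟨fun h => hab (congrArg Subtype.val h), Or.inr (Or.inl ⟨rfl, hvb⟩)⟩
      replace hθl : Real.pi - D (a, 1) (b, -1) ≤ θ := hθl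
      replace hθu : θ ≤ D (a, 1) (b, 1) := hθu
      -- The triangle inequalities through `v`, for the four choices of sheets at `a` and `b`, are
      -- precisely the compatibility conditions of `exists_angles_of_bounds`.
      have t1 := hD.triangle (a, 1) (v, 1) (b, 1)
      have t2 := hD.triangle (a, -1) (v, 1) (b, -1)
      have t3 := hD.triangle (a, 1) (v, 1) (b, -1)
      have t4 := hD.triangle (a, -1) (v, 1) (b, 1)
      rw [hbar, hD.symm _ (v, 1)] at t2
      rw [hbar', hD.symm _ (v, 1)] at t4
      rw [hD.symm _ (v, 1)] at t1 t3
      have p1 := hD.le_pi (a, 1) (b, -1)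
      have p2 := hD.le_pi (a, 1) (b, 1)
      have p3 := hD.le_pi (v, 1) (a, 1)
      have p4 := hD.le_pi (v, 1) (a, -1)
      have p5 := hD.le_pi (v, 1) (b, 1)
      have p6 := hD.le_pi (v, 1) (b, -1)
      have q1 := hpi v a
      have q2 := hpi v b
      obtain ⟨θ₁, θ₂, h1, h2, h3, h4, h5, h6, h7⟩ := exists_angles_of_bounds (θ := θ)
        (l₁ := Real.pi - D (v, 1) (a, -1)) (u₁ := D (v, 1) (a, 1))
        (l₂ := Real.pi - D (v, 1) (b, -1)) (u₂ := D (v, 1) (b, 1)) (by linarith) (by linarith)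
        (by linarith) (by linarith) p3 (by linarith) (by linarith) p5 (by linarith) (by linarith)
        (by linarith) (by linarith)
      obtain ⟨x, y, z, hx, hy, hz, hxy, hxz, hyz⟩ := exists_unit_vectors_of_angles (α := θ₁)
        (β := θ₂) (γ := θ) (by linarith) (by linarith) (by linarith) (by linarith) (by linarith)
        (by linarith) h5 h6 h7
      refine step _ hG' (fun i j h => ⟨fun h' => h.ne (congrArg Subtype.val h'), Or.inl h⟩) M hM
        hM1 hMθ (fun i => if i = v then x else if i = a then y else z) {v, a, b} (by simp)
        (by simpa using hx) ?_ ?_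
      · intro w hw
        rcases hv w hw with rfl | rfl
        · exact ⟨by simp, θ₁, by simpa [hav] using hxy, h1, h2⟩
        · exact ⟨by simp, θ₂, by simpa [hbv, hab.symm] using hxz, h3, h4⟩
      · rintro ⟨i, hi⟩ ⟨j, hj⟩ hi' hj'
        have hi'' : i = a ∨ i = b := by simpa [show i ≠ v from hi] using hi'
        have hj'' : j = a ∨ j = b := by simpa [show j ≠ v from hj] using hj'
        rcases hi'' with rfl | rfl <;> rcases hj'' with rfl | rfl
        · rw [hM1]; simpa [hav] using hy
        · rw [hθ]; simpa [hav, hbv, hab.symm] using hyz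
        · rw [hM.symm_apply, hθ, real_inner_comm]; simpa [hav, hbv, hab.symm] using hyz
        · rw [hM1]; simpa [hbv, hab.symm] using hz
    · refine one a hva fun c hc => ?_
      rcases hv c hc with h | rfl
      · exact h
      · by_contra hca
        exact hvb ⟨hc, fun h => hca h.symm⟩
  · by_cases hvb : G.Adj v b
    · refine one b hvb fun c hc => ?_
      rcases hv c hc with rfl | h
      · exact absurd hc hva
      · exact h
    · obtain ⟨M, hM, hM1, hMθ⟩ := ih _ hcard (hG.induce _) hD' rfl
      have h0 := Real.pi_pos
      refine step _ (hG.induce _) (fun i j h => h) M hM hM1 hMθ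
        (fun _ => EuclideanSpace.single 0 1) {v} (by simp) (by simp) ?_ ?_
      · intro w hw
        rcases hv w hw with rfl | rfl
        · exact absurd hw hva
        · exact absurd hw hvb
      · rintro ⟨i, hi⟩ ⟨j, hj⟩ hi' hj'
        exact absurd hi' hi

/-! ### Edge angles and their convexity -/

/-- The angle between the vectors of two vertices of weights `A` and `B` of a locally rank one
matrix, after the addition of `ε` on the diagonal. -/
noncomputable def edgeAngle (ε A B : ℝ) : ℝ :=
  Real.arccos (√A * √B / (√(A + ε) * √(B + ε)))

theorem edgeAngle_comm (ε A B : ℝ) : edgeAngle ε A B = edgeAngle ε B A := by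
  rw [edgeAngle, edgeAngle, mul_comm √A, mul_comm √(A + ε)]

theorem edgeAngle_nonneg (ε A B : ℝ) : 0 ≤ edgeAngle ε A B := Real.arccos_nonneg _

theorem edgeAngle_le_pi_div_two (ε A B : ℝ) : edgeAngle ε A B ≤ Real.pi / 2 :=
  Real.arccos_le_pi_div_two.mpr (by positivity)

theorem edgeAngle_le_pi (ε A B : ℝ) : edgeAngle ε A B ≤ Real.pi := Real.arccos_le_pi _

theorem sqrt_mul_sqrt_div_le_one {ε A B : ℝ} (hε : 0 ≤ ε) :
    √A * √B / (√(A + ε) * √(B + ε)) ≤ 1 :=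
  div_le_one_of_le₀ (mul_le_mul (Real.sqrt_le_sqrt (by linarith)) (Real.sqrt_le_sqrt (by linarith))
    (Real.sqrt_nonneg _) (Real.sqrt_nonneg _)) (by positivity)

theorem cos_edgeAngle {ε A B : ℝ} (hε : 0 ≤ ε) :
    Real.cos (edgeAngle ε A B) = √A * √B / (√(A + ε) * √(B + ε)) :=
  Real.cos_arccos (le_trans (by norm_num) (show 0 ≤ _ by positivity))
    (sqrt_mul_sqrt_div_le_one hε)

/-- At this angle, vectors whose squared lengths are raised by `ε` keep the inner product of the
rank one matrix. -/
theorem mul_cos_edgeAngle {ε A B : ℝ} (hε : 0 < ε) (hA : 0 ≤ A) (hB : 0 ≤ B) :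
    √(A + ε) * √(B + ε) * Real.cos (edgeAngle ε A B) = √A * √B := by
  rw [cos_edgeAngle hε.le]
  have : √(A + ε) * √(B + ε) ≠ 0 := by positivity
  field_simp

/-- The three angles occur together: take a common first coordinate direction and private directions
of length `√ε`. -/
theorem edgeAngle_triangle {ε A B C : ℝ} (hε : 0 < ε) (hA : 0 ≤ A) (hB : 0 ≤ B) (hC : 0 ≤ C) :
    edgeAngle ε A C ≤ edgeAngle ε A B + edgeAngle ε B C := by
  let x : EuclideanSpace ℝ (Fin 4) := !₂[√A, √ε, 0, 0]
  let y : EuclideanSpace ℝ (Fin 4) := !₂[√B, 0, √ε, 0]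
  let z : EuclideanSpace ℝ (Fin 4) := !₂[√C, 0, 0, √ε]
  have hx : ‖x‖ = √(A + ε) := by
    rw [EuclideanSpace.norm_eq]; simp [x, Fin.sum_univ_four, Real.sq_sqrt hA, Real.sq_sqrt hε.le]
  have hy : ‖y‖ = √(B + ε) := by
    rw [EuclideanSpace.norm_eq]; simp [y, Fin.sum_univ_four, Real.sq_sqrt hB, Real.sq_sqrt hε.le]
  have hz : ‖z‖ = √(C + ε) := by
    rw [EuclideanSpace.norm_eq]; simp [z, Fin.sum_univ_four, Real.sq_sqrt hC, Real.sq_sqrt hε.le]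
  have hxy : ⟪x, y⟫_ℝ = √A * √B := by
    rw [PiLp.inner_apply, Fin.sum_univ_four]; simp [x, y, mul_comm]
  have hyz : ⟪y, z⟫_ℝ = √B * √C := by
    rw [PiLp.inner_apply, Fin.sum_univ_four]; simp [y, z, mul_comm]
  have hxz : ⟪x, z⟫_ℝ = √A * √C := by
    rw [PiLp.inner_apply, Fin.sum_univ_four]; simp [x, z, mul_comm]
  have := InnerProductGeometry.angle_le_angle_add_angle x y z
  simpa only [InnerProductGeometry.angle, hx, hy, hz, hxy, hyz, hxz, edgeAngle] using this

/-- The angle of two vertices is at least the mean of the angles of two copies of them. -/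
theorem edgeAngle_ge_mean {ε A B : ℝ} (hε : 0 < ε) :
    (edgeAngle ε A A + edgeAngle ε B B) / 2 ≤ edgeAngle ε A B := by
  have h0 := edgeAngle_nonneg ε A A
  have h0' := edgeAngle_nonneg ε B B
  have h1 := edgeAngle_le_pi_div_two ε A A
  have h1' := edgeAngle_le_pi_div_two ε B B
  have hsum : Real.cos (edgeAngle ε A A) * Real.cos (edgeAngle ε B B) =
      Real.cos (edgeAngle ε A B) ^ 2 := by
    rw [cos_edgeAngle hε.le, cos_edgeAngle hε.le, cos_edgeAngle hε.le]
    ring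
  -- With `a`, `b` the two equal-weight angles, `cos a cos b = (cos (a + b) + cos (a - b)) / 2` is
  -- at most `cos² ((a + b) / 2)`, whereas `hsum` identifies it with the squared cosine of the mixed
  -- angle.
  by_contra! hlt
  have hcos := Real.cos_lt_cos_of_nonneg_of_le_pi (edgeAngle_nonneg ε A B) (by linarith) hlt
  have hpos : 0 ≤ Real.cos ((edgeAngle ε A A + edgeAngle ε B B) / 2) :=
    Real.cos_nonneg_of_neg_pi_div_two_le_of_le (by linarith) (by linarith)
  have hsq : Real.cos ((edgeAngle ε A A + edgeAngle ε B B) / 2) ^ 2 <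
      Real.cos (edgeAngle ε A B) ^ 2 := by
    nlinarith
  have e1 := Real.cos_sq ((edgeAngle ε A A + edgeAngle ε B B) / 2)
  rw [show 2 * ((edgeAngle ε A A + edgeAngle ε B B) / 2) = edgeAngle ε A A + edgeAngle ε B B by
    ring] at e1
  have e2 := Real.cos_add (edgeAngle ε A A) (edgeAngle ε B B)
  have e3 := Real.cos_sub (edgeAngle ε A A) (edgeAngle ε B B)
  have e4 := Real.cos_le_one (edgeAngle ε A A - edgeAngle ε B B)
  linarith

theorem cos_edgeAngle_self {ε A : ℝ} (hε : 0 < ε) (hA : 0 ≤ A) :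
    Real.cos (edgeAngle ε A A) = A / (A + ε) := by
  rw [cos_edgeAngle hε.le, Real.mul_self_sqrt hA, Real.mul_self_sqrt (by linarith)]

/-- The tangent line inequality for the convex function `x ↦ 1 / sin x ^ 2`. -/
theorem one_div_sin_sq_ge {x y : ℝ} (hx : 0 < x) (hx' : x ≤ Real.pi / 2) (hy : 0 < y)
    (hy' : y ≤ Real.pi / 2) :
    1 / Real.sin y ^ 2 - 2 * Real.cos y / Real.sin y ^ 3 * (x - y) ≤ 1 / Real.sin x ^ 2 := by
  have hsx : 0 < Real.sin x := Real.sin_pos_of_pos_of_lt_pi hx (by linarith)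
  have hsy : 0 < Real.sin y := Real.sin_pos_of_pos_of_lt_pi hy (by linarith)
  have hcy : 0 ≤ Real.cos y := Real.cos_nonneg_of_neg_pi_div_two_le_of_le (by linarith) hy'
  -- Concavity of the sine, followed by `1 - 2 z ≤ 1 / (1 + z) ^ 2`, gives the tangent of `1 / sin ^
  -- 2`.
  have htan : Real.sin x ≤ Real.sin y + Real.cos y * (x - y) := by
    have hconc := strictConcaveOn_sin_Icc.concaveOn
    have hx₁ : x ∈ Set.Icc 0 Real.pi := ⟨hx.le, by linarith⟩
    have hy₁ : y ∈ Set.Icc 0 Real.pi := ⟨hy.le, by linarith⟩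
    rcases lt_trichotomy x y with h | rfl | h
    · have := hconc.le_slope_of_hasDerivAt hx₁ hy₁ h (Real.hasDerivAt_sin y)
      rw [slope_def_field, le_div_iff₀ (by linarith)] at this
      linarith
    · simp
    · have := hconc.slope_le_of_hasDerivAt hy₁ hx₁ h (Real.hasDerivAt_sin y)
      rw [slope_def_field, div_le_iff₀ (by linarith)] at this
      linarith
  obtain ⟨z, hz⟩ : ∃ z, z = Real.cos y / Real.sin y * (x - y) := ⟨_, rfl⟩
  have h1 : Real.sin x ≤ Real.sin y * (1 + z) := by
    have : Real.sin y * (1 + z) = Real.sin y + Real.cos y * (x - y) := by rw [hz]; field_simp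
    rw [this]; exact htan
  have hz1 : 0 < 1 + z := by
    by_contra! h
    nlinarith
  have h2 : 1 / (Real.sin y * (1 + z)) ^ 2 ≤ 1 / Real.sin x ^ 2 :=
    one_div_le_one_div_of_le (by positivity) (pow_le_pow_left₀ hsx.le h1 2)
  have h3 : 1 - 2 * z ≤ 1 / (1 + z) ^ 2 := by
    rw [le_div_iff₀ (by positivity)]
    nlinarith [sq_nonneg z, mul_nonneg (sq_nonneg z) hz1.le]
  have h4 : 1 / Real.sin y ^ 2 - 2 * Real.cos y / Real.sin y ^ 3 * (x - y) =
      1 / Real.sin y ^ 2 * (1 - 2 * z) := by rw [hz]; field_simp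
  have h5 : 1 / (Real.sin y * (1 + z)) ^ 2 = 1 / Real.sin y ^ 2 * (1 / (1 + z) ^ 2) := by
    field_simp
  rw [h4]
  refine le_trans ?_ h2
  rw [h5]
  exact mul_le_mul_of_nonneg_left h3 (by positivity)

/-- The tangent line inequality for the convex function `A ↦ edgeAngle ε A A`. -/
theorem exists_edgeAngle_tangent {ε B : ℝ} (hε : 0 < ε) (hB : 0 < B) :
    ∃ κ, 0 ≤ κ ∧ ∀ A, 0 ≤ A → edgeAngle ε B B - κ * (A - B) ≤ edgeAngle ε A A := by
  -- In terms of the half angle, the weight is an affine function of `1 / sin ^ 2`, convex and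
  -- decreasing. Its tangent inequality is inverted below; `κ` is minus the derivative of `A ↦
  -- edgeAngle ε A A` at `B`.
  have key : ∀ A, 0 ≤ A → 0 < edgeAngle ε A A / 2 ∧ edgeAngle ε A A / 2 ≤ Real.pi / 4 ∧
      A = ε * (1 / (2 * Real.sin (edgeAngle ε A A / 2) ^ 2) - 1) := by
    intro A hA
    have hlt : 0 < edgeAngle ε A A := by
      refine (edgeAngle_nonneg ε A A).lt_of_ne fun h => ?_
      have := cos_edgeAngle_self hε hA
      rw [← h, Real.cos_zero, eq_div_iff (by linarith)] at this
      linarith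
    refine ⟨by linarith, by linarith [edgeAngle_le_pi_div_two ε A A], ?_⟩
    have hs : Real.sin (edgeAngle ε A A / 2) ^ 2 = (1 - A / (A + ε)) / 2 := by
      rw [Real.sin_sq_eq_half_sub, ← cos_edgeAngle_self hε hA,
        show 2 * (edgeAngle ε A A / 2) = edgeAngle ε A A by ring]
      ring
    rw [hs]
    have : A + ε ≠ 0 := by linarith
    have h2 : 1 - A / (A + ε) = ε / (A + ε) := by field_simp; ring
    rw [h2]
    field_simp
    ring
  obtain ⟨b1, b2, b3⟩ := key B hB.le
  have hpi := Real.pi_pos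
  have hsy : 0 < Real.sin (edgeAngle ε B B / 2) := Real.sin_pos_of_pos_of_lt_pi b1 (by linarith)
  have hcy : 0 < Real.cos (edgeAngle ε B B / 2) :=
    Real.cos_pos_of_mem_Ioo ⟨by linarith, by linarith⟩
  refine ⟨2 * Real.sin (edgeAngle ε B B / 2) ^ 3 / (ε * Real.cos (edgeAngle ε B B / 2)),
    by positivity, fun A hA => ?_⟩
  obtain ⟨a1, a2, a3⟩ := key A hA
  have h := one_div_sin_sq_ge a1 (by linarith) b1 (by linarith)
  obtain ⟨x, hx⟩ : ∃ x, x = edgeAngle ε A A / 2 := ⟨_, rfl⟩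
  obtain ⟨y, hy⟩ : ∃ y, y = edgeAngle ε B B / 2 := ⟨_, rfl⟩
  have hx' : edgeAngle ε A A = 2 * x := by linarith
  have hy' : edgeAngle ε B B = 2 * y := by linarith
  rw [← hx] at a3 h
  rw [← hy] at b3 h hsy hcy ⊢
  rw [hx', hy']
  have hAB : -(ε * Real.cos y / Real.sin y ^ 3 * (x - y)) ≤ A - B := by
    have e1 : A - B = ε / 2 * (1 / Real.sin x ^ 2 - 1 / Real.sin y ^ 2) := by
      rw [a3, b3]; ring
    have e2 : -(ε * Real.cos y / Real.sin y ^ 3 * (x - y)) =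
        ε / 2 * -(2 * Real.cos y / Real.sin y ^ 3 * (x - y)) := by ring
    rw [e1, e2]
    exact mul_le_mul_of_nonneg_left (by linarith) (by positivity)
  have hmul := mul_le_mul_of_nonneg_left hAB
    (show 0 ≤ 2 * Real.sin y ^ 3 / (ε * Real.cos y) by positivity)
  have e3 : 2 * Real.sin y ^ 3 / (ε * Real.cos y) * -(ε * Real.cos y / Real.sin y ^ 3 * (x - y)) =
      -(2 * (x - y)) := by field_simp
  linarith

theorem cos_pi_div_mem_Ioo {g : ℕ} (hg : 3 ≤ g) : Real.cos (Real.pi / g) ∈ Set.Ioo (0 : ℝ) 1 := by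
  have hpi := Real.pi_pos
  have hg3 : (3 : ℝ) ≤ g := by exact_mod_cast hg
  have hlt : Real.pi / g < Real.pi / 2 := div_lt_div_of_pos_left hpi (by norm_num) (by linarith)
  have hpos : 0 < Real.pi / g := by positivity
  refine ⟨Real.cos_pos_of_mem_Ioo ⟨by linarith, hlt⟩, ?_⟩
  rw [← Real.cos_zero]
  exact Real.cos_lt_cos_of_nonneg_of_le_pi le_rfl (by linarith) hpos

theorem one_div_mul_one_div_cos_sub_one_pos {g : ℕ} (hg : 3 ≤ g) :
    0 < 1 / (g : ℝ) * (1 / Real.cos (Real.pi / g) - 1) := by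
  obtain ⟨h0, h1⟩ := cos_pi_div_mem_Ioo hg
  have : 1 < 1 / Real.cos (Real.pi / g) := by rwa [lt_div_iff₀ h0, one_mul]
  have hg0 : (0 : ℝ) < g := by positivity
  exact mul_pos (by positivity) (by linarith)

/-- The sum of the angles along a cycle with at least `g` vertices and weights of sum at most `τ`
is at least `π`. -/
theorem pi_le_sum_edgeAngle {g n : ℕ} (hg : 3 ≤ g) (hgn : g ≤ n) {τ ε : ℝ} (hτ : 0 < τ)
    (hε : ε = τ * (1 / (g : ℝ) * (1 / Real.cos (Real.pi / g) - 1))) {A : ℕ → ℝ}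
    (hA : ∀ k, 0 ≤ A k) (hsum : ∑ k ∈ Finset.range n, A k ≤ τ) (hcyc : A n = A 0) :
    Real.pi ≤ ∑ k ∈ Finset.range n, edgeAngle ε (A k) (A (k + 1)) := by
  have hpi := Real.pi_pos
  have hg0 : (0 : ℝ) < g := by positivity
  have hg3 : (3 : ℝ) ≤ g := by exact_mod_cast hg
  have hlt : Real.pi / g ≤ Real.pi := div_le_self hpi.le (by linarith)
  have hcos := (cos_pi_div_mem_Ioo hg).1
  have hε0 : 0 < ε := hε ▸ mul_pos hτ (one_div_mul_one_div_cos_sub_one_pos hg)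
  have hB : 0 < τ / g := by positivity
  -- This fixes the constant: for `g` equal weights of sum `τ`, the angles add up to exactly `π`.
  have hw : edgeAngle ε (τ / g) (τ / g) = Real.pi / g := by
    apply Real.injOn_cos ⟨edgeAngle_nonneg _ _ _, edgeAngle_le_pi _ _ _⟩
      ⟨by positivity, by linarith⟩
    rw [cos_edgeAngle_self hε0 hB.le, hε]
    field_simp
    ring
  -- Mixed angles are first replaced by equal-weight ones, which is possible on average around the
  -- cycle. Then the tangent at `τ / g` bounds their sum below by `n π / g`, since the weights sum
  -- to at most `n τ / g` and `κ ≥ 0`.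
  obtain ⟨κ, hκ, h⟩ := exists_edgeAngle_tangent hε0 hB
  rw [hw] at h
  have h1 : ∑ k ∈ Finset.range n, edgeAngle ε (A (k + 1)) (A (k + 1)) =
      ∑ k ∈ Finset.range n, edgeAngle ε (A k) (A k) := by
    have e1 := Finset.sum_range_succ (fun k => edgeAngle ε (A k) (A k)) n
    have e2 := Finset.sum_range_succ' (fun k => edgeAngle ε (A k) (A k)) n
    simp only [hcyc] at e1
    linarith
  have h2 : ∑ k ∈ Finset.range n, edgeAngle ε (A k) (A k) ≤
      ∑ k ∈ Finset.range n, edgeAngle ε (A k) (A (k + 1)) := by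
    have : ∑ k ∈ Finset.range n, (edgeAngle ε (A k) (A k) +
        edgeAngle ε (A (k + 1)) (A (k + 1))) / 2 ≤
        ∑ k ∈ Finset.range n, edgeAngle ε (A k) (A (k + 1)) :=
      Finset.sum_le_sum fun k _ => edgeAngle_ge_mean hε0
    rw [← Finset.sum_div, Finset.sum_add_distrib, h1] at this
    linarith
  have h3 : ∑ k ∈ Finset.range n, (Real.pi / g - κ * (A k - τ / g)) ≤
      ∑ k ∈ Finset.range n, edgeAngle ε (A k) (A k) :=
    Finset.sum_le_sum fun k _ => h (A k) (hA k)
  rw [Finset.sum_sub_distrib, ← Finset.mul_sum, Finset.sum_sub_distrib, Finset.sum_const,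
    Finset.sum_const, Finset.card_range, nsmul_eq_mul, nsmul_eq_mul] at h3
  have hgn' : (g : ℝ) ≤ n := by exact_mod_cast hgn
  have h4 : Real.pi ≤ n * (Real.pi / g) := by
    have := mul_le_mul_of_nonneg_right hgn' (show 0 ≤ Real.pi / g by positivity)
    rwa [mul_div_cancel₀ _ hg0.ne'] at this
  have h5 : τ ≤ n * (τ / g) := by
    have := mul_le_mul_of_nonneg_right hgn' (show 0 ≤ τ / g by positivity)
    rwa [mul_div_cancel₀ _ hg0.ne'] at this
  have h6 : κ * (∑ k ∈ Finset.range n, A k - n * (τ / g)) ≤ 0 :=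
    mul_nonpos_of_nonneg_of_nonpos hκ (by linarith)
  linarith

/-! ### Completions along a chain of layers -/

theorem edgeAngle_le_sum {ε : ℝ} (hε : 0 < ε) {A : ℕ → ℝ} (hA : ∀ k, 0 ≤ A k) (d : ℕ) :
    edgeAngle ε (A 0) (A (d + 1)) ≤
      ∑ k ∈ Finset.range (d + 1), edgeAngle ε (A k) (A (k + 1)) := by
  induction d with
  | zero => simp
  | succ d ih =>
    rw [Finset.sum_range_succ]
    exact (edgeAngle_triangle hε (hA _) (hA (d + 1)) (hA _)).trans (by linarith)

/-- A chain of unit vectors with prescribed consecutive angles, whose end points enclose a given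
angle. -/
theorem exists_chain {ε : ℝ} (hε : 0 < ε) {A : ℕ → ℝ} (hA : ∀ k, 0 ≤ A k) (N d : ℕ)
    (hd : d + 1 ≤ N) {θ : ℝ} (h1 : edgeAngle ε (A 0) (A (d + 1)) ≤ θ) (h2 : θ ≤ Real.pi)
    (h3 : θ ≤ ∑ k ∈ Finset.range (d + 1), edgeAngle ε (A k) (A (k + 1))) :
    ∃ M : Matrix (Fin (N + 1)) (Fin (N + 1)) ℝ, M.PosSemidef ∧
      (∀ i : Fin (N + 1), (i : ℕ) ≤ d + 1 → M i i = 1) ∧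
      (∀ i j : Fin (N + 1), (i : ℕ) + 1 = j → (j : ℕ) ≤ d + 1 →
        M i j = Real.cos (edgeAngle ε (A i) (A j))) ∧
      ∀ i j : Fin (N + 1), (i : ℕ) = 0 → (j : ℕ) = d + 1 → M i j = Real.cos θ := by
  induction d generalizing θ with
  | zero =>
    simp only [zero_add, Finset.sum_range_one] at h1 h3
    obtain rfl : θ = edgeAngle ε (A 0) (A 1) := le_antisymm h3 h1
    have h0 := edgeAngle_nonneg ε (A 0) (A 1)
    obtain ⟨x, y, -, hx, hy, -, hxy, -, -⟩ := exists_unit_vectors_of_angles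
      h0 h2 h0 h2 le_rfl Real.pi_pos.le (by simp) (by linarith) (by linarith)
    refine ⟨Matrix.gram ℝ fun i => if (i : ℕ) = 0 then x else y, Matrix.posSemidef_gram ℝ _,
      fun i _ => ?_, fun i j hij hj => ?_, fun i j hi hj => ?_⟩
    · rw [Matrix.gram_apply]
      by_cases hi : (i : ℕ) = 0
      · rw [if_pos hi, hx]
      · rw [if_neg hi, hy]
    · have hi : (i : ℕ) = 0 := by omega
      have hj : (j : ℕ) = 1 := by omega
      rw [Matrix.gram_apply, if_pos hi, if_neg (by omega), hxy, hi, hj]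
    · rw [Matrix.gram_apply, if_pos hi, if_neg (by omega), hxy]
  | succ d ih =>
    have hpi := Real.pi_pos
    have a1 := edgeAngle_nonneg ε (A 0) (A (d + 1))
    have a2 := edgeAngle_le_pi_div_two ε (A 0) (A (d + 1))
    have a3 := edgeAngle_nonneg ε (A (d + 1)) (A (d + 2))
    have a4 := edgeAngle_le_pi_div_two ε (A (d + 1)) (A (d + 2))
    have a5 := edgeAngle_nonneg ε (A 0) (A (d + 2))
    have t1 := edgeAngle_triangle hε (hA 0) (hA (d + 2)) (hA (d + 1))
    have t2 := edgeAngle_triangle hε (hA (d + 1)) (hA 0) (hA (d + 2))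
    rw [edgeAngle_comm ε (A (d + 2)) (A (d + 1))] at t1
    rw [edgeAngle_comm ε (A (d + 1)) (A 0)] at t2
    have s1 := edgeAngle_le_sum hε hA d
    rw [Finset.sum_range_succ] at h3
    change edgeAngle ε (A 0) (A (d + 2)) ≤ θ at h1
    change _ ≤ _ + edgeAngle ε (A (d + 1)) (A (d + 2)) at h3
    -- The angle between the ends of the shorter chain may vary in its admissible range, while the
    -- new consecutive angle is pinned by choosing `l₂ = u₂`.
    have u1 : edgeAngle ε (A 0) (A (d + 1)) ≤
        min Real.pi (∑ k ∈ Finset.range (d + 1), edgeAngle ε (A k) (A (k + 1))) :=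
      le_min (by linarith) s1
    obtain ⟨θ₁, θ₂, b1, b2, b3, b4, b5, b6, b7⟩ := exists_angles_of_bounds (θ := θ)
      (l₁ := edgeAngle ε (A 0) (A (d + 1)))
      (u₁ := min Real.pi (∑ k ∈ Finset.range (d + 1), edgeAngle ε (A k) (A (k + 1))))
      (l₂ := edgeAngle ε (A (d + 1)) (A (d + 2))) (u₂ := edgeAngle ε (A (d + 1)) (A (d + 2)))
      (by linarith) h2 a1 u1 (min_le_left _ _) a3 le_rfl (by linarith)
      (by rw [min_add]; exact le_min (by linarith) h3) (by linarith) (by linarith) (by linarith)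
    obtain rfl : θ₂ = edgeAngle ε (A (d + 1)) (A (d + 2)) := le_antisymm b4 b3
    have b2' := b2.trans (min_le_left _ _)
    obtain ⟨M, hM, hM1, hM2, hM3⟩ := ih (by omega) b1 b2' (b2.trans (min_le_right _ _))
    obtain ⟨x, y, z, hx, hy, hz, hxy, hxz, hyz⟩ := exists_unit_vectors_of_angles (α := θ₁)
      (β := θ) (γ := edgeAngle ε (A (d + 1)) (A (d + 2))) (by linarith) b2' (by linarith) h2 a3
      (by linarith) (by rw [abs_le] at b5 ⊢; constructor <;> linarith)
      (by rw [abs_le] at b5; linarith) (by linarith)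
    let f : Fin (N + 1) → EuclideanSpace ℝ (Fin 3) := fun i =>
      if (i : ℕ) = 0 then x else if (i : ℕ) = d + 1 then y else z
    have f0 : ∀ i : Fin (N + 1), (i : ℕ) = 0 → f i = x := fun i hi => if_pos hi
    have f1 : ∀ i : Fin (N + 1), (i : ℕ) = d + 1 → f i = y := fun i hi => by
      simp only [f]; rw [if_neg (by omega), if_pos hi]
    have f2 : ∀ i : Fin (N + 1), (i : ℕ) = d + 2 → f i = z := fun i hi => by
      simp only [f]; rw [if_neg (by omega), if_neg (by omega)]
    obtain ⟨P, hP, hP1, hP2⟩ := hM.exists_amalgam (Matrix.posSemidef_gram ℝ f)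
      {i | (i : ℕ) ≤ d + 1} {i | (i : ℕ) = 0 ∨ (i : ℕ) = d + 1 ∨ (i : ℕ) = d + 2} (by
        rintro i ⟨hi, hi'⟩ j ⟨hj, hj'⟩
        simp only [Set.mem_ofPred_eq] at hi hj hi' hj'
        rw [Matrix.gram_apply]
        rcases hi' with hi' | hi' | hi' <;> rcases hj' with hj' | hj' | hj' <;> try omega
        · rw [f0 i hi', f0 j hj', hx, show j = i from Fin.ext (by omega), hM1 i hi]
        · rw [f0 i hi', f1 j hj', hxy, hM3 i j hi' hj']
        · rw [f1 i hi', f0 j hj', real_inner_comm, hxy, hM.symm_apply, hM3 j i hj' hi']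
        · rw [f1 i hi', f1 j hj', hy, show j = i from Fin.ext (by omega), hM1 i hi])
    refine ⟨P, hP, fun i hi => ?_, fun i j hij hj => ?_, fun i j hi hj => ?_⟩
    · rcases hi.lt_or_eq with hi | hi
      · rw [hP1 i (Nat.lt_succ_iff.mp hi) i (Nat.lt_succ_iff.mp hi), hM1 i (by omega)]
      · have hi' : i ∈ {i : Fin (N + 1) | (i : ℕ) = 0 ∨ (i : ℕ) = d + 1 ∨ (i : ℕ) = d + 2} :=
          Or.inr (Or.inr hi)
        rw [hP2 i hi' i hi', Matrix.gram_apply, f2 i hi, hz]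
    · rcases hj.lt_or_eq with hj | hj
      · rw [hP1 i (show (i : ℕ) ≤ d + 1 by omega) j (show (j : ℕ) ≤ d + 1 by omega),
          hM2 i j hij (by omega)]
      · have hi' : (i : ℕ) = d + 1 := by omega
        rw [hP2 i (Or.inr (Or.inl hi')) j (Or.inr (Or.inr hj)), Matrix.gram_apply, f1 i hi',
          f2 j hj, hyz, hi', hj]
    · rw [hP2 i (Or.inl hi) j (Or.inr (Or.inr hj)), Matrix.gram_apply, f0 i hi, f2 j hj, hxz]

/-- The unit vectors along which the parts of a vector on the fibres of a map are directed. -/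
theorem exists_fibre_directions {W K : Type*} [Fintype W] [DecidableEq K] (lay : W → K)
    (v : W → ℝ) (A : K → ℝ) (hA : ∀ k, A k = ∑ i with lay i = k, v i ^ 2) :
    ∃ c : W → ℝ, (∀ i, v i = c i * √(A (lay i))) ∧ (∀ i, ∑ j with lay j = lay i, c j ^ 2 = 1) ∧
      ∀ i, 0 ≤ v i → (∀ j, lay j = lay i → j = i) → c i = 1 := by
  classical
  -- A fibre on which `v` vanishes has no direction of its own; the basis vector of a chosen
  -- representative is used instead.
  obtain ⟨r, hr⟩ : ∃ r : K → Option W, ∀ i, ∃ j, r (lay i) = some j ∧ lay j = lay i := by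
    refine ⟨fun k => if h : ∃ i, lay i = k then some h.choose else none, fun i => ?_⟩
    have h : ∃ j, lay j = lay i := ⟨i, rfl⟩
    exact ⟨h.choose, dif_pos h, h.choose_spec⟩
  have hA0 : ∀ k, 0 ≤ A k := fun k => by rw [hA]; positivity
  have hv0 : ∀ i, A (lay i) = 0 → v i = 0 := by
    intro i hi
    rw [hA, Finset.sum_eq_zero_iff_of_nonneg fun _ _ => sq_nonneg _] at hi
    exact pow_eq_zero_iff two_ne_zero |>.mp (hi i (by simp))
  refine ⟨fun i => if A (lay i) = 0 then (if r (lay i) = some i then 1 else 0)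
    else v i / √(A (lay i)), fun i => ?_, fun i => ?_, fun i hi hui => ?_⟩
  · by_cases h : A (lay i) = 0
    · simp [h, hv0 i h]
    · have : √(A (lay i)) ≠ 0 := (Real.sqrt_ne_zero (hA0 _)).mpr h
      simp only [if_neg h]
      field_simp
  · by_cases h : A (lay i) = 0
    · obtain ⟨j, hj, hj'⟩ := hr i
      rw [Finset.sum_eq_single j]
      · simp [hj', h, hj]
      · intro b hb hbj
        rw [Finset.mem_filter] at hb
        have hjb : j ≠ b := fun h => hbj h.symm
        simp [hb.2, h, hj, hjb]
      · intro hjn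
        exact absurd (Finset.mem_filter.mpr ⟨Finset.mem_univ j, hj'⟩) hjn
    · have : ∀ j ∈ Finset.univ.filter fun j => lay j = lay i,
          (if A (lay j) = 0 then (if r (lay j) = some j then (1 : ℝ) else 0)
            else v j / √(A (lay j))) ^ 2 = v j ^ 2 / A (lay i) := by
        intro j hj
        rw [Finset.mem_filter] at hj
        rw [hj.2, if_neg h, div_pow, Real.sq_sqrt (hA0 _)]
      rw [Finset.sum_congr rfl this, ← Finset.sum_div, ← hA, div_self h]
  · by_cases h : A (lay i) = 0
    · obtain ⟨j, hj, hj'⟩ := hr i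
      rw [hui j hj'] at hj
      simp [h, hj]
    · simp only [if_neg h]
      have : A (lay i) = v i ^ 2 := by
        rw [hA]
        have : (Finset.univ.filter fun j => lay j = lay i) = {i} := by
          ext j
          simp only [Finset.mem_filter, Finset.mem_univ, true_and, Finset.mem_singleton]
          exact ⟨hui j, fun h => h ▸ rfl⟩
        rw [this, Finset.sum_singleton]
      rw [this, Real.sqrt_sq hi]
      rw [this] at h
      exact div_self fun h' => h (by rw [h']; simp)

/-- Blowing up a positive semidefinite matrix with unit diagonal along the fibres of a map. -/
theorem exists_layered {W K : Type*} [Fintype W] [Finite K] [DecidableEq K] [DecidableEq W]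
    (lay : W → K) (v : W → ℝ) (A : K → ℝ) (hA : ∀ k, A k = ∑ i with lay i = k, v i ^ 2) {ε : ℝ}
    (hε : 0 ≤ ε) {N : Matrix K K ℝ} (hN : N.PosSemidef) (hN1 : ∀ k, N k k = 1) :
    ∃ P : Matrix W W ℝ, P.PosSemidef ∧
      (∀ i j, lay i = lay j → P i j = v i * v j + if i = j then ε else 0) ∧
      (∀ i j, lay i ≠ lay j → √(A (lay i) + ε) * √(A (lay j) + ε) * N (lay i) (lay j) =
        √(A (lay i)) * √(A (lay j)) → P i j = v i * v j) ∧
      ∀ i j, lay i ≠ lay j → 0 ≤ v i → 0 ≤ v j → (∀ k, lay k = lay i → k = i) →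
        (∀ k, lay k = lay j → k = j) →
        P i j = √(A (lay i) + ε) * √(A (lay j) + ε) * N (lay i) (lay j) := by
  obtain ⟨c, hc1, hc2, hc3⟩ := exists_fibre_directions lay v A hA
  have hA0 : ∀ k, 0 ≤ A k := fun k => by rw [hA]; positivity
  let u : K → EuclideanSpace ℝ W := fun k => WithLp.toLp 2 fun j => if lay j = k then c j else 0
  have huu : ∀ i j, ⟪u (lay i), u (lay j)⟫_ℝ = if lay i = lay j then 1 else 0 := by
    intro i j
    rw [PiLp.inner_apply]
    by_cases h : lay i = lay j
    · rw [if_pos h, ← hc2 j, Finset.sum_filter]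
      refine Finset.sum_congr rfl fun k _ => ?_
      by_cases hk : lay k = lay j
      · simp [u, h, hk, sq]
      · simp [u, hk]
    · rw [if_neg h]
      refine Finset.sum_eq_zero fun k _ => ?_
      by_cases hk : lay k = lay i
      · simp [u, hk, h]
      · simp [u, hk]
  -- The Gram matrix of `q` is the identity minus the projections to the fibre directions. On a
  -- fibre of weight `A`, the sum `(A + ε) c cᵀ + ε (1 - c cᵀ)` equals `v vᵀ + ε`.
  let q : W → EuclideanSpace ℝ W := fun i => EuclideanSpace.single i 1 - c i • u (lay i)
  have hq : ∀ i j, ⟪q i, q j⟫_ℝ = (if i = j then 1 else 0) -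
      if lay i = lay j then c i * c j else 0 := by
    intro i j
    have e1 : ⟪EuclideanSpace.single i (1 : ℝ), u (lay j)⟫_ℝ =
        if lay i = lay j then c i else 0 := by
      rw [EuclideanSpace.inner_single_left]; simp [u]
    have e2 : ⟪u (lay i), EuclideanSpace.single j (1 : ℝ)⟫_ℝ =
        if lay i = lay j then c j else 0 := by
      rw [EuclideanSpace.inner_single_right]; simp [u, eq_comm]
    have e3 : ⟪EuclideanSpace.single i (1 : ℝ), EuclideanSpace.single j (1 : ℝ)⟫_ℝ =
        if i = j then 1 else 0 := by
      rw [EuclideanSpace.inner_single_left]; simp [PiLp.single_apply]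
    simp only [q, inner_sub_left, inner_sub_right, real_inner_smul_left, real_inner_smul_right,
      e1, e2, e3, huu]
    split_ifs <;> ring
  refine ⟨_, ((hN.submatrix lay).mul_sign fun i => c i * √(A (lay i) + ε)).add
    ((Matrix.posSemidef_gram ℝ q).smul hε), fun i j hij => ?_, fun i j hij h => ?_,
    fun i j hij hi hj hui huj => ?_⟩
  · have h1 : √(A (lay j) + ε) * √(A (lay j) + ε) = A (lay j) + ε :=
      Real.mul_self_sqrt (by linarith [hA0 (lay j)])
    have h2 : √(A (lay j)) * √(A (lay j)) = A (lay j) := Real.mul_self_sqrt (hA0 _)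
    simp only [Matrix.add_apply, Matrix.of_apply, Matrix.submatrix_apply, Matrix.smul_apply,
      Matrix.gram_apply, hq, smul_eq_mul, hij, if_true, hN1]
    rw [hc1 i, hc1 j, hij]
    split_ifs <;> linear_combination c i * c j * h1 - c i * c j * h2
  · have hne : i ≠ j := fun h => hij (h ▸ rfl)
    simp only [Matrix.add_apply, Matrix.of_apply, Matrix.submatrix_apply, Matrix.smul_apply,
      Matrix.gram_apply, hq, smul_eq_mul, if_neg hij, if_neg hne]
    rw [hc1 i, hc1 j]
    linear_combination c i * c j * h
  · have hne : i ≠ j := fun h => hij (h ▸ rfl)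
    simp only [Matrix.add_apply, Matrix.of_apply, Matrix.submatrix_apply, Matrix.smul_apply,
      Matrix.gram_apply, hq, smul_eq_mul, if_neg hij, if_neg hne, hc3 i hi hui, hc3 j hj huj]
    ring

open Classical in
/-- The layers of a graph between two vertices `T` and `H`; the last one is `{H}`. -/
noncomputable def layer {W : Type*} (C : SimpleGraph W) (T H b : W) : ℕ :=
  if b = H then C.dist T H else min (C.dist T b) (C.dist T H - 1)

/-- A locally rank one matrix on a connected graph, with `ε` added on the diagonal, has completions
whose entry at a pair of vertices `T` and `H` realizes a whole range of angles. -/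
theorem exists_completion_of_angle {W : Type*} [Fintype W] [DecidableEq W] {C : SimpleGraph W}
    (hC : C.Connected) {T H : W} (hTH : T ≠ H) {v : W → ℝ} (hv : ∀ i, 0 ≤ v i) {ε : ℝ} (hε : 0 < ε)
    {A : ℕ → ℝ} (hA0 : A 0 = v T ^ 2) (hAd : A (C.dist T H) = v H ^ 2)
    (hA : ∀ k, 0 < k → k < C.dist T H → A k = ∑ b with layer C T H b = k, v b ^ 2)
    (hAn : ∀ k, 0 ≤ A k) {θ : ℝ} (h1 : edgeAngle ε (v T ^ 2) (v H ^ 2) ≤ θ) (h2 : θ ≤ Real.pi)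
    (h3 : θ ≤ ∑ k ∈ Finset.range (C.dist T H), edgeAngle ε (A k) (A (k + 1))) :
    ∃ P : Matrix W W ℝ, P.PosSemidef ∧ (∀ i, P i i = v i ^ 2 + ε) ∧
      (∀ i j, C.Adj i j → P i j = v i * v j) ∧
      P T H = √(v T ^ 2 + ε) * √(v H ^ 2 + ε) * Real.cos θ := by
  have hd0 : 0 < C.dist T H := hC.pos_dist_of_ne hTH
  obtain ⟨d, hd⟩ : ∃ d, C.dist T H = d + 1 := ⟨C.dist T H - 1, by omega⟩
  -- If `T` and `H` are adjacent, all vertices but `H` would fall into layer `0`. The angle is then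
  -- forced, and `v vᵀ + ε` itself is a completion.
  rcases Nat.eq_zero_or_pos d with rfl | hdpos
  · rw [hd] at h3 hAd
    simp only [zero_add, Finset.sum_range_one] at h3 hAd
    rw [hA0, hAd] at h3
    obtain rfl : θ = edgeAngle ε (v T ^ 2) (v H ^ 2) := le_antisymm h3 h1
    refine ⟨_, (Matrix.PosSemidef.of_mul_self v).add (Matrix.PosSemidef.one.smul hε.le),
      fun i => ?_, fun i j hij => ?_, ?_⟩
    · simp [sq]
    · simp [hij.ne]
    · rw [mul_cos_edgeAngle hε (sq_nonneg _) (sq_nonneg _), Real.sqrt_sq (hv _),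
        Real.sqrt_sq (hv _)]
      simp [hTH]
  have hlT : layer C T H T = 0 := by simp [layer, hTH]
  have hlH : layer C T H H = d + 1 := by simp [layer, hd]
  have hl0 : ∀ b, layer C T H b = 0 → b = T := by
    intro b hb
    rw [layer] at hb
    split_ifs at hb with h
    · omega
    · have : C.dist T b = 0 := by omega
      exact (hC.dist_eq_zero_iff.mp this).symm
  have hld : ∀ b, layer C T H b = d + 1 → b = H := by
    intro b hb
    rw [layer] at hb
    split_ifs at hb with h
    · exact h
    · omega
  have hle : ∀ b, layer C T H b < d + 2 := by
    intro b
    rw [layer]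
    split_ifs <;> omega
  -- Edges stay in a layer or join consecutive ones, so only consecutive angles are constrained.
  -- Capping at `dist - 1` keeps `H` alone in the last layer.
  have hadj : ∀ i j, C.Adj i j → layer C T H j ≤ layer C T H i + 1 := by
    intro i j hij
    have t := hC.dist_triangle (u := T) (v := i) (w := j)
    rw [dist_eq_one_iff_adj.mpr hij] at t
    rw [layer, layer]
    split_ifs with h h' h'
    · omega
    · subst h; omega
    · omega
    · omega
  obtain ⟨M, hM, hM1, hM2, hM3⟩ := exists_chain hε hAn (d + 1) d le_rfl (θ := θ)
    (by rwa [← hd, hA0, hAd]) h2 (by rwa [← hd])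
  have hA' : ∀ k : Fin (d + 2), A k =
      ∑ i with (⟨layer C T H i, hle i⟩ : Fin (d + 2)) = k, v i ^ 2 := by
    intro k
    have hk : ∀ i, ((⟨layer C T H i, hle i⟩ : Fin (d + 2)) = k) ↔ layer C T H i = k :=
      fun i => by rw [Fin.ext_iff]
    simp only [hk]
    rcases Nat.eq_zero_or_pos (k : ℕ) with h | h
    · have : (Finset.univ.filter fun i => layer C T H i = k) = {T} := by
        ext i
        simp only [Finset.mem_filter, Finset.mem_univ, true_and, Finset.mem_singleton, h]
        exact ⟨hl0 i, fun h => h ▸ hlT⟩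
      rw [this, Finset.sum_singleton, h, hA0]
    · rcases (Nat.lt_succ_iff.mp k.2).lt_or_eq with h' | h'
      · exact hA k h (by omega)
      · have : (Finset.univ.filter fun i => layer C T H i = k) = {H} := by
          ext i
          simp only [Finset.mem_filter, Finset.mem_univ, true_and, Finset.mem_singleton, h']
          exact ⟨hld i, fun h => h ▸ hlH⟩
        rw [this, Finset.sum_singleton, h', ← hd, hAd]
  obtain ⟨P, hP, hP1, hP2, hP3⟩ := exists_layered
    (fun i => (⟨layer C T H i, hle i⟩ : Fin (d + 2))) v (fun k => A k) hA' hε.le hM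
    (fun k => hM1 k (Nat.lt_succ_iff.mp k.2))
  have hup : ∀ i j, C.Adj i j → layer C T H i < layer C T H j → P i j = v i * v j := by
    intro i j hij hlt
    have := hadj i j hij
    refine hP2 i j (fun h => hlt.ne (congrArg Fin.val h)) ?_
    rw [hM2 _ _ (show layer C T H i + 1 = layer C T H j by omega)
      (Nat.lt_succ_iff.mp (hle j))]
    exact mul_cos_edgeAngle hε (hAn _) (hAn _)
  refine ⟨P, hP, fun i => ?_, fun i j hij => ?_, ?_⟩
  · rw [hP1 i i rfl, if_pos rfl, sq]
  · rcases lt_trichotomy (layer C T H i) (layer C T H j) with h | h | h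
    · exact hup i j hij h
    · rw [hP1 i j (Fin.ext h), if_neg hij.ne, add_zero]
    · rw [hP.symm_apply, hup j i hij.symm h, mul_comm]
  · rw [hP3 T H (fun h => by
      have := congrArg Fin.val h
      simp only [hlT, hlH] at this
      omega) (hv _) (hv _) (fun k hk => hl0 k (by rw [← hlT]; exact congrArg Fin.val hk))
      (fun k hk => hld k (by rw [← hlH]; exact congrArg Fin.val hk)),
      hM3 _ _ hlT hlH]
    simp only [hlT, hlH]
    rw [hA0, ← hd, hAd]

/-! ### Gluing -/

namespace Multidigraph

section Glue

variable {V E : Type*} (D : Multidigraph V E) {W : E → Type*} (T H : ∀ e, W e)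

/-- The map `V(D) → V(D / {C_e})`. -/
def glueVertex (i : V) : GlueVertex D T H := Quot.mk _ (Sum.inr i)

theorem glueMap_tail (e : E) : D.glueMap T H e (T e) = D.glueVertex T H (D.tail e) :=
  Quot.sound (GlueRel.tail e)

theorem glueMap_head (e : E) : D.glueMap T H e (H e) = D.glueVertex T H (D.head e) :=
  Quot.sound (GlueRel.head e)

open Classical in
/-- The normal form of an element of the disjoint union that is glued. -/
noncomputable def glueNormal : (Σ e, W e) ⊕ V → (Σ e, W e) ⊕ V
  | Sum.inl ⟨e, a⟩ => if a = T e then Sum.inr (D.tail e) else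
      if a = H e then Sum.inr (D.head e) else Sum.inl ⟨e, a⟩
  | Sum.inr i => Sum.inr i

variable {T H}

/-- The normal form of a vertex of the glued graph. -/
noncomputable def glueLift (hTH : ∀ e, T e ≠ H e) : GlueVertex D T H → (Σ e, W e) ⊕ V :=
  Quot.lift (D.glueNormal T H) (by
    rintro _ _ (e | e)
    · simp [glueNormal]
    · simp [glueNormal, (hTH e).symm])

variable {D}

theorem glueLift_glueMap (hTH : ∀ e, T e ≠ H e) {e : E} {a : W e} (hT : a ≠ T e) (hH : a ≠ H e) :
    D.glueLift hTH (D.glueMap T H e a) = Sum.inl ⟨e, a⟩ := by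
  change D.glueNormal T H (Sum.inl ⟨e, a⟩) = _
  simp [glueNormal, hT, hH]

theorem glueVertex_injective (hTH : ∀ e, T e ≠ H e) :
    Function.Injective (D.glueVertex T H) := fun _ _ h =>
  Sum.inr_injective (congrArg (D.glueLift hTH) h)

theorem glueMap_eq_glueVertex (hTH : ∀ e, T e ≠ H e) {e : E} {a : W e} {i : V}
    (h : D.glueMap T H e a = D.glueVertex T H i) :
    (a = T e ∧ i = D.tail e) ∨ (a = H e ∧ i = D.head e) := by
  by_cases hT : a = T e
  · subst hT
    rw [glueMap_tail] at h
    exact Or.inl ⟨rfl, (glueVertex_injective hTH h).symm⟩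
  by_cases hH : a = H e
  · subst hH
    rw [glueMap_head] at h
    exact Or.inr ⟨rfl, (glueVertex_injective hTH h).symm⟩
  have := congrArg (D.glueLift hTH) h
  rw [glueLift_glueMap hTH hT hH] at this
  exact absurd this Sum.inl_ne_inr

theorem glueMap_eq_glueMap (hTH : ∀ e, T e ≠ H e) {e e' : E} {a : W e} {b : W e'}
    (hT : a ≠ T e) (hH : a ≠ H e)
    (h : D.glueMap T H e a = D.glueMap T H e' b) : (⟨e, a⟩ : Σ e, W e) = ⟨e', b⟩ := by
  have hb : b ≠ T e' ∧ b ≠ H e' := by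
    constructor <;> rintro rfl
    · rw [glueMap_tail] at h
      rcases glueMap_eq_glueVertex hTH h with h | h
      exacts [hT h.1, hH h.1]
    · rw [glueMap_head] at h
      rcases glueMap_eq_glueVertex hTH h with h | h
      exacts [hT h.1, hH h.1]
  have := congrArg (D.glueLift hTH) h
  rw [glueLift_glueMap hTH hT hH, glueLift_glueMap hTH hb.1 hb.2] at this
  exact Sum.inl_injective this

theorem glueMap_injective (hTH : ∀ e, T e ≠ H e) (e : E) :
    Function.Injective (D.glueMap T H e) := by
  intro a b h
  by_cases hT : a = T e
  · subst hT
    rw [glueMap_tail] at h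
    rcases glueMap_eq_glueVertex hTH h.symm with h | h
    · exact h.1.symm
    · exact absurd h.2 (D.tail_ne_head e)
  by_cases hH : a = H e
  · subst hH
    rw [glueMap_head] at h
    rcases glueMap_eq_glueVertex hTH h.symm with h | h
    · exact absurd h.2.symm (D.tail_ne_head e)
    · exact h.1.symm
  have := glueMap_eq_glueMap hTH hT hH h
  simpa using this

theorem eq_tail_or_head_of_glueMap_eq (hTH : ∀ e, T e ≠ H e) {e e' : E} {a : W e} {b : W e'}
    (hee' : e ≠ e')
    (h : D.glueMap T H e a = D.glueMap T H e' b) : a = T e ∨ a = H e := by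
  by_contra! hn
  exact hee' (congrArg Sigma.fst (glueMap_eq_glueMap hTH hn.1 hn.2 h))

theorem glueVertex_or_glueMap (z : GlueVertex D T H) :
    (∃ i, z = D.glueVertex T H i) ∨
      ∃ e a, a ≠ T e ∧ a ≠ H e ∧ z = D.glueMap T H e a := by
  induction z using Quot.ind with
  | _ y =>
  rcases y with ⟨e, a⟩ | i
  · by_cases hT : a = T e
    · subst hT; exact Or.inl ⟨_, D.glueMap_tail T H e⟩
    by_cases hH : a = H e
    · subst hH; exact Or.inl ⟨_, D.glueMap_head T H e⟩
    exact Or.inr ⟨e, a, hT, hH, rfl⟩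
  · exact Or.inl ⟨i, rfl⟩

/-- Positive semidefinite matrices on `V(D)` and on the `V(C_e)` that agree at the distinguished
vertices have a common extension. -/
theorem exists_glued (hTH : ∀ e, T e ≠ H e) [Finite V] [Finite E] [∀ e, Finite (W e)]
    {M : Matrix V V ℝ} (hM : M.PosSemidef) {P : ∀ e, Matrix (W e) (W e) ℝ} (hP : ∀ e, (P e).PosSemidef)
    (hPT : ∀ e, P e (T e) (T e) = M (D.tail e) (D.tail e))
    (hPH : ∀ e, P e (H e) (H e) = M (D.head e) (D.head e))
    (hPTH : ∀ e, P e (T e) (H e) = M (D.tail e) (D.head e)) :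
    ∃ N : Matrix (GlueVertex D T H) (GlueVertex D T H) ℝ, N.PosSemidef ∧
      (∀ i j, N (D.glueVertex T H i) (D.glueVertex T H j) = M i j) ∧
      ∀ e a b, N (D.glueMap T H e a) (D.glueMap T H e b) = P e a b := by
  classical
  cases nonempty_fintype E
  suffices h : ∀ S : Finset E, ∃ N : Matrix (GlueVertex D T H) (GlueVertex D T H) ℝ,
      N.PosSemidef ∧ (∀ i j, N (D.glueVertex T H i) (D.glueVertex T H j) = M i j) ∧
      ∀ e ∈ S, ∀ a b, N (D.glueMap T H e a) (D.glueMap T H e b) = P e a b by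
    obtain ⟨N, hN, h1, h2⟩ := h Finset.univ
    exact ⟨N, hN, h1, fun e => h2 e (Finset.mem_univ e)⟩
  intro S
  induction S using Finset.induction_on with
  | empty =>
    obtain ⟨N, hN, h⟩ := hM.exists_extend (glueVertex_injective hTH)
    exact ⟨N, hN, h, fun e he => absurd he (Finset.notMem_empty e)⟩
  | insert e₀ S he₀ ih =>
    obtain ⟨N, hN, h1, h2⟩ := ih
    obtain ⟨Q, hQ, hQ'⟩ := (hP e₀).exists_extend (glueMap_injective (D := D) hTH e₀)
    -- A new piece meets what has been glued so far only in its two distinguished vertices.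
    have hint : ∀ z ∈ {z | (∃ i, z = D.glueVertex T H i) ∨ ∃ e ∈ S, ∃ a, z = D.glueMap T H e a} ∩
        Set.range (D.glueMap T H e₀), z = D.glueMap T H e₀ (T e₀) ∨
          z = D.glueMap T H e₀ (H e₀) := by
      rintro _ ⟨hz, a, rfl⟩
      rcases hz with ⟨i, hi⟩ | ⟨e, he, b, hb⟩
      · rcases glueMap_eq_glueVertex hTH hi with h | h
        exacts [Or.inl (by rw [h.1]), Or.inr (by rw [h.1])]
      · rcases eq_tail_or_head_of_glueMap_eq hTH (by rintro rfl; exact he₀ he) hb with h | h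
        exacts [Or.inl (by rw [h]), Or.inr (by rw [h])]
    have hHT : P e₀ (H e₀) (T e₀) = M (D.head e₀) (D.tail e₀) := by
      rw [(hP e₀).symm_apply, hPTH, hM.symm_apply]
    obtain ⟨R, hR, hR1, hR2⟩ := hN.exists_amalgam hQ _ _ (by
      intro z hz z' hz'
      rcases hint z hz with rfl | rfl <;> rcases hint z' hz' with rfl | rfl <;> rw [hQ']
      · rw [glueMap_tail, h1, hPT]
      · rw [glueMap_tail, glueMap_head, h1, hPTH]
      · rw [glueMap_tail, glueMap_head, h1, hHT]
      · rw [glueMap_head, h1, hPH])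
    refine ⟨R, hR, fun i j => ?_, fun e he a b => ?_⟩
    · rw [hR1 _ (Or.inl ⟨i, rfl⟩) _ (Or.inl ⟨j, rfl⟩), h1]
    · rcases Finset.mem_insert.mp he with rfl | he
      · rw [hR2 _ ⟨a, rfl⟩ _ ⟨b, rfl⟩, hQ']
      · rw [hR1 _ (Or.inr ⟨e, he, a, rfl⟩) _ (Or.inr ⟨e, he, b, rfl⟩), h2 e he]

end Glue

/-! ### Signs and the double cover of the glued graph -/

/-- The class of an edge `e`: parallel edges `e` such that `T(e)` and `H(e)` are adjacent, so that
these edges of the `C_e` are merged, belong together. -/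
noncomputable def edgeClass {V E : Type*} (D : Multidigraph V E) {W : E → Type*}
    (C : ∀ e, SimpleGraph (W e)) (T H : ∀ e, W e) (e : E) : Sym2 V ⊕ E :=
  open Classical in
  if (C e).Adj (T e) (H e) then Sum.inl s(D.tail e, D.head e) else Sum.inr e

theorem edgeClass_eq {V E : Type*} {D : Multidigraph V E} {W : E → Type*}
    {C : ∀ e, SimpleGraph (W e)} {T H : ∀ e, W e} {e e' : E}
    (h : D.edgeClass C T H e = D.edgeClass C T H e') :
    e = e' ∨ ((C e).Adj (T e) (H e) ∧ (C e').Adj (T e') (H e') ∧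
      s(D.tail e, D.head e) = s(D.tail e', D.head e')) := by
  rw [edgeClass, edgeClass] at h
  split_ifs at h with h1 h2 h3
  · exact Or.inr ⟨h1, h2, Sum.inl_injective h⟩
  · exact Or.inl (Sum.inr_injective h)

/-- Signs of the vertices of the `C_e` that are `1` at `T(e)` and agree on merged edges. -/
structure IsGlueSign {V E : Type*} (D : Multidigraph V E) {W : E → Type*}
    (C : ∀ e, SimpleGraph (W e)) (T H : ∀ e, W e) (s : ∀ e, W e → ℤˣ) : Prop where
  tail : ∀ e, s e (T e) = 1
  head : ∀ e e', D.edgeClass C T H e = D.edgeClass C T H e' → s e (H e) = s e' (H e')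

section Cover

variable {V E : Type*} {D : Multidigraph V E} {W : E → Type*} {C : ∀ e, SimpleGraph (W e)}
  {T H : ∀ e, W e}

/-- The double cover of the glued graph that is given by signs of the vertices of the `C_e`. -/
def glueCover (hTH : ∀ e, T e ≠ H e) (C : ∀ e, SimpleGraph (W e)) (s : ∀ e, W e → ℤˣ) :
    SimpleGraph (GlueVertex D T H × ℤˣ) where
  Adj x y := ∃ e a b, (C e).Adj a b ∧ D.glueMap T H e a = x.1 ∧ D.glueMap T H e b = y.1 ∧
    x.2 * s e a = y.2 * s e b
  symm := ⟨fun _ _ ⟨e, a, b, h1, h2, h3, h4⟩ => ⟨e, b, a, h1.symm, h3, h2, h4.symm⟩⟩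
  loopless := ⟨fun _ ⟨e, _, _, h1, h2, h3, _⟩ =>
    h1.ne (glueMap_injective hTH e (h2.trans h3.symm))⟩

variable {s : ∀ e, W e → ℤˣ}

theorem glueCover_proj (hTH : ∀ e, T e ≠ H e) {x y : GlueVertex D T H × ℤˣ}
    (h : (glueCover hTH C s).Adj x y) : (D.glue C T H).Adj x.1 y.1 := by
  obtain ⟨e, a, b, hab, ha, hb, -⟩ := h
  refine ⟨fun h => hab.ne (glueMap_injective (D := D) hTH e ?_), e, a, b, hab, ha, hb⟩
  rw [ha, hb, h]

/-- An edge of the glued graph that comes from two different pieces joins the distinguished vertices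
of both, so the pieces belong to one class and their signs agree. -/
theorem IsGlueSign.mul_eq_mul (hs : IsGlueSign D C T H s) (hTH : ∀ e, T e ≠ H e) {e e' : E}
    {a b : W e} {a' b' : W e'} (hab : (C e).Adj a b) (hab' : (C e').Adj a' b')
    (ha : D.glueMap T H e a = D.glueMap T H e' a')
    (hb : D.glueMap T H e b = D.glueMap T H e' b') : s e a * s e b = s e' a' * s e' b' := by
  by_cases hee' : e = e'
  · subst hee'
    rw [glueMap_injective hTH e ha, glueMap_injective hTH e hb]
  have key : ∀ {e : E} {a b : W e}, (C e).Adj a b → (a = T e ∨ a = H e) → (b = T e ∨ b = H e) →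
      (C e).Adj (T e) (H e) ∧ s e a * s e b = s e (H e) ∧
      s(D.glueMap T H e a, D.glueMap T H e b) =
        s(D.glueVertex T H (D.tail e), D.glueVertex T H (D.head e)) := by
    rintro e a b hab (rfl | rfl) (rfl | rfl)
    · exact absurd hab (C e).irrefl
    · exact ⟨hab, by rw [hs.tail, one_mul], by rw [glueMap_tail, glueMap_head]⟩
    · exact ⟨hab.symm, by rw [hs.tail, mul_one], by rw [glueMap_tail, glueMap_head, Sym2.eq_swap]⟩
    · exact absurd hab (C e).irrefl
  obtain ⟨h1, h2, h3⟩ := key hab (eq_tail_or_head_of_glueMap_eq hTH hee' ha)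
    (eq_tail_or_head_of_glueMap_eq hTH hee' hb)
  obtain ⟨h1', h2', h3'⟩ := key hab'
    (eq_tail_or_head_of_glueMap_eq hTH (Ne.symm hee') ha.symm)
    (eq_tail_or_head_of_glueMap_eq hTH (Ne.symm hee') hb.symm)
  rw [h2, h2']
  refine hs.head e e' ?_
  rw [ha, hb, h3'] at h3
  rw [edgeClass, edgeClass, if_pos h1, if_pos h1']
  have := Sym2.map.injective (glueVertex_injective (D := D) hTH)
    (a₁ := s(D.tail e', D.head e')) (a₂ := s(D.tail e, D.head e)) h3
  rw [this]

/-- Adjacency in the cover can be tested in any piece that contains the edge. -/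
theorem IsGlueSign.cover_eq (hs : IsGlueSign D C T H s) (hTH : ∀ e, T e ≠ H e)
    {x y : GlueVertex D T H × ℤˣ} (h : (glueCover hTH C s).Adj x y) {e : E} {a b : W e}
    (hab : (C e).Adj a b) (ha : D.glueMap T H e a = x.1) (hb : D.glueMap T H e b = y.1) :
    x.2 * s e a = y.2 * s e b := by
  obtain ⟨e', a', b', hab', ha', hb', h⟩ := h
  have h1 := hs.mul_eq_mul hTH hab hab' (ha.trans ha'.symm) (hb.trans hb'.symm)
  have h2 : y.2 = x.2 * (s e' a' * s e' b') := by
    rw [← mul_assoc, h, mul_assoc, Int.units_mul_self, mul_one]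
  rw [h2, ← h1, mul_assoc, mul_assoc, Int.units_mul_self, mul_one]

/-- Within one `C e` the cover is trivial, because the edge signs come from vertex signs; the
thickening condition puts every triangle inside one `C e`. -/
theorem IsGlueSign.isTriangleEvenCover (hs : IsGlueSign D C T H s) (hTH : ∀ e, T e ≠ H e)
    (hThick : D.IsThickening C T H) : IsTriangleEvenCover (D.glue C T H) (glueCover hTH C s) where
  proj _ _ h := glueCover_proj hTH h
  bar_bar := by
    rintro x y ⟨e, a, b, hab, ha, hb, h⟩
    exact ⟨e, a, b, hab, ha, hb, by simp [h]⟩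
  lift := by
    rintro x y ⟨-, e, a, b, hab, ha, hb⟩
    rcases Int.units_eq_one_or (x.2 * s e a * (y.2 * s e b)) with h | h
    · left
      refine ⟨e, a, b, hab, ha, hb, ?_⟩
      rw [← mul_left_inj (y.2 * s e b), h, Int.units_mul_self]
    · right
      refine ⟨e, a, b, hab, ha, hb, ?_⟩
      rw [← mul_left_inj (y.2 * s e b), h, bar_snd, neg_mul, neg_mul, Int.units_mul_self]
  unique := by
    rintro x y h h'
    obtain ⟨e, a, b, hab, ha, hb, h1⟩ := id h
    have h2 := hs.cover_eq hTH h' hab ha hb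
    rw [h1, bar_snd, neg_mul] at h2
    exact Int.units_ne_neg _ h2
  triangle := by
    rintro x y z hxy hyz hzx
    obtain ⟨e, a, b, c, hab, hbc, hac, ha, hb, hc⟩ :=
      hThick x.1 y.1 z.1
      (glueCover_proj hTH hxy) (glueCover_proj hTH hyz) (glueCover_proj hTH hzx).symm
    have h1 := hs.cover_eq hTH hxy hab ha hb
    have h2 := hs.cover_eq hTH hyz hbc hb hc
    have h3 := hs.cover_eq hTH hzx hac.symm hc ha
    rw [← h2, ← h1, bar_snd, neg_mul] at h3
    exact Int.units_ne_neg _ h3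

end Cover

end Multidigraph

/-! ### Weighted paths -/

/-- A path with respect to a relation, with its number of steps and its total weight. -/
inductive WeightedPath {α : Type*} (R : α → α → Prop) (f : α → α → ℝ) : α → α → ℕ → ℝ → Prop
  | nil (x : α) : WeightedPath R f x x 0 0
  | cons {x y z : α} {n : ℕ} {w : ℝ} (h : R x y) (p : WeightedPath R f y z n w) :
      WeightedPath R f x z (n + 1) (f x y + w)

namespace WeightedPath

variable {α : Type*} {R : α → α → Prop} {f : α → α → ℝ}

theorem trans {x y z : α} {n m : ℕ} {w u : ℝ} (p : WeightedPath R f x y n w)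
    (q : WeightedPath R f y z m u) : WeightedPath R f x z (n + m) (w + u) := by
  induction p with
  | nil => simpa using q
  | cons h p ih => rw [add_right_comm, add_assoc (f _ _)]; exact .cons h (ih q)

theorem symm {x y : α} {n : ℕ} {w : ℝ} (hR : ∀ x y, R x y → R y x) (hf : ∀ x y, f x y = f y x)
    (p : WeightedPath R f x y n w) : WeightedPath R f y x n w := by
  induction p with
  | nil => exact .nil _
  | @cons x y z n w h p ih =>
    have := ih.trans (.cons (hR _ _ h) (.nil x))
    rwa [add_zero, hf y x, add_comm w] at this

theorem map {x y : α} {n : ℕ} {w : ℝ} (φ : α → α) (hR : ∀ x y, R x y → R (φ x) (φ y))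
    (hf : ∀ x y, f (φ x) (φ y) = f x y) (p : WeightedPath R f x y n w) :
    WeightedPath R f (φ x) (φ y) n w := by
  induction p with
  | nil => exact .nil _
  | cons h p ih => rw [← hf]; exact .cons (hR _ _ h) ih

theorem nonneg {x y : α} {n : ℕ} {w : ℝ} (hf : ∀ x y, 0 ≤ f x y) (p : WeightedPath R f x y n w) :
    0 ≤ w := by
  induction p with
  | nil => exact le_rfl
  | cons h p ih => exact add_nonneg (hf _ _) ih

theorem of_seq {c : ℕ → α} {n : ℕ} (hc : ∀ k < n, R (c k) (c (k + 1))) (i d : ℕ) (h : i + d ≤ n) :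
    WeightedPath R f (c i) (c (i + d)) d (∑ k ∈ Finset.range d, f (c (i + k)) (c (i + k + 1))) := by
  induction d with
  | zero => exact .nil _
  | succ d ih =>
    rw [Finset.sum_range_succ]
    have := (ih (by omega)).trans (.cons (hc (i + d) (by omega)) (.nil _))
    rwa [add_zero] at this

theorem exists_seq {x y : α} {n : ℕ} {w : ℝ} (p : WeightedPath R f x y n w) :
    ∃ c : ℕ → α, c 0 = x ∧ c n = y ∧ (∀ k < n, R (c k) (c (k + 1))) ∧
      w = ∑ k ∈ Finset.range n, f (c k) (c (k + 1)) := by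
  induction p with
  | nil x => exact ⟨fun _ => x, rfl, rfl, fun k hk => absurd hk (Nat.not_lt_zero k), by simp⟩
  | @cons x y z n w h p ih =>
    obtain ⟨c, h0, hn, hc, hw⟩ := ih
    refine ⟨fun k => k.casesOn x c, rfl, hn, fun k hk => ?_, ?_⟩
    · cases k with
      | zero => simpa [h0] using h
      | succ k => exact hc k (by omega)
    · rw [Finset.sum_range_succ', hw, add_comm]
      simp [h0]

end WeightedPath

/-! ### The angular pseudometric on the double cover -/

section Odd

variable {β : Type*} {R : β × ℤˣ → β × ℤˣ → Prop} {A : β → ℝ} {ε : ℝ}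

/-- The angle between the vectors of two nodes in a standard position. -/
noncomputable def baseAngle (ε : ℝ) (A : β → ℝ) (b b' : β) : ℝ :=
  open Classical in if b = b' then 0 else edgeAngle ε (A b) (A b')

theorem baseAngle_comm (b b' : β) : baseAngle ε A b b' = baseAngle ε A b' b := by
  by_cases h : b = b'
  · rw [h]
  · rw [baseAngle, if_neg h, baseAngle, if_neg (Ne.symm h), edgeAngle_comm]

theorem baseAngle_self (b : β) : baseAngle ε A b b = 0 := if_pos rfl

theorem baseAngle_le_edgeAngle (b b' : β) : baseAngle ε A b b' ≤ edgeAngle ε (A b) (A b') := by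
  rw [baseAngle]
  split_ifs
  · exact edgeAngle_nonneg _ _ _
  · exact le_rfl

theorem baseAngle_nonneg (b b' : β) : 0 ≤ baseAngle ε A b b' := by
  rw [baseAngle]
  split_ifs
  · exact le_rfl
  · exact edgeAngle_nonneg _ _ _

theorem baseAngle_le_pi_div_two (b b' : β) : baseAngle ε A b b' ≤ Real.pi / 2 :=
  (baseAngle_le_edgeAngle b b').trans (edgeAngle_le_pi_div_two _ _ _)

theorem baseAngle_triangle (hε : 0 < ε) (hA : ∀ b, 0 ≤ A b) (a b c : β) :
    baseAngle ε A a c ≤ baseAngle ε A a b + baseAngle ε A b c := by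
  by_cases hab : a = b
  · subst hab; simp [baseAngle_self]
  by_cases hbc : b = c
  · subst hbc; simp [baseAngle_self]
  refine (baseAngle_le_edgeAngle a c).trans ?_
  rw [baseAngle, if_neg hab, baseAngle, if_neg hbc]
  exact edgeAngle_triangle hε (hA _) (hA _) (hA _)

/-- The weight of a step in the double cover. -/
noncomputable def stepAngle (ε : ℝ) (A : β → ℝ) (x y : β × ℤˣ) : ℝ := edgeAngle ε (A x.1) (A y.1)

theorem stepAngle_nonneg (x y : β × ℤˣ) : 0 ≤ stepAngle ε A x y := edgeAngle_nonneg _ _ _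

/-- The value `0` of `baseAngle` on the diagonal, in place of the angle between two copies, makes
this valid for the empty path. -/
theorem WeightedPath.baseAngle_le (hε : 0 < ε) (hA : ∀ b, 0 ≤ A b) {x y : β × ℤˣ} {n : ℕ} {w : ℝ}
    (p : WeightedPath R (stepAngle ε A) x y n w) : baseAngle ε A x.1 y.1 ≤ w := by
  induction p with
  | nil => exact (baseAngle_self _).le
  | @cons x y z n w h p ih =>
    refine (baseAngle_triangle hε hA _ y.1 _).trans ?_
    exact add_le_add (baseAngle_le_edgeAngle _ _) ih

/-- The total angle along an odd closed path is at least `π`, if such paths have at least `g`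
steps. -/
theorem pi_le_of_odd {g : ℕ} (hg : 3 ≤ g) {τ : ℝ} (hτ : 0 < τ)
    (hε : ε = τ * (1 / (g : ℝ) * (1 / Real.cos (Real.pi / g) - 1))) (hA : ∀ b, 0 ≤ A b)
    (hsum : ∀ S : Finset β, ∑ b ∈ S, A b ≤ τ)
    (hlen : ∀ x n w, WeightedPath R (stepAngle ε A) x (bar x) n w → g ≤ n) {x : β × ℤˣ} {n : ℕ}
    {w : ℝ} (p : WeightedPath R (stepAngle ε A) x (bar x) n w) : Real.pi ≤ w := by
  classical
  induction n using Nat.strong_induction_on generalizing x w with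
  | _ n ih =>
  obtain ⟨c, h0, hn, hc, hw⟩ := p.exists_seq
  -- At a repeated node the path splits into two closed parts, one of which is odd and shorter.
  -- Without repetition the weights along the path belong to distinct nodes, so their sum is at most
  -- `τ`.
  by_cases hrep : ∃ i j, i < j ∧ j < n ∧ (c i).1 = (c j).1
  · obtain ⟨i, j, hij, hjn, h⟩ := hrep
    obtain ⟨d, rfl⟩ := Nat.exists_eq_add_of_lt hij
    obtain ⟨l, rfl⟩ := Nat.exists_eq_add_of_lt hjn
    have p1 := WeightedPath.of_seq (f := stepAngle ε A) hc 0 i (by omega)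
    have p2 := WeightedPath.of_seq (f := stepAngle ε A) hc i (d + 1) (by omega)
    have p3 := WeightedPath.of_seq (f := stepAngle ε A) hc (i + d + 1) (l + 1) (by omega)
    have hsplit : w = (∑ k ∈ Finset.range i, stepAngle ε A (c (0 + k)) (c (0 + k + 1))) +
        (∑ k ∈ Finset.range (d + 1), stepAngle ε A (c (i + k)) (c (i + k + 1))) +
        ∑ k ∈ Finset.range (l + 1),
          stepAngle ε A (c (i + d + 1 + k)) (c (i + d + 1 + k + 1)) := by
      rw [hw, show i + d + 1 + l + 1 = i + (d + 1) + (l + 1) by omega, Finset.sum_range_add,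
        Finset.sum_range_add]
      simp only [zero_add, show ∀ k, i + (d + 1) + k = i + d + 1 + k by intro k; omega]
    have w1 := p1.nonneg stepAngle_nonneg
    have w2 := p2.nonneg stepAngle_nonneg
    have w3 := p3.nonneg stepAngle_nonneg
    rw [show 0 + i = i by omega, h0] at p1
    rw [show i + d + 1 + (l + 1) = i + d + 1 + l + 1 by omega, hn] at p3
    change WeightedPath R _ (c i) (c (i + d + 1)) _ _ at p2
    rcases eq_or_eq_bar h with h | h
    · rw [← h] at p3
      have := ih _ (by omega) (p1.trans p3)
      linarith
    · rw [show c (i + d + 1) = bar (c i) by rw [h, bar_bar]] at p2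
      have := ih _ (by omega) p2
      linarith
  · have hinj : Set.InjOn (fun k => (c k).1) (Finset.range n : Set ℕ) := by
      intro i hi j hj hij
      simp only [Finset.coe_range, Set.mem_Iio] at hi hj
      by_contra hne
      rcases Nat.lt_or_gt_of_ne hne with h | h
      · exact hrep ⟨i, j, h, hj, hij⟩
      · exact hrep ⟨j, i, h, hi, hij.symm⟩
    rw [hw]
    refine pi_le_sum_edgeAngle hg (hlen x n w p) hτ hε (A := fun k => A (c k).1)
      (fun k => hA _) ?_ (by simp [h0, hn])
    rw [← Finset.sum_image hinj]
    exact hsum _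

/-- The pseudometric on the double cover that is generated by paths and by the complements of the
angles in the standard position. -/
noncomputable def pathDist (R : β × ℤˣ → β × ℤˣ → Prop) (ε : ℝ) (A : β → ℝ) (x y : β × ℤˣ) : ℝ :=
  sInf {r | (∃ n, WeightedPath R (stepAngle ε A) x y n r) ∨ r = Real.pi - baseAngle ε A x.1 y.1}

theorem le_pathDist {x y : β × ℤˣ} {r : ℝ}
    (h1 : ∀ n w, WeightedPath R (stepAngle ε A) x y n w → r ≤ w)
    (h2 : r ≤ Real.pi - baseAngle ε A x.1 y.1) : r ≤ pathDist R ε A x y := by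
  refine le_csInf ⟨_, Or.inr rfl⟩ ?_
  rintro w (⟨n, hw⟩ | rfl)
  exacts [h1 n w hw, h2]

theorem bddBelow_pathDist (x y : β × ℤˣ) : BddBelow {r | (∃ n,
    WeightedPath R (stepAngle ε A) x y n r) ∨ r = Real.pi - baseAngle ε A x.1 y.1} := by
  refine ⟨0, ?_⟩
  rintro w (⟨n, hw⟩ | rfl)
  · exact hw.nonneg stepAngle_nonneg
  · linarith [baseAngle_le_pi_div_two (ε := ε) (A := A) x.1 y.1, Real.pi_pos]

theorem pathDist_le_of_path {x y : β × ℤˣ} {n : ℕ} {w : ℝ}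
    (p : WeightedPath R (stepAngle ε A) x y n w) : pathDist R ε A x y ≤ w :=
  csInf_le (bddBelow_pathDist x y) (Or.inl ⟨n, p⟩)

theorem pathDist_le_sub (x y : β × ℤˣ) : pathDist R ε A x y ≤ Real.pi - baseAngle ε A x.1 y.1 :=
  csInf_le (bddBelow_pathDist x y) (Or.inr rfl)

/-- Paths concatenate, and a path followed by a complement is at least the complement at its outer
ends, because base angles satisfy the triangle inequality and are bounded by path weights. The
diagonal complement `π` and the hypothesis on odd closed paths give the antipodal condition. -/
theorem isAntipodalMetric_pathDist (hε : 0 < ε) (hA : ∀ b, 0 ≤ A b) (hR : ∀ x y, R x y → R y x)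
    (hRb : ∀ x y, R x y → R (bar x) (bar y))
    (hodd : ∀ x n w, WeightedPath R (stepAngle ε A) x (bar x) n w → Real.pi ≤ w) :
    IsAntipodalMetric (pathDist R ε A) where
  symm := by
    have : ∀ x y, pathDist R ε A x y ≤ pathDist R ε A y x := fun x y =>
      le_pathDist (fun n w p => pathDist_le_of_path
        (p.symm hR fun _ _ => edgeAngle_comm _ _ _)) (by
        rw [baseAngle_comm]; exact pathDist_le_sub x y)
    exact fun x y => le_antisymm (this x y) (this y x)
  triangle x y z := by
    have hpi := Real.pi_pos
    rw [← sub_le_iff_le_add]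
    refine le_pathDist (fun n w p => ?_) ?_
    · rw [sub_le_iff_le_add, ← sub_le_iff_le_add']
      refine le_pathDist (fun n' w' p' => ?_) ?_
      · rw [sub_le_iff_le_add']
        exact pathDist_le_of_path (p.trans p')
      · have h1 := pathDist_le_sub (R := R) (ε := ε) (A := A) x z
        have h2 := p.baseAngle_le hε hA
        have h3 := baseAngle_triangle hε hA y.1 x.1 z.1
        rw [baseAngle_comm y.1 x.1] at h3
        linarith
    · rw [sub_le_iff_le_add, ← sub_le_iff_le_add']
      refine le_pathDist (fun n' w' p' => ?_) ?_
      · have h1 := pathDist_le_sub (R := R) (ε := ε) (A := A) x z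
        have h2 := p'.baseAngle_le hε hA
        have h3 := baseAngle_triangle hε hA x.1 z.1 y.1
        rw [baseAngle_comm z.1 y.1] at h3
        linarith
      -- Two complements add up to at least `π`, since base angles are at most `π / 2`.
      · have h1 := pathDist_le_sub (R := R) (ε := ε) (A := A) x z
        have h2 := baseAngle_le_pi_div_two (ε := ε) (A := A) x.1 y.1
        have h3 := baseAngle_le_pi_div_two (ε := ε) (A := A) y.1 z.1
        have h4 := baseAngle_nonneg (ε := ε) (A := A) x.1 z.1
        linarith
  bar_bar := by
    have : ∀ x y, pathDist R ε A (bar x) (bar y) ≤ pathDist R ε A x y := fun x y =>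
      le_pathDist (fun n w p => pathDist_le_of_path (p.map bar hRb fun _ _ => rfl))
        (pathDist_le_sub (bar x) (bar y))
    intro x y
    refine le_antisymm (this x y) ?_
    have h := this (bar x) (bar y)
    rwa [bar_bar, bar_bar] at h
  le_pi x y := by
    have h1 := pathDist_le_sub (R := R) (ε := ε) (A := A) x y
    have h2 := baseAngle_nonneg (ε := ε) (A := A) x.1 y.1
    linarith
  pi_le x := le_pathDist (fun n w p => hodd x n w p) (by
    rw [bar_fst, baseAngle_self, sub_zero])

end Odd

/-! ### The subdivision of `D` and its weights -/

namespace Multidigraph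

section Chain

variable {V E : Type*} (D : Multidigraph V E) {W : E → Type*} (C : ∀ e, SimpleGraph (W e))
  (T H : ∀ e, W e)

open Classical in
/-- The sum of the values of two functions, on `V(D)` and on the `V(C_e)`, over the vertices of
the glued graph. -/
noncomputable def glueSum [Fintype V] [Fintype E] [∀ e, Fintype (W e)] (m : V → ℝ)
    (y : ∀ e, W e → ℝ) : ℝ :=
  ∑ i, m i + ∑ e, ∑ a, if a = T e ∨ a = H e then 0 else y e a

/-- The vertices of the graph that is obtained from `D` when each edge `e` is subdivided into
`dist(T(e), H(e))` edges, in their order along `e`. -/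
noncomputable def chainNode (e : E) (k : ℕ) : V ⊕ E × ℕ :=
  if k = 0 then Sum.inl (D.tail e) else
    if k = (C e).dist (T e) (H e) then Sum.inl (D.head e) else Sum.inr (e, k)

/-- The steps of the double cover of the subdivision of `D`, for given signs of the edges. -/
def ChainStep (σ : E → ℤˣ) (x y : (V ⊕ E × ℕ) × ℤˣ) : Prop :=
  ∃ e k t, k < (C e).dist (T e) (H e) ∧ x = (D.chainNode C T H e k, t) ∧
    y = (D.chainNode C T H e (k + 1), t * if k + 1 = (C e).dist (T e) (H e) then σ e else 1)

/-- The node of the subdivision to which a vertex contributes its weight. -/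
noncomputable def chainBlock : V ⊕ (Σ e, W e) → V ⊕ E × ℕ
  | Sum.inl i => Sum.inl i
  | Sum.inr ⟨e, a⟩ => Sum.inr (e, layer (C e) (T e) (H e) a)

open Classical in
/-- The weights of the nodes of the subdivision. -/
noncomputable def chainWeight [Fintype V] [Fintype E] [∀ e, Fintype (W e)] (m : V → ℝ)
    (y : ∀ e, W e → ℝ) (b : V ⊕ E × ℕ) : ℝ :=
  ∑ z : V ⊕ (Σ e, W e), if chainBlock C T H z = b then
    Sum.elim m (fun p => if p.2 = T p.1 ∨ p.2 = H p.1 then 0 else y p.1 p.2) z else 0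

variable [Fintype V] [Fintype E] [∀ e, Fintype (W e)] {m : V → ℝ} {y : ∀ e, W e → ℝ}

theorem chainWeight_inl (i : V) : chainWeight C T H m y (Sum.inl i) = m i := by
  classical
  rw [chainWeight, Fintype.sum_sum_type]
  simp [chainBlock]

open Classical in
theorem chainWeight_inr (e : E) (k : ℕ) : chainWeight C T H m y (Sum.inr (e, k)) =
    ∑ a with layer (C e) (T e) (H e) a = k, if a = T e ∨ a = H e then 0 else y e a := by
  rw [chainWeight, Fintype.sum_sum_type, Fintype.sum_sigma, Finset.sum_filter]
  rw [Finset.sum_eq_zero (s := (Finset.univ : Finset V)) (by simp [chainBlock]), zero_add]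
  rw [Finset.sum_eq_single e]
  · refine Finset.sum_congr rfl fun a _ => ?_
    simp [chainBlock]
  · intro e' _ he'
    refine Finset.sum_eq_zero fun a _ => ?_
    simp [chainBlock, he']
  · intro h; exact absurd (Finset.mem_univ e) h

theorem chainWeight_nonneg (hm : ∀ i, 0 ≤ m i) (hy : ∀ e a, 0 ≤ y e a) (b : V ⊕ E × ℕ) :
    0 ≤ chainWeight C T H m y b := by
  refine Finset.sum_nonneg fun z _ => ?_
  split_ifs
  · rcases z with i | ⟨e, a⟩
    · exact hm i
    · simp only [Sum.elim_inr]
      split_ifs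
      exacts [le_rfl, hy e a]
  · exact le_rfl

/-- Each vertex contributes to one node only, and the copies of `T e` and `H e` contribute zero. -/
theorem sum_chainWeight_le (hm : ∀ i, 0 ≤ m i) (hy : ∀ e a, 0 ≤ y e a) (S : Finset (V ⊕ E × ℕ)) :
    ∑ b ∈ S, chainWeight C T H m y b ≤ glueSum T H m y := by
  classical
  have h1 : glueSum T H m y = ∑ z : V ⊕ (Σ e, W e),
      Sum.elim m (fun p => if p.2 = T p.1 ∨ p.2 = H p.1 then 0 else y p.1 p.2) z := by
    rw [glueSum, Fintype.sum_sum_type, Fintype.sum_sigma]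
    simp
  rw [h1]
  simp only [chainWeight]
  rw [Finset.sum_comm]
  refine Finset.sum_le_sum fun z _ => ?_
  rw [Finset.sum_ite_eq]
  split_ifs
  · exact le_rfl
  · rcases z with i | ⟨e, a⟩
    · exact hm i
    · simp only [Sum.elim_inr]
      split_ifs
      exacts [le_rfl, hy e a]

end Chain

/-! ### Families of rank one -/

section Core

variable {V E : Type*} {D : Multidigraph V E} {W : E → Type*} {C : ∀ e, SimpleGraph (W e)}
  {T H : ∀ e, W e}

theorem exists_geodesic {W : Type*} {C : SimpleGraph W} (hC : C.Connected) (T H : W) :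
    ∃ π : ℕ → W, π 0 = T ∧ π (C.dist T H) = H ∧
      ∀ k < C.dist T H, C.Adj (π k) (π (k + 1)) := by
  obtain ⟨p, hp⟩ := hC.exists_walk_length_eq_dist T H
  refine ⟨p.getVert, p.getVert_zero, ?_, fun k hk => p.adj_getVert_succ (by omega)⟩
  rw [← hp]; exact p.getVert_length

/-- Odd closed paths in the subdivision of `D` have at least as many steps as a shortest hole of
the glued graph. -/
theorem le_of_odd_chain (hTH : ∀ e, T e ≠ H e) (hConnected : ∀ e, (C e).Connected)
    (hThick : D.IsThickening C T H) {g : ℕ} (hg : ∀ n, HasHole (D.glue C T H) n → g ≤ n)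
    {s : ∀ e, W e → ℤˣ} (hs : IsGlueSign D C T H s) {f : (V ⊕ E × ℕ) × ℤˣ → (V ⊕ E × ℕ) × ℤˣ → ℝ}
    {x : (V ⊕ E × ℕ) × ℤˣ} {n : ℕ} {w : ℝ}
    (p : WeightedPath (fun x y => ChainStep D C T H (fun e => s e (H e)) x y ∨
      ChainStep D C T H (fun e => s e (H e)) y x) f x (bar x) n w) : g ≤ n := by
  choose π h0 hd hadj using fun e => exists_geodesic (hConnected e) (T e) (H e)
  -- Inner nodes are placed on geodesics of the `C e`. A step of the subdivision changes sheets only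
  -- at the end of an edge, whereas the cover changes them with `s`; multiplication by `s`
  -- reconciles the two.
  let Λ : (V ⊕ E × ℕ) × ℤˣ → GlueVertex D T H × ℤˣ := fun x => match x with
    | (Sum.inl i, t) => (D.glueVertex T H i, t)
    | (Sum.inr (e, k), t) => (D.glueMap T H e (π e k), t * s e (π e k))
  have hbar : ∀ x, Λ (bar x) = bar (Λ x) := by
    rintro ⟨i | ⟨e, k⟩, t⟩
    · rfl
    · simp [Λ, bar]
  have hd0 : ∀ e, (C e).dist (T e) (H e) ≠ 0 := fun e =>
    ((hConnected e).pos_dist_of_ne (hTH e)).ne'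
  have hΛ : ∀ e k t, k ≤ (C e).dist (T e) (H e) →
      Λ (D.chainNode C T H e k, t * if k = (C e).dist (T e) (H e) then s e (H e) else 1) =
        (D.glueMap T H e (π e k), t * s e (π e k)) := by
    intro e k t hk
    by_cases hk0 : k = 0
    · subst hk0
      simp [Λ, chainNode, (hd0 e).symm, h0, hs.tail, glueMap_tail]
    by_cases hkd : k = (C e).dist (T e) (H e)
    · subst hkd
      simp [Λ, chainNode, hd0 e, hd, glueMap_head]
    · simp [Λ, chainNode, hk0, hkd]
  have hstep : ∀ x y, ChainStep D C T H (fun e => s e (H e)) x y →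
      (glueCover hTH C s).Adj (Λ x) (Λ y) := by
    rintro _ _ ⟨e, k, t, hk, rfl, rfl⟩
    have h1 := hΛ e k t hk.le
    rw [if_neg hk.ne, mul_one] at h1
    rw [h1, hΛ e (k + 1) t hk]
    refine ⟨e, π e k, π e (k + 1), hadj e k hk, rfl, rfl, ?_⟩
    rw [mul_assoc, mul_assoc, Int.units_mul_self, Int.units_mul_self]
  obtain ⟨c, hc0, hcn, hc, -⟩ := p.exists_seq
  obtain ⟨q, hq⟩ := exists_walk_of_seq (K := glueCover hTH C s) (c := fun k => Λ (c k)) (n := n)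
    (fun k hk => (hc k hk).elim (hstep _ _) fun h => (hstep _ _ h).symm) 0 n (by omega)
  obtain ⟨l, hl, hole⟩ := (hs.isTriangleEvenCover hTH hThick).exists_hasHole
    (q.copy (v' := bar (Λ (c 0))) rfl (by rw [zero_add, hcn, ← hc0, hbar]))
  rw [Walk.length_copy, hq] at hl
  exact (hg l hole).trans hl

/-- Partial matrices that are locally of rank one become completable when the appropriate multiple
of the identity is added. -/
theorem exists_completion_of_rank_one [Fintype V] [Fintype E] [∀ e, Fintype (W e)]
    (hSP : IsSeriesParallel D.undirected) (hTH : ∀ e, T e ≠ H e)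
    (hConnected : ∀ e, (C e).Connected) (hThick : D.IsThickening C T H) {g : ℕ} (hg3 : 3 ≤ g)
    (hg : ∀ n, HasHole (D.glue C T H) n → g ≤ n) {m : V → ℝ} (hm : ∀ i, 0 ≤ m i)
    {x : ∀ e, W e → ℝ} (σ : Sym2 V ⊕ E → ℤˣ) (hxT : ∀ e, x e (T e) = √(m (D.tail e)))
    (hxH : ∀ e, x e (H e) = ((σ (D.edgeClass C T H e) : ℤ) : ℝ) * √(m (D.head e))) {ε : ℝ}
    (hε : ε = glueSum T H m (fun e a => x e a ^ 2) *
      (1 / (g : ℝ) * (1 / Real.cos (Real.pi / g) - 1))) :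
    ∃ N : Matrix (GlueVertex D T H) (GlueVertex D T H) ℝ, N.PosSemidef ∧
      (∀ i, N (D.glueVertex T H i) (D.glueVertex T H i) = m i + ε) ∧
      (∀ e a, N (D.glueMap T H e a) (D.glueMap T H e a) = x e a ^ 2 + ε) ∧
      ∀ e a b, (C e).Adj a b → N (D.glueMap T H e a) (D.glueMap T H e b) = x e a * x e b := by
  classical
  have hy : ∀ e a, 0 ≤ (fun e a => x e a ^ 2 : ∀ e, W e → ℝ) e a := fun e a => sq_nonneg _
  have hin : ∀ e, 0 ≤ ∑ a, if a = T e ∨ a = H e then 0 else x e a ^ 2 := fun e =>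
    Finset.sum_nonneg fun a _ => by split_ifs <;> positivity
  have hτ0 : 0 ≤ glueSum T H m (fun e a => x e a ^ 2) :=
    add_nonneg (Finset.sum_nonneg fun i _ => hm i) (Finset.sum_nonneg fun e _ => hin e)
  -- For total weight zero also `ε = 0`, and the edge angles are meaningless; but then everything
  -- vanishes.
  rcases hτ0.eq_or_lt with hτ | hτ
  · rw [← hτ, zero_mul] at hε
    rw [eq_comm, glueSum, add_eq_zero_iff_of_nonneg (Finset.sum_nonneg fun i _ => hm i)
      (Finset.sum_nonneg fun e _ => hin e), Finset.sum_eq_zero_iff_of_nonneg fun i _ => hm i,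
      Finset.sum_eq_zero_iff_of_nonneg fun e _ => hin e] at hτ
    have hm0 : ∀ i, m i = 0 := fun i => hτ.1 i (Finset.mem_univ i)
    have hx0 : ∀ e a, x e a = 0 := by
      intro e a
      by_cases haT : a = T e
      · rw [haT, hxT, hm0, Real.sqrt_zero]
      by_cases haH : a = H e
      · rw [haH, hxH, hm0, Real.sqrt_zero, mul_zero]
      have h := hτ.2 e (Finset.mem_univ e)
      rw [Finset.sum_eq_zero_iff_of_nonneg fun a _ => by split_ifs <;> positivity] at h
      have := h a (Finset.mem_univ a)
      rw [if_neg (by tauto)] at this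
      exact pow_eq_zero_iff two_ne_zero |>.mp this
    exact ⟨0, .zero, fun i => by simp [hm0, hε], fun e a => by simp [hx0, hε],
      fun e a b _ => by simp [hx0]⟩
  have hε0 : 0 < ε := hε ▸ mul_pos hτ (one_div_mul_one_div_cos_sub_one_pos hg3)
  -- At `H e` the sign is read from `σ` and not from the entry, which may be zero, so that merged
  -- edges always receive equal signs.
  let s : ∀ e, W e → ℤˣ := fun e a => if a = T e then 1 else
    if a = H e then σ (D.edgeClass C T H e) else if 0 ≤ x e a then 1 else -1
  have hsH : ∀ e, s e (H e) = σ (D.edgeClass C T H e) := fun e => by simp [s, (hTH e).symm]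
  have hsT : ∀ e, s e (T e) = 1 := fun e => by simp [s]
  have hs : IsGlueSign D C T H s := ⟨hsT, fun e e' h => by rw [hsH, hsH, h]⟩
  have hsq : ∀ e a, ((s e a : ℤ) : ℝ) * ((s e a : ℤ) : ℝ) = 1 := fun e a => by
    rcases Int.units_eq_one_or (s e a) with h | h <;> simp [h]
  have hsx : ∀ e a, ((s e a : ℤ) : ℝ) * |x e a| = x e a := by
    intro e a
    by_cases haT : a = T e
    · subst haT
      rw [hsT, hxT, abs_of_nonneg (Real.sqrt_nonneg _)]; simp
    by_cases haH : a = H e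
    · subst haH
      rw [hsH, hxH]
      rcases Int.units_eq_one_or (σ (D.edgeClass C T H e)) with h | h <;>
        simp [h, abs_of_nonneg (Real.sqrt_nonneg _)]
    · simp only [s, if_neg haT, if_neg haH]
      split_ifs with h
      · simp [abs_of_nonneg h]
      · simp [abs_of_neg (not_le.mp h)]
  have hxT2 : ∀ e, |x e (T e)| ^ 2 = m (D.tail e) := fun e => by
    rw [sq_abs, hxT, Real.sq_sqrt (hm _)]
  have hxH2 : ∀ e, |x e (H e)| ^ 2 = m (D.head e) := fun e => by
    rw [sq_abs, hxH]
    rcases Int.units_eq_one_or (σ (D.edgeClass C T H e)) with h | h <;>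
      simp [h, Real.sq_sqrt (hm _)]
  have hA := chainWeight_nonneg C T H hm hy
  have hodd := fun z n w (p : WeightedPath (fun x y =>
      ChainStep D C T H (fun e => s e (H e)) x y ∨ ChainStep D C T H (fun e => s e (H e)) y x)
      (stepAngle ε (chainWeight C T H m fun e a => x e a ^ 2)) z (bar z) n w) =>
    pi_le_of_odd hg3 hτ hε hA (sum_chainWeight_le C T H hm hy)
      (fun _ _ _ => le_of_odd_chain hTH hConnected hThick hg hs) p
  have hmetric := isAntipodalMetric_pathDist hε0 hA (fun _ _ => Or.symm) (by
    have hb : ∀ x y, ChainStep D C T H (fun e => s e (H e)) x y →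
        ChainStep D C T H (fun e => s e (H e)) (bar x) (bar y) := by
      rintro _ _ ⟨e, k, t, hk, rfl, rfl⟩
      exact ⟨e, k, -t, hk, rfl, by simp only [bar]; split_ifs <;> simp⟩
    exact fun x y h => h.imp (hb _ _) (hb _ _)) hodd
  set A := chainWeight C T H m (fun e a => x e a ^ 2) with hAdef
  set R : (V ⊕ E × ℕ) × ℤˣ → (V ⊕ E × ℕ) × ℤˣ → Prop := fun x y =>
    ChainStep D C T H (fun e => s e (H e)) x y ∨ ChainStep D C T H (fun e => s e (H e)) y x with hR
  have hmetric' : IsAntipodalMetric fun (x y : V × ℤˣ) =>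
      pathDist R ε A (Sum.inl x.1, x.2) (Sum.inl y.1, y.2) :=
    ⟨fun _ _ => hmetric.symm _ _, fun _ _ _ => hmetric.triangle _ _ _,
      fun _ _ => hmetric.bar_bar (_, _) (_, _), fun _ _ => hmetric.le_pi _ _,
      fun _ => hmetric.pi_le (_, _)⟩
  obtain ⟨M, hM, hM1, hMθ⟩ := hSP.exists_posSemidef hmetric'
  have hM0 := hM.mul_sign fun i => √(m i + ε)
  have hmul : ∀ i, √(m i + ε) * √(m i + ε) = m i + ε := fun i =>
    Real.mul_self_sqrt (by linarith [hm i])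
  have hAm : ∀ i, A (Sum.inl i) = m i := chainWeight_inl C T H
  have hd0 : ∀ e, (C e).dist (T e) (H e) ≠ 0 := fun e =>
    ((hConnected e).pos_dist_of_ne (hTH e)).ne'
  have hedge : ∀ e, ∃ P : Matrix (W e) (W e) ℝ, P.PosSemidef ∧
      (∀ a, P a a = x e a ^ 2 + ε) ∧ (∀ a b, (C e).Adj a b → P a b = x e a * x e b) ∧
      P (T e) (H e) =
        √(m (D.tail e) + ε) * √(m (D.head e) + ε) * M (D.tail e) (D.head e) := by
    intro e
    obtain ⟨θ, hθ, hθl, hθu⟩ := hMθ (D.tail e) (D.head e) ⟨e, Or.inl ⟨rfl, rfl⟩⟩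
    dsimp only at hθl hθu
    have hpath : pathDist R ε A (Sum.inl (D.tail e), 1) (Sum.inl (D.head e), s e (H e)) ≤
        ∑ k ∈ Finset.range ((C e).dist (T e) (H e)),
          edgeAngle ε (A (D.chainNode C T H e k)) (A (D.chainNode C T H e (k + 1))) := by
      have p := WeightedPath.of_seq (R := R) (f := stepAngle ε A) (c := fun k =>
        (D.chainNode C T H e k, if k = (C e).dist (T e) (H e) then s e (H e) else 1))
        (n := (C e).dist (T e) (H e)) (fun k hk => Or.inl ⟨e, k, 1, hk, by
          rw [if_neg hk.ne], by rw [one_mul]⟩) 0 ((C e).dist (T e) (H e)) (by omega)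
      simp only [zero_add] at p
      have h0 : D.chainNode C T H e 0 = Sum.inl (D.tail e) := by simp [chainNode]
      have h1 : D.chainNode C T H e ((C e).dist (T e) (H e)) = Sum.inl (D.head e) := by
        simp [chainNode, hd0]
      rw [h0, h1, if_pos trivial, if_neg (hd0 e).symm] at p
      exact pathDist_le_of_path p
    have hb1 := pathDist_le_sub (R := R) (ε := ε) (A := A) (Sum.inl (D.tail e), 1)
      (Sum.inl (D.head e), 1)
    have hb2 := pathDist_le_sub (R := R) (ε := ε) (A := A) (Sum.inl (D.tail e), 1)
      (Sum.inl (D.head e), -1)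
    have hbase : baseAngle ε A (Sum.inl (D.tail e)) (Sum.inl (D.head e)) =
        edgeAngle ε (|x e (T e)| ^ 2) (|x e (H e)| ^ 2) := by
      rw [baseAngle, if_neg fun h => D.tail_ne_head e (Sum.inl_injective h), hAm, hAm, hxT2, hxH2]
    dsimp only at hb1 hb2
    rw [hbase] at hb1 hb2
    have hple : ∀ t, pathDist R ε A (Sum.inl (D.tail e), 1) (Sum.inl (D.head e), t) ≤ Real.pi :=
      fun t => hmetric.le_pi _ _
    have hnn := edgeAngle_nonneg ε (|x e (T e)| ^ 2) (|x e (H e)| ^ 2)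
    -- For absolute values the angle is `θ` or `π - θ`, according to the sign of the edge. One bound
    -- on `θ` comes from the path along `e`, the other from the complement of the base angle.
    obtain ⟨θ', h1, h2, h3, h4⟩ : ∃ θ', edgeAngle ε (|x e (T e)| ^ 2) (|x e (H e)| ^ 2) ≤ θ' ∧
        θ' ≤ Real.pi ∧ θ' ≤ ∑ k ∈ Finset.range ((C e).dist (T e) (H e)),
          edgeAngle ε (A (D.chainNode C T H e k)) (A (D.chainNode C T H e (k + 1))) ∧
        ((s e (H e) : ℤ) : ℝ) * Real.cos θ' = Real.cos θ := by
      rcases Int.units_eq_one_or (s e (H e)) with h | h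
      · rw [h] at hpath
        exact ⟨θ, by linarith, by linarith [hple 1], by linarith, by simp [h]⟩
      · rw [h] at hpath
        refine ⟨Real.pi - θ, by linarith, by linarith, by linarith, ?_⟩
        rw [h, Real.cos_pi_sub]; simp
    obtain ⟨P, hP, hP1, hP2, hP3⟩ := exists_completion_of_angle (hConnected e) (hTH e)
      (v := fun a => |x e a|) (fun a => abs_nonneg _) hε0
      (A := fun k => A (D.chainNode C T H e k)) (by
        rw [hxT2, ← hAm]; simp [chainNode]) (by
        rw [hxH2, ← hAm]; simp [chainNode, hd0]) (fun k hk hkd => by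
        simp only [chainNode, if_neg hk.ne', if_neg hkd.ne]
        rw [hAdef, chainWeight_inr]
        refine Finset.sum_congr (by ext; simp) fun a ha => ?_
        have ha' : layer (C e) (T e) (H e) a = k := (Finset.mem_filter.mp ha).2
        rw [if_neg, sq_abs]
        rintro (rfl | rfl)
        · simp [layer, hTH e] at ha'; omega
        · simp [layer] at ha'; omega)
      (fun k => hA _) h1 h2 h3
    -- The completion was made for `|x e|`; the signs are put back here.
    refine ⟨_, hP.mul_sign fun a => ((s e a : ℤ) : ℝ), fun a => ?_, fun a b hab => ?_, ?_⟩
    · rw [Matrix.of_apply, hsq, one_mul, hP1, sq_abs]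
    · rw [Matrix.of_apply, hP2 a b hab, mul_mul_mul_comm, hsx, hsx]
    · rw [Matrix.of_apply, hP3, hxT2, hxH2, hsT, hθ, ← h4]
      push_cast
      ring
  choose P hP hP1 hP2 hP3 using hedge
  obtain ⟨N, hN, hN1, hN2⟩ := exists_glued hTH hM0 hP
    (fun e => by
      rw [hP1, Matrix.of_apply, hM1, mul_one, hmul, ← hxT2, sq_abs])
    (fun e => by
      rw [hP1, Matrix.of_apply, hM1, mul_one, hmul, ← hxH2, sq_abs])
    (fun e => by rw [hP3, Matrix.of_apply])
  refine ⟨N, hN, fun i => ?_, fun e a => ?_, fun e a b hab => ?_⟩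
  · rw [hN1, Matrix.of_apply, hM1, mul_one, hmul]
  · rw [hN2, hP1]
  · rw [hN2, hP2 e a b hab]

end Core

end Multidigraph

/-! ### Reduction to families of rank one -/

namespace Multidigraph

section Reduction

variable {V E : Type*} {D : Multidigraph V E} {W : E → Type*} {C : ∀ e, SimpleGraph (W e)}
  {T H : ∀ e, W e}

theorem glueSum_add [Fintype V] [Fintype E] [∀ e, Fintype (W e)] (m m' : V → ℝ)
    (y y' : ∀ e, W e → ℝ) : glueSum T H (fun i => m i + m' i) (fun e a => y e a + y' e a) =
      glueSum T H m y + glueSum T H m' y' := by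
  classical
  have h : ∀ e a, (if a = T e ∨ a = H e then 0 else y e a + y' e a) =
      (if a = T e ∨ a = H e then 0 else y e a) + if a = T e ∨ a = H e then 0 else y' e a := by
    intro e a; split_ifs <;> simp
  simp only [glueSum]
  rw [Finset.sum_add_distrib, Finset.sum_congr rfl fun e _ => (Finset.sum_congr rfl fun a _ =>
    h e a).trans Finset.sum_add_distrib, Finset.sum_add_distrib]
  ring

theorem glueSum_mul [Fintype V] [Fintype E] [∀ e, Fintype (W e)] (c : ℝ) (m : V → ℝ)
    (y : ∀ e, W e → ℝ) : glueSum T H (fun i => c * m i) (fun e a => c * y e a) =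
      c * glueSum T H m y := by
  simp only [glueSum, mul_add, Finset.mul_sum, mul_ite, mul_zero]

/-- Positive semidefinite matrices on the `V(C_e)` with the diagonal entries `m` at the vertices
of `D` whose entries agree on merged edges. -/
structure IsLocalFamily (D : Multidigraph V E) (C : ∀ e, SimpleGraph (W e)) (T H : ∀ e, W e)
    (m : V → ℝ) (M : ∀ e, Matrix (W e) (W e) ℝ) : Prop where
  posSemidef : ∀ e, (M e).PosSemidef
  tail : ∀ e, M e (T e) (T e) = m (D.tail e)
  head : ∀ e, M e (H e) (H e) = m (D.head e)
  merged : ∀ e e', D.edgeClass C T H e = D.edgeClass C T H e' →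
    M e (T e) (H e) = M e' (T e') (H e')

/-- The partial matrix on the glued graph that is given by matrices on the `V(C_e)` and by `m`
becomes completable when `c` times its trace is added on the diagonal. -/
def IsCompletableFamily [Fintype V] [Fintype E] [∀ e, Fintype (W e)] (D : Multidigraph V E)
    (C : ∀ e, SimpleGraph (W e)) (T H : ∀ e, W e) (c : ℝ) (m : V → ℝ)
    (M : ∀ e, Matrix (W e) (W e) ℝ) : Prop :=
  ∃ N : Matrix (GlueVertex D T H) (GlueVertex D T H) ℝ, N.PosSemidef ∧
    (∀ i, N (D.glueVertex T H i) (D.glueVertex T H i) =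
      m i + glueSum T H m (fun e a => M e a a) * c) ∧
    (∀ e a, N (D.glueMap T H e a) (D.glueMap T H e a) =
      M e a a + glueSum T H m (fun e a => M e a a) * c) ∧
    ∀ e a b, (C e).Adj a b → N (D.glueMap T H e a) (D.glueMap T H e b) = M e a b

/-- The shift is linear in the family, being a fixed multiple of the trace, so completable families
form a convex cone. -/
theorem IsCompletableFamily.add [Fintype V] [Fintype E] [∀ e, Fintype (W e)] {c : ℝ}
    {m m' : V → ℝ} {M M' : ∀ e, Matrix (W e) (W e) ℝ} (h : IsCompletableFamily D C T H c m M)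
    (h' : IsCompletableFamily D C T H c m' M') :
    IsCompletableFamily D C T H c (fun i => m i + m' i) (fun e => M e + M' e) := by
  obtain ⟨N, hN, h1, h2, h3⟩ := h
  obtain ⟨N', hN', h1', h2', h3'⟩ := h'
  refine ⟨N + N', hN.add hN', fun i => ?_, fun e a => ?_, fun e a b hab => ?_⟩
  · simp only [Matrix.add_apply, glueSum_add, h1, h1']; ring
  · simp only [Matrix.add_apply, glueSum_add, h2, h2']; ring
  · simp only [Matrix.add_apply, h3 e a b hab, h3' e a b hab]

theorem IsCompletableFamily.smul [Fintype V] [Fintype E] [∀ e, Fintype (W e)] {c : ℝ}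
    {m : V → ℝ} {M : ∀ e, Matrix (W e) (W e) ℝ} (h : IsCompletableFamily D C T H c m M)
    {a : ℝ} (ha : 0 ≤ a) :
    IsCompletableFamily D C T H c (fun i => a * m i) (fun e => a • M e) := by
  obtain ⟨N, hN, h1, h2, h3⟩ := h
  refine ⟨a • N, hN.smul ha, fun i => ?_, fun e b => ?_, fun e b b' hb => ?_⟩
  · simp only [Matrix.smul_apply, smul_eq_mul, glueSum_mul, h1]; ring
  · simp only [Matrix.smul_apply, smul_eq_mul, glueSum_mul, h2]; ring
  · simp only [Matrix.smul_apply, smul_eq_mul, h3 e b b' hb]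

/-- Families that vanish at the vertices of `D` are completable. -/
theorem IsCompletableFamily.of_zero [Fintype V] [Fintype E] [∀ e, Fintype (W e)]
    (hTH : ∀ e, T e ≠ H e) {c : ℝ} (hc : 0 ≤ c) {R : ∀ e, Matrix (W e) (W e) ℝ}
    (hR : ∀ e, (R e).PosSemidef) (hT : ∀ e, R e (T e) (T e) = 0)
    (hH : ∀ e, R e (H e) (H e) = 0) :
    IsCompletableFamily D C T H c (fun _ => 0) R := by
  classical
  obtain ⟨N, hN, h1, h2⟩ := exists_glued (D := D) hTH (M := (0 : Matrix V V ℝ)) .zero hR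
    (fun e => by rw [hT]; rfl) (fun e => by rw [hH]; rfl) (fun e => by
      have := (hR e).abs_le_sqrt (T e) (H e)
      rw [hT, Real.sqrt_zero, zero_mul] at this
      rw [abs_nonpos_iff.mp this]; rfl)
  have hs : 0 ≤ glueSum T H (fun _ : V => 0) (fun e a => R e a a) :=
    add_nonneg (Finset.sum_nonneg fun i _ => le_rfl) (Finset.sum_nonneg fun e _ =>
      Finset.sum_nonneg fun a _ => by
        split_ifs
        exacts [le_rfl, (hR e).diag_nonneg])
  refine ⟨N + (glueSum T H (fun _ : V => 0) (fun e a => R e a a) * c) • 1,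
    hN.add (Matrix.PosSemidef.one.smul (mul_nonneg hs hc)), fun i => ?_, fun e a => ?_,
    fun e a b hab => ?_⟩
  · simp [h1]
  · simp [h2]
  · simp [h2, (glueMap_injective (D := D) hTH e).ne hab.ne]

/-- Splitting replaces a family by a convex combination of families of rank one on a given class of
edges, with the same diagonal at `D`, plus a family that vanishes at `D` and needs no shift. After
all classes are treated, `exists_completion_of_rank_one` applies. -/
theorem IsLocalFamily.isCompletableFamily [Fintype V] [Fintype E] [∀ e, Fintype (W e)]
    (hSP : IsSeriesParallel D.undirected) (hTH : ∀ e, T e ≠ H e)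
    (hConnected : ∀ e, (C e).Connected) (hThick : D.IsThickening C T H) {g : ℕ} (hg3 : 3 ≤ g)
    (hg : ∀ n, HasHole (D.glue C T H) n → g ≤ n) {m : V → ℝ} (hm : ∀ i, 0 ≤ m i)
    {M : ∀ e, Matrix (W e) (W e) ℝ} (hM : IsLocalFamily D C T H m M) :
    IsCompletableFamily D C T H (1 / (g : ℝ) * (1 / Real.cos (Real.pi / g) - 1)) m M := by
  classical
  have hprod : ∀ e e', D.edgeClass C T H e = D.edgeClass C T H e' →
      √(m (D.tail e)) * √(m (D.head e)) = √(m (D.tail e')) * √(m (D.head e')) := by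
    intro e e' h
    rcases edgeClass_eq h with rfl | ⟨-, -, h⟩
    · rfl
    · rcases Sym2.eq_iff.mp h with ⟨h1, h2⟩ | ⟨h1, h2⟩ <;> rw [h1, h2]
      exact mul_comm _ _
  -- `S` contains the classes that may not yet have rank one; `σ` records the signs chosen for the
  -- others.
  suffices h : ∀ S : Finset (Sym2 V ⊕ E), ∀ (M : ∀ e, Matrix (W e) (W e) ℝ)
      (σ : Sym2 V ⊕ E → ℤˣ), IsLocalFamily D C T H m M →
      (∀ e, D.edgeClass C T H e ∉ S → ∃ x : W e → ℝ, M e = Matrix.of (fun a b => x a * x b) ∧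
        x (T e) = √(m (D.tail e)) ∧
        x (H e) = ((σ (D.edgeClass C T H e) : ℤ) : ℝ) * √(m (D.head e))) →
      IsCompletableFamily D C T H (1 / (g : ℝ) * (1 / Real.cos (Real.pi / g) - 1)) m M from
    h (Finset.univ.image (D.edgeClass C T H)) M (fun _ => 1) hM fun e he =>
      absurd (Finset.mem_image_of_mem _ (Finset.mem_univ e)) he
  intro S
  induction S using Finset.induction_on with
  | empty =>
    intro M σ hM h
    choose x hx hxT hxH using fun e => h e (Finset.notMem_empty _)
    obtain ⟨N, hN, h1, h2, h3⟩ := exists_completion_of_rank_one hSP hTH hConnected hThick hg3 hg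
      hm σ hxT hxH rfl
    have hM' : M = fun e => Matrix.of fun a b => x e a * x e b := funext hx
    subst hM'
    simp only [IsCompletableFamily, Matrix.of_apply, ← pow_two]
    exact ⟨N, hN, h1, h2, h3⟩
  | insert k S hk ih =>
    intro M σ hM h
    by_cases hex : ∃ e₀, D.edgeClass C T H e₀ = k
    swap
    · exact ih M σ hM fun e he => h e (by
        rw [Finset.mem_insert]; push Not; exact ⟨fun h => hex ⟨e, h⟩, he⟩)
    obtain ⟨e₀, he₀⟩ := hex
    -- All edges of the class must be split with the same coefficient. It is computed at `e₀` and is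
    -- right for the others, because their entries at `T`, `H` and the products of roots coincide.
    set a : ℝ := (1 + M e₀ (T e₀) (H e₀) /
      (√(M e₀ (T e₀) (T e₀)) * √(M e₀ (H e₀) (H e₀)))) / 2 with ha
    obtain ⟨ha0, ha1⟩ : 0 ≤ a ∧ a ≤ 1 := by
      have h1 := (hM.posSemidef e₀).abs_le_sqrt (T e₀) (H e₀)
      have h2 : |M e₀ (T e₀) (H e₀) /
          (√(M e₀ (T e₀) (T e₀)) * √(M e₀ (H e₀) (H e₀)))| ≤ 1 := by
        rw [abs_div, abs_of_nonneg (by positivity : 0 ≤ √(M e₀ (T e₀) (T e₀)) * _)]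
        exact div_le_one_of_le₀ h1 (by positivity)
      have h3 := abs_le.mp h2
      constructor <;> rw [ha] <;> linarith
    have hsplit : ∀ e, ∃ p n : W e → ℝ, D.edgeClass C T H e = k →
        p (T e) = √(m (D.tail e)) ∧ p (H e) = √(m (D.head e)) ∧
        n (T e) = √(m (D.tail e)) ∧ n (H e) = -√(m (D.head e)) ∧
        (Matrix.of fun i j => M e i j - a * (p i * p j) - (1 - a) * (n i * n j)).PosSemidef := by
      intro e
      by_cases hek : D.edgeClass C T H e = k
      · obtain ⟨p, n, hpn⟩ := (hM.posSemidef e).exists_split (hTH e) (a := a) (by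
          rw [ha, hM.merged e e₀ (hek.trans he₀.symm), hM.tail, hM.head, hM.tail, hM.head,
            hprod e e₀ (hek.trans he₀.symm)])
        rw [hM.tail, hM.head] at hpn
        exact ⟨p, n, fun _ => hpn⟩
      · exact ⟨0, 0, fun h => absurd h hek⟩
    choose p n hpn using hsplit
    have hfam : ∀ (q : ∀ e, W e → ℝ) (s : ℤˣ), (∀ e, D.edgeClass C T H e = k →
        q e (T e) = √(m (D.tail e)) ∧ q e (H e) = ((s : ℤ) : ℝ) * √(m (D.head e))) →
        IsCompletableFamily D C T H (1 / (g : ℝ) * (1 / Real.cos (Real.pi / g) - 1)) m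
          (fun e => if D.edgeClass C T H e = k then Matrix.of fun i j => q e i * q e j
            else M e) := by
      intro q s hq
      refine ih _ (Function.update σ k s) ⟨fun e => ?_, fun e => ?_, fun e => ?_,
        fun e e' hee' => ?_⟩ fun e he => ?_
      · split_ifs
        exacts [Matrix.PosSemidef.of_mul_self _, hM.posSemidef e]
      · split_ifs with h1
        · rw [Matrix.of_apply, (hq e h1).1, Real.mul_self_sqrt (hm _)]
        · exact hM.tail e
      · split_ifs with h1
        · rw [Matrix.of_apply, (hq e h1).2, mul_mul_mul_comm, Real.mul_self_sqrt (hm _)]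
          rcases Int.units_eq_one_or s with rfl | rfl <;> simp
        · exact hM.head e
      · rw [← hee']
        split_ifs with h1
        · rw [Matrix.of_apply, Matrix.of_apply, (hq e h1).1, (hq e h1).2,
            (hq e' (hee'.symm.trans h1)).1, (hq e' (hee'.symm.trans h1)).2, mul_left_comm,
            hprod e e' hee', mul_left_comm]
        · exact hM.merged e e' hee'
      · by_cases h1 : D.edgeClass C T H e = k
        · refine ⟨q e, if_pos h1, (hq e h1).1, ?_⟩
          rw [h1, Function.update_self]
          exact (hq e h1).2
        · rw [if_neg h1, Function.update_of_ne h1]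
          exact h e (by rw [Finset.mem_insert]; tauto)
    have hP := hfam p 1 fun e he => ⟨(hpn e he).1, by simpa using (hpn e he).2.1⟩
    have hN := hfam n (-1) fun e he => ⟨(hpn e he).2.2.1, by simpa using (hpn e he).2.2.2.1⟩
    -- Both rank one matrices carry the full diagonal entries at `T` and `H`, so the remainder
    -- vanishes there.
    have hR := IsCompletableFamily.of_zero (D := D) (C := C) hTH
      (one_div_mul_one_div_cos_sub_one_pos hg3).le
      (R := fun e => if D.edgeClass C T H e = k then Matrix.of fun i j =>
        M e i j - a * (p e i * p e j) - (1 - a) * (n e i * n e j) else 0)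
      (fun e => by
        split_ifs with h1
        exacts [(hpn e h1).2.2.2.2, .zero])
      (fun e => by
        split_ifs with h1
        · rw [Matrix.of_apply, (hpn e h1).1, (hpn e h1).2.2.1, hM.tail,
            Real.mul_self_sqrt (hm _)]
          ring
        · rfl)
      (fun e => by
        split_ifs with h1
        · rw [Matrix.of_apply, (hpn e h1).2.1, (hpn e h1).2.2.2.1, hM.head, neg_mul_neg,
            Real.mul_self_sqrt (hm _)]
          ring
        · rfl)
    convert ((hP.smul ha0).add (hN.smul (sub_nonneg.mpr ha1))).add hR using 1
    · funext i; ring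
    · funext e
      ext i j
      by_cases h1 : D.edgeClass C T H e = k
      · simp only [h1, if_true, Matrix.add_apply, Matrix.smul_apply, Matrix.of_apply, smul_eq_mul]
        ring
      · simp only [h1, if_false, Matrix.add_apply, Matrix.smul_apply, smul_eq_mul,
          Matrix.zero_apply]
        ring

end Reduction

end Multidigraph

/-! ### Pullback and extension of partial matrices -/

namespace PartialMatrix

section Basic

variable {V V' : Type*} {G : SimpleGraph V} {G' : SimpleGraph V'}

theorem _root_.IsSpecified.map (f : G →g G') {z : Sym2 V} (hz : IsSpecified G z) :
    IsSpecified G' (z.map f) := by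
  induction z with
  | _ i j =>
  rcases hz with h | h
  · rw [Sym2.mk_isDiag_iff] at h
    subst h
    exact isSpecified_diag G' (f i)
  · exact Or.inr (f.map_adj h)

/-- The pullback of a partial matrix along a graph homomorphism. -/
def comap (f : G →g G') (X : PartialMatrix G') : PartialMatrix G :=
  fun z => X ⟨z.1.map f, z.2.map f⟩

theorem IsLocallyPSD.comap (f : G →g G') {X : PartialMatrix G'} (hX : X.IsLocallyPSD) :
    (X.comap f).IsLocallyPSD := by
  intro S hS
  have hS' : G'.IsClique (f '' S) := by
    rintro _ ⟨a, ha, rfl⟩ _ ⟨b, hb, rfl⟩ hab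
    exact f.map_adj (hS ha hb (ne_of_apply_ne f hab))
  exact (hX _ hS').submatrix fun a : S => ⟨f a, a, a.2, rfl⟩

theorem IsLocallyPSD.diag_nonneg {X : PartialMatrix G} (hX : X.IsLocallyPSD) (i : V) :
    0 ≤ X ⟨s(i, i), isSpecified_diag G i⟩ :=
  (hX {i} (G.isClique_singleton i)).diag_nonneg (i := ⟨i, rfl⟩)

theorem identity_diag (i : V) : identity G ⟨s(i, i), isSpecified_diag G i⟩ = 1 :=
  if_pos (Sym2.mk_isDiag_iff.mpr rfl)

theorem identity_of_ne {i j : V} (h : IsSpecified G s(i, j)) (hij : i ≠ j) :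
    identity G ⟨s(i, j), h⟩ = 0 :=
  if_neg fun h => hij (Sym2.mk_isDiag_iff.mp h)

theorem IsCompletable.comap {f : G →g G'} {X : PartialMatrix G'} (hX : X.IsCompletable) :
    (X.comap f).IsCompletable := by
  obtain ⟨M, hM, h⟩ := hX
  exact ⟨M.submatrix f f, hM.submatrix f, fun i j hij => h _ _ (hij.map f)⟩

theorem comap_add_identity {f : G →g G'} (hf : Function.Injective f) (X : PartialMatrix G')
    (ε : ℝ) : (X + ε • identity G').comap f = X.comap f + ε • identity G := by
  funext ⟨z, hz⟩
  have : (z.map f).IsDiag ↔ z.IsDiag := by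
    induction z with
    | _ i j => simp [hf.eq_iff]
  by_cases h : z.IsDiag
  · simp [PartialMatrix.comap, identity, h, this.mpr h]
  · simp [PartialMatrix.comap, identity, h, mt this.mp h]

/-- The extension of a partial matrix by zero along an embedding of graphs. -/
noncomputable def extendZero (f : G ↪g G') (X : PartialMatrix G) : PartialMatrix G' :=
  Function.extend (fun z => ⟨z.1.map f, z.2.map f.toHom⟩) X 0

theorem extendZero_apply (f : G ↪g G') (X : PartialMatrix G) (z : Sym2 V)
    (hz : IsSpecified G z) (hz' : IsSpecified G' (z.map f)) :
    X.extendZero f ⟨z.map f, hz'⟩ = X ⟨z, hz⟩ :=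
  Function.Injective.extend_apply
    (f := fun z : {z : Sym2 V // IsSpecified G z} =>
      (⟨z.1.map f, z.2.map f.toHom⟩ : {z : Sym2 V' // IsSpecified G' z}))
    (fun _ _ h => Subtype.ext (Sym2.map.injective f.injective (congrArg Subtype.val h))) X 0 ⟨z, hz⟩

theorem extendZero_of_notMem (f : G ↪g G') (X : PartialMatrix G) {i j : V'}
    (hij : i ∉ Set.range f ∨ j ∉ Set.range f) (h : IsSpecified G' s(i, j)) :
    X.extendZero f ⟨s(i, j), h⟩ = 0 := by
  refine Function.extend_apply' _ _ _ ?_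
  rintro ⟨⟨z, hz⟩, h⟩
  have h := congrArg Subtype.val h
  induction z with
  | _ a b =>
  rcases Sym2.eq_iff.mp h with ⟨rfl, rfl⟩ | ⟨rfl, rfl⟩ <;> simp at hij

theorem comap_extendZero (f : G ↪g G') (X : PartialMatrix G) :
    (X.extendZero f).comap f.toHom = X :=
  funext fun z => X.extendZero_apply f z.1 z.2 _

/-- An embedding reflects adjacency, so a clique of `G'` meets the image in a clique of `G`; outside
it the rows are zero. -/
theorem IsLocallyPSD.extendZero [Finite V'] (f : G ↪g G') {X : PartialMatrix G}
    (hX : X.IsLocallyPSD) : (X.extendZero f).IsLocallyPSD := by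
  intro S hS
  have hS' : G.IsClique (f ⁻¹' S) := fun a ha b hb hab =>
    f.map_adj_iff.mp (hS ha hb (f.injective.ne hab))
  have : Finite V := Finite.of_injective f f.injective
  obtain ⟨N, hN, h1, h2⟩ := (hX _ hS').exists_extend_zero
    (f := fun a : f ⁻¹' S => (⟨f a, a.2⟩ : S))
    (fun a b h => Subtype.ext (f.injective (congrArg Subtype.val h)))
  convert hN using 1
  ext ⟨i, hi⟩ ⟨j, hj⟩
  by_cases h : i ∈ Set.range f ∧ j ∈ Set.range f
  · obtain ⟨⟨a, rfl⟩, b, rfl⟩ := h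
    exact (X.extendZero_apply f s(a, b) (isSpecified_of_isClique hS' ⟨a, hi⟩ ⟨b, hj⟩) _).trans
      (h1 ⟨a, hi⟩ ⟨b, hj⟩).symm
  · rw [not_and_or] at h
    rw [h2 _ _ (h.imp (fun h => ?_) fun h => ?_)]
    · exact X.extendZero_of_notMem f h _
    all_goals
      rintro ⟨a, ha⟩
      exact h ⟨a, congrArg Subtype.val ha⟩

theorem trace_extendZero [Fintype V] [Fintype V'] (f : G ↪g G') (X : PartialMatrix G) :
    (X.extendZero f).trace = X.trace :=
  (Fintype.sum_of_injective f f.injective _ _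
    (fun _ hi => X.extendZero_of_notMem f (Or.inl hi) _)
    fun i => (X.extendZero_apply f s(i, i) _ _).symm).symm

/-- The additive distance is `c`, if adding `c` on the diagonal suffices for all locally positive
semidefinite partial matrices of trace one, and is necessary for one of them. -/
theorem _root_.additiveDistance_eq [Fintype V] [Nonempty V] {c : ℝ}
    (hc : ∀ X : PartialMatrix G, X.IsLocallyPSD → X.trace = 1 →
      (X + c • identity G).IsCompletable) {X₀ : PartialMatrix G} (hX₀ : X₀.IsLocallyPSD)
    (htr : X₀.trace = 1) (hX₀c : ∀ ε : ℝ, (X₀ + ε • identity G).IsCompletable → c ≤ ε) :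
    additiveDistance G = c := by
  refine IsGreatest.csSup_eq ⟨⟨X₀, hX₀, htr, ?_⟩, ?_⟩
  · have : IsLeast {ε : ℝ | IsCompletable (X₀ + ε • identity G)} c := ⟨hc X₀ hX₀ htr, hX₀c⟩
    exact this.csInf_eq.symm
  · rintro _ ⟨X, hX, hX1, rfl⟩
    obtain ⟨i⟩ := ‹Nonempty V›
    -- The admissible shifts are bounded below, because diagonal entries stay nonnegative.
    refine csInf_le ⟨-X ⟨s(i, i), isSpecified_diag G i⟩, ?_⟩ (hc X hX hX1)
    rintro ε ⟨M, hM, h⟩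
    have h1 := h i i (isSpecified_diag G i)
    have h2 : 0 ≤ M i i := hM.diag_nonneg
    rw [h1, Pi.add_apply, Pi.smul_apply, identity_diag, smul_eq_mul, mul_one] at h2
    linarith

/-- No shift is needed, and with a second vertex none can be negative: a matrix unit at `a` has a
zero diagonal entry at `b`. -/
theorem _root_.IsChordal.additiveDistance_eq_zero [Fintype V] [Nontrivial V] (hG : IsChordal G) :
    additiveDistance G = 0 := by
  classical
  obtain ⟨a, b, hab⟩ := exists_pair_ne V
  refine additiveDistance_eq (X₀ := fun z => if z.1 = s(a, a) then 1 else 0) (fun X hX _ => ?_)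
    (fun S hS => ?_) ?_ ?_
  · rw [zero_smul, add_zero]
    exact hG.isCompletable hX
  · have : Finite S := inferInstance
    convert Matrix.PosSemidef.of_mul_self (fun i : S => if (i : V) = a then (1 : ℝ) else 0) using 1
    ext i j
    simp only [cliqueSubmatrix, Matrix.of_apply, Sym2.eq_iff]
    by_cases hi : (i : V) = a <;> by_cases hj : (j : V) = a <;> simp [hi, hj]
  · simp [trace]
  · rintro ε ⟨M, hM, h⟩
    have h1 := h b b (isSpecified_diag G b)
    have h2 : 0 ≤ M b b := hM.diag_nonneg
    rw [h1, Pi.add_apply, Pi.smul_apply, identity_diag, smul_eq_mul, mul_one] at h2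
    simpa [Sym2.eq_iff, hab.symm] using h2

end Basic

end PartialMatrix

/-! ### The upper bound for thickenings -/

namespace Multidigraph

variable {V E : Type*} {D : Multidigraph V E} {W : E → Type*} {C : ∀ e, SimpleGraph (W e)}
  {T H : ∀ e, W e}

/-- The vertices of `D` and the undistinguished vertices of the `C e` enumerate the glued vertex set
without repetition. -/
theorem glueSum_eq_sum [Fintype V] [Fintype E] [∀ e, Fintype (W e)]
    [Fintype (GlueVertex D T H)] (hTH : ∀ e, T e ≠ H e) (f : GlueVertex D T H → ℝ) :
    glueSum T H (fun i => f (D.glueVertex T H i)) (fun e a => f (D.glueMap T H e a)) =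
      ∑ z, f z := by
  classical
  let Φ : V ⊕ {p : Σ e, W e // ¬(p.2 = T p.1 ∨ p.2 = H p.1)} → GlueVertex D T H :=
    Sum.elim (D.glueVertex T H) fun p => D.glueMap T H p.1.1 p.1.2
  have hΦ : Function.Bijective Φ := by
    constructor
    · rintro (i | ⟨⟨e, a⟩, ha⟩) (j | ⟨⟨e', b⟩, hb⟩) h
      · exact congrArg _ (glueVertex_injective hTH h)
      · rcases glueMap_eq_glueVertex hTH h.symm with h | h
        exacts [absurd (Or.inl h.1) hb, absurd (Or.inr h.1) hb]
      · rcases glueMap_eq_glueVertex hTH h with h | h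
        exacts [absurd (Or.inl h.1) ha, absurd (Or.inr h.1) ha]
      · push Not at ha
        exact congrArg _ (Subtype.ext (glueMap_eq_glueMap hTH ha.1 ha.2 h))
    · intro z
      rcases glueVertex_or_glueMap z with ⟨i, rfl⟩ | ⟨e, a, hT, hH, rfl⟩
      exacts [⟨Sum.inl i, rfl⟩, ⟨Sum.inr ⟨⟨e, a⟩, by tauto⟩, rfl⟩]
  rw [← hΦ.sum_comp, Fintype.sum_sum_type, glueSum]
  congr 1
  rw [← Fintype.sum_sigma (f := fun p : Σ e, W e =>
    if p.2 = T p.1 ∨ p.2 = H p.1 then 0 else f (D.glueMap T H p.1 p.2)),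
    Finset.sum_ite, Finset.sum_const_zero, zero_add,
    Finset.sum_subtype (p := fun p : Σ e, W e => ¬(p.2 = T p.1 ∨ p.2 = H p.1)) _ (by simp)]
  rfl

/-- The map of `C_e` to the glued graph, as a graph homomorphism. -/
def glueHom (hTH : ∀ e, T e ≠ H e) (e : E) : C e →g D.glue C T H where
  toFun := D.glueMap T H e
  map_rel' h := ⟨(glueMap_injective hTH e).ne h.ne, e, _, _, h, rfl, rfl⟩

/-- Chordal completions of the restrictions to the `C e` form a local family: entries at merged
edges agree because they are specified in the glued graph. -/
theorem IsThickening.isCompletable_add [Finite V] [Finite E] [∀ e, Finite (W e)]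
    (hSP : IsSeriesParallel D.undirected) (hTH : ∀ e, T e ≠ H e)
    (hConnected : ∀ e, (C e).Connected) (hChordal : ∀ e, IsChordal (C e))
    (hThick : D.IsThickening C T H) {g : ℕ} (hg3 : 3 ≤ g)
    (hg : ∀ n, HasHole (D.glue C T H) n → g ≤ n) {X : PartialMatrix (D.glue C T H)}
    (hX : X.IsLocallyPSD) (htr : X.trace = 1) :
    (X + (1 / (g : ℝ) * (1 / Real.cos (Real.pi / g) - 1)) •
      PartialMatrix.identity (D.glue C T H)).IsCompletable := by
  cases nonempty_fintype V
  cases nonempty_fintype E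
  have := fun e => Fintype.ofFinite (W e)
  choose M hM hMX using fun e => (hChordal e).isCompletable (hX.comap (glueHom hTH e))
  have hdiag : ∀ e a, M e a a = X ⟨s(D.glueMap T H e a, D.glueMap T H e a),
      isSpecified_diag _ _⟩ := fun e a => hMX e a a (isSpecified_diag _ a)
  have hcongr : ∀ {z z' : Sym2 (GlueVertex D T H)} (hz : IsSpecified _ z)
      (hz' : IsSpecified _ z'), z = z' → X ⟨z, hz⟩ = X ⟨z', hz'⟩ := by
    rintro z _ hz hz' rfl; rfl
  have hfam : IsLocalFamily D C T H
      (fun i => X ⟨s(D.glueVertex T H i, D.glueVertex T H i), isSpecified_diag _ _⟩) M := by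
    refine ⟨hM, fun e => ?_, fun e => ?_, fun e e' h => ?_⟩
    · rw [hdiag]
      exact hcongr _ _ (by rw [glueMap_tail])
    · rw [hdiag]
      exact hcongr _ _ (by rw [glueMap_head])
    · rcases edgeClass_eq h with rfl | ⟨h1, h2, h3⟩
      · rfl
      · rw [hMX e _ _ (Or.inr h1), hMX e' _ _ (Or.inr h2)]
        refine hcongr _ _ ?_
        change s(D.glueMap T H e (T e), D.glueMap T H e (H e)) =
          s(D.glueMap T H e' (T e'), D.glueMap T H e' (H e'))
        rw [glueMap_tail, glueMap_head, glueMap_tail, glueMap_head, ← Sym2.map_mk, h3,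
          Sym2.map_mk]
  obtain ⟨N, hN, h1, h2, h3⟩ := hfam.isCompletableFamily hSP hTH hConnected hThick hg3 hg
    fun i => hX.diag_nonneg _
  have hsum := glueSum_eq_sum hTH fun z => X ⟨s(z, z), isSpecified_diag _ z⟩
  simp only [← hdiag] at hsum
  rw [hsum] at h1 h2
  rw [PartialMatrix.trace] at htr
  rw [htr, one_mul] at h1 h2
  refine ⟨N, hN, fun i j h => ?_⟩
  by_cases hij : i = j
  · subst hij
    rw [Pi.add_apply, Pi.smul_apply, PartialMatrix.identity_diag, smul_eq_mul, mul_one]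
    rcases glueVertex_or_glueMap i with ⟨i, rfl⟩ | ⟨e, a, -, -, rfl⟩
    · rw [h1]
    · rw [h2, hdiag]
  · rw [Pi.add_apply, Pi.smul_apply, PartialMatrix.identity_of_ne h hij, smul_zero, add_zero]
    obtain ⟨-, e, a, b, hab, rfl, rfl⟩ := h.resolve_left fun h => hij (Sym2.mk_isDiag_iff.mp h)
    rw [h3 e a b hab, hMX e a b (Or.inr hab)]
    rfl

end Multidigraph

/-! ### The lower bound from an odd cycle -/

/-- The partial matrix on the cycle whose diagonal entries are `1 / g` and whose entries at the
edges are `1 / g`, except for one edge, where it is `-1 / g`. -/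
noncomputable def oddCycleMatrix (g : ℕ) : PartialMatrix (cycleGraph g) :=
  fun z => if ∃ i j : Fin g, z.1 = s(i, j) ∧ (i : ℕ) = 0 ∧ (j : ℕ) = g - 1 then -1 / (g : ℝ)
    else 1 / (g : ℝ)

theorem oddCycleMatrix_apply {g : ℕ} {i j : Fin g} (hij : i ≤ j)
    (h : IsSpecified (cycleGraph g) s(i, j)) :
    oddCycleMatrix g ⟨s(i, j), h⟩ =
      if (i : ℕ) = 0 ∧ (j : ℕ) = g - 1 then -1 / (g : ℝ) else 1 / (g : ℝ) := by
  refine if_congr ⟨?_, fun h => ⟨i, j, rfl, h⟩⟩ rfl rfl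
  rintro ⟨i', j', h, h0, h1⟩
  rcases Sym2.eq_iff.mp h with ⟨rfl, rfl⟩ | ⟨rfl, rfl⟩
  · exact ⟨h0, h1⟩
  · have := Fin.le_def.mp hij
    have := i.2
    omega

/-- On a clique the signs can be switched away. Since `g ≥ 4`, a clique with the negative edge has
no third vertex, so switching at vertex `0` suffices. -/
theorem isLocallyPSD_oddCycleMatrix {g : ℕ} (hg : 4 ≤ g) :
    (oddCycleMatrix g).IsLocallyPSD := by
  classical
  intro S hS
  have hg0 : (0 : ℝ) ≤ 1 / g := by positivity
  have hadj : ∀ i ∈ S, ∀ j ∈ S, i < j →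
      (j : ℕ) = i + 1 ∨ ((i : ℕ) = 0 ∧ (j : ℕ) = g - 1) := fun i hi j hj hij =>
    ((cycleGraph_adj_iff_of_lt hij).mp (hS hi hj hij.ne)).imp_right fun h => ⟨h.1, h.2.1⟩
  have key : ∃ σ : Fin g → ℝ, (∀ i, σ i * σ i = 1) ∧ ∀ i ∈ S, ∀ j ∈ S, i < j → σ i * σ j =
      if (i : ℕ) = 0 ∧ (j : ℕ) = g - 1 then -1 else 1 := by
    by_cases hex : ∃ i ∈ S, ∃ j ∈ S, (i : ℕ) = 0 ∧ (j : ℕ) = g - 1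
    · obtain ⟨a, ha, b, hb, ha0, hb1⟩ := hex
      refine ⟨fun i => if (i : ℕ) = 0 then -1 else 1, fun i => by
        dsimp only; split_ifs <;> norm_num,
        fun i hi j hj hij => ?_⟩
      have h1 := Fin.lt_def.mp hij
      have h2 : ∀ k ∈ S, (k : ℕ) = 0 ∨ (k : ℕ) = g - 1 := by
        intro k hk
        by_contra! hne
        have h3 := hadj a ha k hk (Fin.lt_def.mpr (by omega))
        have h4 := hadj k hk b hb (Fin.lt_def.mpr (by have := k.2; omega))
        omega
      have h3 := h2 i hi
      have h4 := h2 j hj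
      have h5 := j.2
      dsimp only
      rw [if_pos (by omega), if_neg (by omega), if_pos (by omega)]
      norm_num
    · refine ⟨fun _ => 1, fun _ => one_mul 1, fun i hi j hj _ => ?_⟩
      rw [if_neg fun h => hex ⟨i, hi, j, hj, h⟩, one_mul]
  obtain ⟨σ, hσ, hσS⟩ := key
  have hlt : ∀ i ∈ S, ∀ j ∈ S, i < j → ∀ h : IsSpecified (cycleGraph g) s(i, j),
      oddCycleMatrix g ⟨s(i, j), h⟩ = 1 / (g : ℝ) * (σ i * σ j) := by
    intro i hi j hj hij h
    rw [oddCycleMatrix_apply hij.le, hσS i hi j hj hij]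
    split_ifs <;> ring
  convert (Matrix.PosSemidef.of_mul_self fun i : S => σ i).smul hg0 using 1
  ext ⟨i, hi⟩ ⟨j, hj⟩
  simp only [PartialMatrix.cliqueSubmatrix, Matrix.of_apply, Matrix.smul_apply, smul_eq_mul]
  rcases lt_trichotomy i j with h | rfl | h
  · exact hlt i hi j hj h _
  · rw [oddCycleMatrix_apply le_rfl, if_neg (by omega), hσ, mul_one]
  · rw [mul_comm (σ i), ← hlt j hj i hi h (isSpecified_of_isClique hS ⟨j, hj⟩ ⟨i, hi⟩)]
    exact congrArg _ (Subtype.ext Sym2.eq_swap)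

theorem trace_oddCycleMatrix {g : ℕ} (hg : 4 ≤ g) : (oddCycleMatrix g).trace = 1 := by
  have hg0 : (g : ℝ) ≠ 0 := by positivity
  rw [PartialMatrix.trace, Finset.sum_congr rfl fun i _ => (oddCycleMatrix_apply le_rfl _).trans
    (if_neg (by omega))]
  simp [hg0]

/-- Gram vectors of common squared length `d = 1/g + ε` have `g - 1` consecutive angles `θ = arccos
((1/g)/d)` and closing angle `π - θ`. Hence `π - θ ≤ (g - 1) θ`, and `θ ≥ π / g` bounds `d` from
below. -/
theorem le_of_isCompletable_oddCycleMatrix {g : ℕ} (hg : 4 ≤ g) {ε : ℝ}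
    (h : (oddCycleMatrix g + ε • PartialMatrix.identity (cycleGraph g)).IsCompletable) :
    1 / (g : ℝ) * (1 / Real.cos (Real.pi / g) - 1) ≤ ε := by
  obtain ⟨M, hM, hMX⟩ := h
  have hg0 : (0 : ℝ) < g := by positivity
  have hd : ∀ i, M i i = 1 / (g : ℝ) + ε := fun i => by
    rw [hMX i i (isSpecified_diag _ i), Pi.add_apply, Pi.smul_apply, PartialMatrix.identity_diag,
      oddCycleMatrix_apply le_rfl, if_neg (by omega), smul_eq_mul, mul_one]
  have hoff : ∀ i j : Fin g, i < j → (cycleGraph g).Adj i j →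
      M i j = if (i : ℕ) = 0 ∧ (j : ℕ) = g - 1 then -1 / (g : ℝ) else 1 / (g : ℝ) := by
    intro i j hij hadj
    have hs : IsSpecified (cycleGraph g) s(i, j) := Or.inr hadj
    rw [hMX i j hs, Pi.add_apply, Pi.smul_apply, PartialMatrix.identity_of_ne _ hij.ne,
      oddCycleMatrix_apply hij.le, smul_zero, add_zero]
  have hstep : ∀ k (hk : k + 1 < g), M ⟨k, by omega⟩ ⟨k + 1, hk⟩ = 1 / (g : ℝ) := by
    intro k hk
    have hlt : (⟨k, by omega⟩ : Fin g) < ⟨k + 1, hk⟩ := Fin.lt_def.mpr (Nat.lt_succ_self k)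
    rw [hoff _ _ hlt ((cycleGraph_adj_iff_of_lt hlt).mpr (Or.inl rfl)), if_neg (by
      simp only; omega)]
  have hlast : M ⟨0, by omega⟩ ⟨g - 1, by omega⟩ = -1 / (g : ℝ) := by
    have hlt : (⟨0, by omega⟩ : Fin g) < ⟨g - 1, by omega⟩ := Fin.lt_def.mpr (by simp only; omega)
    rw [hoff _ _ hlt ((cycleGraph_adj_iff_of_lt hlt).mpr (Or.inr ⟨rfl, rfl, by omega⟩)),
      if_pos ⟨rfl, rfl⟩]
  set d := 1 / (g : ℝ) + ε with hd'
  have hd0 : 0 ≤ d := hd ⟨0, by omega⟩ ▸ hM.diag_nonneg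
  have hdg : 1 / (g : ℝ) ≤ d := by
    have h1 := hM.abs_le_sqrt ⟨0, by omega⟩ ⟨0 + 1, by omega⟩
    rw [hd, hd, hstep 0 (by omega), Real.mul_self_sqrt hd0] at h1
    exact (le_abs_self _).trans h1
  have hdpos : 0 < d := lt_of_lt_of_le (by positivity) hdg
  obtain ⟨x, hx⟩ := hM.exists_gram
  have hangle : ∀ i j, InnerProductGeometry.angle (x i) (x j) = Real.arccos (M i j / d) := by
    intro i j
    have hn : ∀ i, ‖x i‖ = √d := fun i => by
      rw [← hd i, hx, real_inner_self_eq_norm_sq, Real.sqrt_sq (norm_nonneg _)]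
    rw [InnerProductGeometry.angle, hn, hn, Real.mul_self_sqrt hd0, hx]
  set θ := Real.arccos (1 / (g : ℝ) / d) with hθ
  have hsum : ∀ k (hk : k < g),
      InnerProductGeometry.angle (x ⟨0, by omega⟩) (x ⟨k, hk⟩) ≤ k * θ := by
    intro k
    induction k with
    | zero => intro hk; rw [hangle, hd, div_self hdpos.ne']; simp
    | succ k ih =>
      intro hk
      refine (InnerProductGeometry.angle_le_angle_add_angle _ (x ⟨k, by omega⟩) _).trans ?_
      rw [hangle ⟨k, _⟩ ⟨k + 1, _⟩, hstep k hk]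
      push_cast
      linarith [ih (by omega)]
  have h1 := hsum (g - 1) (by omega)
  rw [hangle, hlast, neg_div, neg_div, Real.arccos_neg, ← hθ, Nat.cast_sub (by omega),
    Nat.cast_one] at h1
  have h2 : Real.pi / g ≤ θ := by
    rw [div_le_iff₀ hg0]; linarith
  have hcos := (cos_pi_div_mem_Ioo (show 3 ≤ g by omega)).1
  have h3 : 1 / (g : ℝ) / d ≤ Real.cos (Real.pi / g) := by
    rw [← Real.cos_arccos (x := 1 / (g : ℝ) / d)
      (by linarith [show 0 ≤ 1 / (g : ℝ) / d by positivity]) ((div_le_one hdpos).mpr hdg), ← hθ]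
    exact Real.cos_le_cos_of_nonneg_of_le_pi (by positivity) (Real.arccos_le_pi _) h2
  rw [div_le_iff₀ hdpos] at h3
  have h4 : 1 / (g : ℝ) * (1 / Real.cos (Real.pi / g)) ≤ d := by
    rw [mul_one_div, div_le_iff₀ hcos, mul_comm d]
    exact h3
  rw [mul_sub, mul_one]
  linarith

/-- The additive distance of the cycle and of the graphs of chordal girth `g`, if the upper bound
holds. -/
theorem additiveDistance_eq_of_embedding {V : Type*} [Fintype V] {G : SimpleGraph V} {g : ℕ}
    (hg : 4 ≤ g) (f : cycleGraph g ↪g G)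
    (hG : ∀ X : PartialMatrix G, X.IsLocallyPSD → X.trace = 1 →
      (X + (1 / (g : ℝ) * (1 / Real.cos (Real.pi / g) - 1)) •
        PartialMatrix.identity G).IsCompletable) :
    additiveDistance G = 1 / (g : ℝ) * (1 / Real.cos (Real.pi / g) - 1) ∧
      additiveDistance (cycleGraph g) = 1 / (g : ℝ) * (1 / Real.cos (Real.pi / g) - 1) := by
  have : Nonempty (Fin g) := ⟨⟨0, by omega⟩⟩
  have : Nonempty V := ‹Nonempty (Fin g)›.map f
  have hcomap : ∀ (X : PartialMatrix (cycleGraph g)) (ε : ℝ),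
      (X.extendZero f + ε • PartialMatrix.identity G).IsCompletable →
      (X + ε • PartialMatrix.identity (cycleGraph g)).IsCompletable := by
    intro X ε h
    have := h.comap (f := f.toHom)
    rwa [PartialMatrix.comap_add_identity f.injective, PartialMatrix.comap_extendZero] at this
  constructor
  · exact additiveDistance_eq hG ((isLocallyPSD_oddCycleMatrix hg).extendZero f)
      ((PartialMatrix.trace_extendZero f _).trans (trace_oddCycleMatrix hg))
      fun ε hε => le_of_isCompletable_oddCycleMatrix hg (hcomap _ ε hε)
  -- The cycle inherits its upper bound from `G`, by extending by zero, completing and restricting.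
  · exact additiveDistance_eq (fun X hX htr => hcomap X _ (hG _ (hX.extendZero f)
      ((PartialMatrix.trace_extendZero f _).trans htr))) (isLocallyPSD_oddCycleMatrix hg)
      (trace_oddCycleMatrix hg) fun ε hε => le_of_isCompletable_oddCycleMatrix hg hε

/-! ### Chordal girth and conclusion -/

theorem hasHole_of_chordalGirth_eq {V : Type*} {G : SimpleGraph V} {g : ℕ}
    (h : chordalGirth G = (g : ℕ∞)) : HasHole G g ∧ ∀ n, HasHole G n → g ≤ n := by
  have hne : {m : ℕ∞ | ∃ n : ℕ, HasHole G n ∧ m = (n : ℕ∞)}.Nonempty := by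
    by_contra hne
    rw [chordalGirth, Set.not_nonempty_iff_eq_empty.mp hne, sInf_empty] at h
    exact ENat.top_ne_natCast g h
  obtain ⟨n, hn, hgn⟩ := csInf_mem hne
  rw [chordalGirth] at h
  refine ⟨by rwa [Nat.cast_injective (h.symm.trans hgn)], fun n hn => ?_⟩
  have : (g : ℕ∞) ≤ n := h ▸ sInf_le ⟨n, hn, rfl⟩
  exact_mod_cast this

theorem isChordal_of_chordalGirth_eq_top {V : Type*} {G : SimpleGraph V}
    (h : chordalGirth G = ⊤) : IsChordal G := fun n hn =>
  ENat.natCast_ne_top n (sInf_eq_top.mp h _ ⟨n, hn, rfl⟩)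

theorem mainTheorem4 {V E : Type*} [Finite V] [Finite E] (D : Multidigraph V E)
    (hTriangleFree : D.undirected.CliqueFree 3) (hSP : IsSeriesParallel D.undirected)
    {W : E → Type*} [∀ e, Finite (W e)] (C : ∀ e, SimpleGraph (W e)) (T H : ∀ e, W e)
    (hTH : ∀ e, T e ≠ H e) (hConnected : ∀ e, (C e).Connected)
    (hChordal : ∀ e, IsChordal (C e)) (hThick : D.IsThickening C T H) :
    (∀ g : ℕ, chordalGirth (D.glue C T H) = (g : ℕ∞) →
      additiveDistance (D.glue C T H) = additiveDistance (SimpleGraph.cycleGraph g) ∧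
      additiveDistance (D.glue C T H) = 1 / (g : ℝ) * (1 / Real.cos (Real.pi / g) - 1)) ∧
    (chordalGirth (D.glue C T H) = ⊤ → Nontrivial (D.GlueVertex T H) →
      additiveDistance (D.glue C T H) = 0) := by
  refine ⟨fun g hg => ?_, fun h _ => (isChordal_of_chordalGirth_eq_top h).additiveDistance_eq_zero⟩
  obtain ⟨hole, hmin⟩ := hasHole_of_chordalGirth_eq hg
  obtain ⟨hg4, ⟨f⟩⟩ := hole.exists_embedding
  have h := additiveDistance_eq_of_embedding hg4 f fun X hX htr =>
    hThick.isCompletable_add hSP hTH hConnected hChordal (by omega) hmin hX htr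
  exact ⟨h.1.trans h.2.symm, h.1⟩
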